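/- \textbf{Theorem (prediction formula for MSDDEs).} \emph{Setting.} Let $(Z_t)_{t\in\mathbb R}$ be an $n$-dimensional measurable process with $\mathbb E\|Z_t\|<\infty$ for all $t$ and with stationary increments, and let $\eta=(\eta_{jk})$ be an $n\times n$ matrix of finite signed Borel measures on $\mathbb R$ concentrated on $[0,\infty)$. A stationary, integrable, measurable process $(X_t)_{t\in\mathbb R}$ is a solution of $dX_t=\eta\ast X(t)\,dt+dZ_t$ if, for each $s<t$, almost surely $$X^j_t-X^j_s=\sum_{k=1}^n\int_s^t\int_{[0,\infty)}X^k_{u-v}\,\eta_{jk}(dv)\,du+Z^j_t-Z^j_s,\qquad j=1,\dots,n.$$ Put $h(z)=-zI_n-\Big(\int_{[0,\infty)}e^{zu}\,\eta_{jk}(du)\Big)_{j,k}$ for $\operatorname{Re}z\le 0$. \emph{Assumptions.} Suppose that $\det h(z)\neq 0$ for all $z\in\mathbb C$ with $\operatorname{Re}z\le 0$ and that $\int u^2\,|\eta_{jk}|(du)<\infty$ for all $j,k$. Let $(X_t)_{t\in\mathbb R}$ be the stationary and integrable solution. Let $g:\mathbb R\to\mathbb R^{n\times n}$ be the kernel in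 $L^2$ whose Fourier transform (the $L^2$-extension of $\mathcal F[f](y)=\int_{\mathbb R}e^{iyu}f(u)\,du$) is $\mathcal F[g](y)=h(iy)^{-1}$ for almost every $y$; we take its right-continuous version. Fix $s<t$. \emph{Conclusion.} The function $g$ has bounded variation on $\mathbb R$, and so induces a finite signed Lebesgue--Stieltjes matrix measure $g(dv)$. The process $$\hat Z_u=\mathbb E[Z_u-Z_s\mid Z_s-Z_r,\ r<s],\qquad u>s,$$ has a version which is measurable in $(u,\omega)$. For every such version, the integrals below are almost surely well-defined (the inner ones for almost every $u\in(s,t]$), and almost surely $$\mathbb E[X_t\mid X_u,\ u\le s]=g(t-s)X_s+\int_s^t g(t-u)\,\eta\ast\{\mathbf 1_{(-\infty,s]}X\}(u)\,du+g\ast\{\mathbf 1_{(s,\infty)}\hat Z\}(t),$$ where, for $u>s$ and $j=1,\dots,n$, $$\big(\eta\ast\{\mathbf 1_{(-\infty,s]}X\}(u)\big)_j=\sum_{k=1}^n\int_{[u-s,\infty)}X^k_{u-v}\,\eta_{jk}(dv),\qquad \big(g\ast\{\mathbf 1_{(s,\infty)}\hat Z\}(u)\big)_j=\sum_{k=1}^n\int_{[0,u-s)}\hat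 Z^k_{u-v}\,g_{jk}(dv).$$ -/

import Mathlib

open MeasureTheory ProbabilityTheory Set
open scoped FourierTransform ENNReal

namespace MSDDE

noncomputable section

/-- Every entry of the finite signed matrix measure `η` is concentrated on `[0, ∞)`. -/
def ConcentratedOnNonneg {n : ℕ} (η : Matrix (Fin n) (Fin n) (SignedMeasure ℝ)) : Prop :=
  ∀ j k, (η j k).variation (Iio 0) = 0

/-- The matrix measure `η` has a moment of order `p`: `∫ |u|^p |η_{jk}|(du) < ∞`. -/
def HasMoment {n : ℕ} (η : Matrix (Fin n) (Fin n) (SignedMeasure ℝ)) (p : ℕ) : Prop :=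
  ∀ j k, VectorMeasure.Integrable (η j k) (fun u : ℝ => |u| ^ p)

/-- The Laplace transform `L[η](z)_{jk} = ∫ e^{zu} η_{jk}(du)`. -/
def laplace {n : ℕ} (η : Matrix (Fin n) (Fin n) (SignedMeasure ℝ)) (z : ℂ) :
    Matrix (Fin n) (Fin n) ℂ :=
  fun j k => ∫ᵛ u, Complex.exp (z * (u : ℂ)) ∂<•(η j k)

/-- The function `h(z) = -z I - L[η](z)`. -/
def hFun {n : ℕ} (η : Matrix (Fin n) (Fin n) (SignedMeasure ℝ)) (z : ℂ) :
    Matrix (Fin n) (Fin n) ℂ :=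
  -(z • (1 : Matrix (Fin n) (Fin n) ℂ)) - laplace η z

/-- The `L²` Fourier transform normalised as the extension of `F[f](y) = ∫ e^{iyu} f(u) du`.
Mathlib's transform `𝓕` extends `ξ ↦ ∫ e^{-2πiξu} f(u) du`, whence the change of variable. -/
def fourierL2 (f : Lp ℂ 2 (volume : Measure ℝ)) (y : ℝ) : ℂ :=
  (𝓕 f : Lp ℂ 2 (volume : Measure ℝ)) (-(y / (2 * Real.pi)))

/-- `g` is the kernel associated with `η`: it lies in `L²`, its Fourier transform is
`F[g](y) = h(iy)⁻¹`, and among the almost everywhere equal versions it is the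
right-continuous one. -/
structure IsKernel {n : ℕ} (η : Matrix (Fin n) (Fin n) (SignedMeasure ℝ))
    (g : ℝ → Matrix (Fin n) (Fin n) ℝ) : Prop where
  memLp : ∀ j k, MemLp (fun u : ℝ => ((g u j k : ℝ) : ℂ)) 2 volume
  fourier_eq : ∀ j k, ∀ᵐ y : ℝ,
    fourierL2 ((memLp j k).toLp _) y = (hFun η (Complex.I * (y : ℂ)))⁻¹ j k
  right_continuous : ∀ j k, ∀ u : ℝ, ContinuousWithinAt (fun r => g r j k) (Ici u) u

/-- A process is stationary if its law is invariant under time shifts. The law of a process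
is taken on the product σ-algebra, that is, it is given by the finite-dimensional distributions. -/
def IsStationary {n : ℕ} {Ω : Type*} [MeasurableSpace Ω] (μ : Measure Ω)
    (X : ℝ → Ω → Fin n → ℝ) : Prop :=
  ∀ a : ℝ, IdentDistrib (fun ω (r : ℝ) => X (r + a) ω) (fun ω (r : ℝ) => X r ω) μ μ

/-- A process has stationary increments if the law of `(Z_{r+a} - Z_a)_r` does not
depend on `a`. -/
def HasStationaryIncrements {n : ℕ} {Ω : Type*} [MeasurableSpace Ω] (μ : Measure Ω)
    (Z : ℝ → Ω → Fin n → ℝ) : Prop :=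
  ∀ a : ℝ, IdentDistrib (fun ω (r : ℝ) => Z (r + a) ω - Z a ω)
    (fun ω (r : ℝ) => Z r ω - Z 0 ω) μ μ

/-- `X` is a (measurable) stationary and integrable solution of `dX_t = (η ∗ X)(t) dt + dZ_t`. -/
structure IsStationarySolution {n : ℕ} {Ω : Type*} [MeasurableSpace Ω] (μ : Measure Ω)
    (η : Matrix (Fin n) (Fin n) (SignedMeasure ℝ)) (Z X : ℝ → Ω → Fin n → ℝ) : Prop where
  measurable : Measurable (fun p : ℝ × Ω => X p.1 p.2)
  integrable : ∀ r, Integrable (X r) μ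
  stationary : IsStationary μ X
  equation : ∀ s t : ℝ, s < t → ∀ᵐ ω ∂μ, ∀ j,
    X t ω j - X s ω j =
      (∑ k, ∫ u in s..t, ∫ᵛ v in Ici (0 : ℝ), X (u - v) ω k ∂<•(η j k)) + (Z t ω j - Z s ω j)

/-- The σ-algebra `σ(X_u : u ≤ s)`. -/
abbrev pastSigma {n : ℕ} {Ω : Type*} (X : ℝ → Ω → Fin n → ℝ) (s : ℝ) : MeasurableSpace Ω :=
  ⨆ u ∈ Iic s, MeasurableSpace.comap (X u) inferInstance

/-- The σ-algebra `σ(Z_s - Z_r : r < s)`. -/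
abbrev pastIncrements {n : ℕ} {Ω : Type*} (Z : ℝ → Ω → Fin n → ℝ) (s : ℝ) : MeasurableSpace Ω :=
  ⨆ r ∈ Iio s, MeasurableSpace.comap (fun ω => Z s ω - Z r ω) inferInstance

/-- `Zhat` is a measurable version of the process `u ↦ E[Z_u - Z_s | Z_s - Z_r, r < s]`, `u > s`.
(Each conditional expectation is only determined up to a null set, which may depend on `u`;
a measurable version is needed to integrate in `u`.) -/
structure IsNoisePrediction {n : ℕ} {Ω : Type*} [MeasurableSpace Ω] (μ : Measure Ω)
    (Z : ℝ → Ω → Fin n → ℝ) (s : ℝ) (Zhat : ℝ → Ω → Fin n → ℝ) : Prop where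
  measurable : Measurable (fun p : ℝ × Ω => Zhat p.1 p.2)
  ae_eq : ∀ u, s < u → Zhat u =ᵐ[μ] μ[fun ω => Z u ω - Z s ω | pastIncrements Z s]

/-- For a path `x`, the vector `(η ∗ {1_{(-∞,s]} x}(u))_j = ∑_k ∫_{[u-s,∞)} x^k_{u-v} η_{jk}(dv)`. -/
def delayConv {n : ℕ} (η : Matrix (Fin n) (Fin n) (SignedMeasure ℝ)) (x : ℝ → Fin n → ℝ)
    (s u : ℝ) : Fin n → ℝ :=
  fun j => ∑ k, ∫ᵛ v in Ici (u - s), x (u - v) k ∂<•(η j k)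

/-- For a path `z`, the vector `(g ∗ {1_{(s,∞)} z}(u))_j = ∑_k ∫_{[0,u-s)} z^k_{u-v} g_{jk}(dv)`,
the integrals being taken against the Lebesgue-Stieltjes measures of the entries of `g`. -/
def kernelConv {n : ℕ} (g : ℝ → Matrix (Fin n) (Fin n) ℝ)
    (hg : ∀ j k, BoundedVariationOn (fun r => g r j k) univ) (z : ℝ → Fin n → ℝ)
    (s u : ℝ) : Fin n → ℝ :=
  fun j => ∑ k, ∫ᵛ v in Ico (0 : ℝ) (u - s), z (u - v) k ∂<•((hg j k).vectorMeasure)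

end

end MSDDE

namespace MSDDE

/-! ### Signed measures as a sign times their variation. -/

section SignedMeasure

variable {α : Type*} [MeasurableSpace α]

/-! At infinity both h(z)⁻¹ and (1 − z)⁻¹, the transform of e^{-t} on [0, ∞), behave like −1/z.
Their difference `regSymbol` is therefore O(|z|⁻²) on the closed left half plane, and its inverse
Fourier transform is continuous. Cauchy's theorem makes that transform vanish on (−∞, 0]
(`fourierInv_axis_eq_zero`). The second moment of η provides two integrable derivatives in the
frequency, hence decay like 1/(1 + t²) (`exists_norm_fourierInv_le`). Adding e^{-t} back gives a
right-continuous function with transform h⁻¹; by injectivity of the L² transform and right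
continuity it is g (`ofReal_kernel`).

The identity z h⁻¹ = −1 − h⁻¹ L[η], read back in time, is the resolvent equation: g(T) is I plus the
integral of g ∗ η over [0, T] (`kernel_eq_integral`). So g is the distribution function of I δ_0 +
(g ∗ η)(v) dv; it has bounded variation and this is its Lebesgue–Stieltjes measure
(`vectorMeasure_kernel`). The same equation yields variation of constants: integrating the drift of
X against g over (s, t] expresses X_t through X_s, the path up to s and the increments Z_u − Z_s
with s < u ≤ t (`variation_of_constants`).

It remains to condition. The terms in X_s and in the path up to s are already determined by the past
of X. For the noise one needs that the past of X and the past increments of Z generate the same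
σ-algebra up to null sets (`condExp_pastIncrements`). The increments of Z are read off from X by the
equation. Conversely, start the variation of constants at r − N: by stationarity, the terms
involving X up to time r − N are controlled in L¹ by |g(N)| and by the integral of |g(b)| |η|([N −
b, ∞)) over b. Both tend to 0, so X_r is an L¹ limit of functions of the increments. Finally
conditional expectation commutes with the integral in u (`condExp_integral`), and the atom and the
density of g(dv) assemble the predicted noise into g ∗ {1_{(s,∞)} Ẑ}(t) (`kernelConv_eq`). -/

instance isFiniteMeasure_variation (η : SignedMeasure α) : IsFiniteMeasure η.variation := by
  rw [← SignedMeasure.totalVariation_eq_variation]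
  infer_instance

/-- The sign of a Hahn decomposition. Its modulus is one everywhere, not only almost everywhere, so
it can be inserted in any integrand or removed from it without exceptional sets. -/
theorem exists_sign (η : SignedMeasure α) : ∃ σ : α → ℝ, Measurable σ ∧ (∀ v, |σ v| = 1) ∧
    σ =ᵐ[η.toJordanDecomposition.posPart] (fun _ => 1) ∧
    σ =ᵐ[η.toJordanDecomposition.negPart] (fun _ => -1) := by
  classical
  obtain ⟨S, hS, h1, h2⟩ := η.toJordanDecomposition.mutuallySingular
  refine ⟨S.piecewise (fun _ => -1) (fun _ => 1),
    Measurable.piecewise hS measurable_const measurable_const, fun v => ?_, ?_, ?_⟩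
  · by_cases hv : v ∈ S <;> simp [hv]
  · filter_upwards [compl_mem_ae_iff.2 h1] with v hv
    exact Set.piecewise_eq_of_notMem _ _ _ hv
  · have h3 : S ∈ ae η.toJordanDecomposition.negPart := mem_ae_iff.2 h2
    filter_upwards [h3] with v hv
    exact Set.piecewise_eq_of_mem _ _ _ hv

/-- The density of a signed measure with respect to its variation, with values in `{-1, 1}`. -/
noncomputable def sgn (η : SignedMeasure α) : α → ℝ := (exists_sign η).choose

theorem measurable_sgn (η : SignedMeasure α) : Measurable (sgn η) := (exists_sign η).choose_spec.1

theorem abs_sgn (η : SignedMeasure α) (v : α) : |sgn η v| = 1 := (exists_sign η).choose_spec.2.1 v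

variable {G : Type*} [NormedAddCommGroup G] [NormedSpace ℝ G]

theorem integrable_sgn_smul_iff (η : SignedMeasure α) (m : Measure α) (f : α → G) :
    Integrable (fun v => sgn η v • f v) m ↔ Integrable f m := by
  have key : ∀ f : α → G, Integrable f m → Integrable (fun v => sgn η v • f v) m := fun f hf =>
    Integrable.bdd_smul hf 1 (measurable_sgn η).aestronglyMeasurable
      (Filter.Eventually.of_forall fun v => by rw [Real.norm_eq_abs, abs_sgn])
  refine ⟨fun h => ?_, key f⟩
  refine (key _ h).congr (Filter.Eventually.of_forall fun v => ?_)
  have h1 : sgn η v * sgn η v = 1 := by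
    rw [← abs_mul_abs_self, abs_sgn, one_mul]
  simp [smul_smul, h1]

/-- On the two Jordan parts the sign is 1 and −1. This turns integrals against a signed measure into
Bochner integrals against a finite positive measure, where Fubini and dominated convergence apply.
For a non-integrable f both sides take the default value 0. -/
theorem integral_signedMeasure (η : SignedMeasure α) (f : α → G) :
    ∫ᵛ v, f v ∂<•η = ∫ v, sgn η v • f v ∂η.variation := by
  by_cases hf : η.Integrable f
  swap
  · rw [VectorMeasure.integral_undef hf, integral_undef]
    rwa [integrable_sgn_smul_iff]
  obtain ⟨-, -, hp, hn⟩ := (exists_sign η).choose_spec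
  have hv : η.variation = η.toJordanDecomposition.posPart + η.toJordanDecomposition.negPart := by
    rw [← SignedMeasure.totalVariation_eq_variation]; rfl
  have hη : η = η.toJordanDecomposition.posPart.toSignedMeasure
      - η.toJordanDecomposition.negPart.toSignedMeasure :=
    (SignedMeasure.toSignedMeasure_toJordanDecomposition η).symm
  have hf' : Integrable f η.variation := hf
  rw [hv, integrable_add_measure] at hf'
  have hs : Integrable (fun v => sgn η v • f v) η.variation := (integrable_sgn_smul_iff _ _ _).2 hf
  rw [hv, integrable_add_measure] at hs
  calc ∫ᵛ v, f v ∂<•η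
      = ∫ᵛ v, f v ∂<•(η.toJordanDecomposition.posPart.toSignedMeasure
        - η.toJordanDecomposition.negPart.toSignedMeasure) := by rw [← hη]
    _ = ∫ v, f v ∂η.toJordanDecomposition.posPart - ∫ v, f v ∂η.toJordanDecomposition.negPart := by
        rw [VectorMeasure.integral_sub_vectorMeasure, VectorMeasure.integral_toSignedMeasure,
          VectorMeasure.integral_toSignedMeasure]
        · simpa [VectorMeasure.Integrable, Measure.variation_toSignedMeasure] using hf'.1
        · simpa [VectorMeasure.Integrable, Measure.variation_toSignedMeasure] using hf'.2
    _ = ∫ v, sgn η v • f v ∂η.variation := by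
        rw [hv, integral_add_measure hs.1 hs.2]
        have e1 : ∫ v, sgn η v • f v ∂η.toJordanDecomposition.posPart
            = ∫ v, f v ∂η.toJordanDecomposition.posPart := by
          apply integral_congr_ae
          filter_upwards [hp] with v h
          rw [sgn, h, one_smul]
        have e2 : ∫ v, sgn η v • f v ∂η.toJordanDecomposition.negPart
            = - ∫ v, f v ∂η.toJordanDecomposition.negPart := by
          rw [← integral_neg]
          apply integral_congr_ae
          filter_upwards [hn] with v h
          rw [sgn, h, neg_one_smul]
        rw [e1, e2, sub_eq_add_neg]

theorem setIntegral_signedMeasure (η : SignedMeasure α) {S : Set α} (hS : MeasurableSet S)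
    (f : α → G) : ∫ᵛ v in S, f v ∂<•η = ∫ v in S, sgn η v • f v ∂η.variation := by
  rw [← VectorMeasure.integral_indicator hS, integral_signedMeasure, ← integral_indicator hS]
  congr 1
  ext v
  by_cases hv : v ∈ S <;> simp [hv]

omit [NormedSpace ℝ G] in
theorem integrableOn_signedMeasure_iff (η : SignedMeasure α) {S : Set α} (hS : MeasurableSet S)
    (f : α → G) : VectorMeasure.IntegrableOn η f S ↔ IntegrableOn f S η.variation := by
  rw [← VectorMeasure.integrable_indicator_iff hS, ← integrable_indicator_iff hS]

theorem integrable_withDensityᵥ {m : Measure α} {κ : α → ℝ} (hκ : Integrable κ m) {f : α → G}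
    (hf : AEStronglyMeasurable f m) (hf' : Integrable (fun v => κ v • f v) m) :
    VectorMeasure.Integrable (m.withDensityᵥ κ) f := by
  rw [VectorMeasure.Integrable, Measure.variation_withDensityᵥ hκ]
  refine ⟨hf.mono_ac (withDensity_absolutelyContinuous _ _), ?_⟩
  rw [HasFiniteIntegral, lintegral_withDensity_eq_lintegral_mul₀' hκ.1.enorm (hf.enorm.mono_ac
    (withDensity_absolutelyContinuous _ _))]
  simpa [HasFiniteIntegral, enorm_smul] using hf'.2

/-- The positive and negative parts of κ are dominated by |κ|, so the integrals against the two
positive measures are finite separately and may be subtracted. -/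
theorem integral_withDensityᵥ [CompleteSpace G] {m : Measure α} {κ : α → ℝ} (hκ : Integrable κ m)
    (hκm : Measurable κ) {f : α → G}
    (hf : AEStronglyMeasurable f m) (hf' : Integrable (fun v => κ v • f v) m) :
    ∫ᵛ v, f v ∂<•(m.withDensityᵥ κ) = ∫ v, κ v • f v ∂m := by
  have h1 := isFiniteMeasure_withDensity_ofReal hκ.2
  have h2 := isFiniteMeasure_withDensity_ofReal hκ.neg.2
  have hp : Integrable (fun v => (ENNReal.ofReal (κ v)).toReal • f v) m := by
    refine hf'.mono ((hκm.ennreal_ofReal.ennreal_toReal).aestronglyMeasurable.smul hf)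
      (Filter.Eventually.of_forall fun v => ?_)
    rw [norm_smul, norm_smul]
    gcongr
    rw [ENNReal.toReal_ofReal', Real.norm_eq_abs, Real.norm_eq_abs, abs_le]
    grind
  have hn : Integrable (fun v => (ENNReal.ofReal (-κ v)).toReal • f v) m := by
    refine hf'.mono ((hκm.neg.ennreal_ofReal.ennreal_toReal).aestronglyMeasurable.smul hf)
      (Filter.Eventually.of_forall fun v => ?_)
    rw [norm_smul, norm_smul]
    gcongr
    rw [ENNReal.toReal_ofReal', Real.norm_eq_abs, Real.norm_eq_abs, abs_le]
    grind
  rw [withDensityᵥ_eq_withDensity_pos_part_sub_withDensity_neg_part hκ,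
    VectorMeasure.integral_sub_vectorMeasure, VectorMeasure.integral_toSignedMeasure,
    VectorMeasure.integral_toSignedMeasure,
    integral_withDensity_eq_integral_toReal_smul hκm.ennreal_ofReal (by simp),
    integral_withDensity_eq_integral_toReal_smul (f := fun v => ENNReal.ofReal (-κ v))
      hκm.neg.ennreal_ofReal (by simp),
    ← integral_sub hp hn]
  · congr 1
    ext v
    rw [← sub_smul, ENNReal.toReal_ofReal', ENNReal.toReal_ofReal']
    congr 1
    grind
  · rw [VectorMeasure.Integrable, Measure.variation_toSignedMeasure,
      integrable_withDensity_iff_integrable_smul' hκm.ennreal_ofReal (by simp)]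
    exact hp
  · rw [VectorMeasure.Integrable, Measure.variation_toSignedMeasure,
      integrable_withDensity_iff_integrable_smul' (f := fun v => ENNReal.ofReal (-κ v))
        hκm.neg.ennreal_ofReal (by simp)]
    exact hn

end SignedMeasure


/-! ### Conditional expectations: measurable versions, parameter integrals, change of σ-algebra. -/

section CondExp

variable {Ω : Type*} {m m₀ : MeasurableSpace Ω} {μ : Measure Ω}

/-- Monotone convergence: the supremum of the conditional expectations is m-measurable and has the
required integral over each event of m. -/
theorem condLExp_iSup [IsFiniteMeasure μ] (hm : m ≤ m₀) {f : ℕ → Ω → ℝ≥0∞}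
    (hf : ∀ n, Measurable (f n)) (hmono : Monotone f) :
    μ⁻[⨆ n, f n | m] =ᵐ[μ] ⨆ n, μ⁻[f n | m] := by
  symm
  have h0 : Measurable[m] (⨆ n, μ⁻[f n | m]) := by
    rw [show (⨆ n, μ⁻[f n | m]) = fun ω => ⨆ n, μ⁻[f n | m] ω by ext; simp]
    exact Measurable.iSup fun n => measurable_condLExp _ _ _
  refine ae_eq_condLExp (hm := hm) μ _ h0 fun A hA => ?_
  have h1 : ∀ᵐ ω ∂μ, Monotone fun n => μ⁻[f n | m] ω := by
    have : ∀ n, μ⁻[f n | m] ≤ᵐ[μ] μ⁻[f (n + 1) | m] := fun n =>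
      condLExp_mono (Filter.Eventually.of_forall (hmono n.le_succ))
    filter_upwards [ae_all_iff.2 this] with ω h
    exact monotone_nat_of_le_succ h
  have h2 : ∀ n, Measurable (μ⁻[f n | m]) := fun n => (measurable_condLExp _ _ _).mono hm le_rfl
  simp only [iSup_apply]
  rw [lintegral_iSup' (fun n => (h2 n).aemeasurable) (ae_restrict_of_ae h1),
    lintegral_iSup hf hmono]
  exact iSup_congr fun n => setLIntegral_condLExp hm μ (f n) hA

/-- Each conditional expectation is fixed only up to a null set depending on u, so a jointly
measurable choice has to be built. For a rectangle A × B it is 1_A(u) times a conditional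
probability of B; complements and disjoint unions follow by linearity. -/
theorem exists_measurable_condLExp_indicator [IsFiniteMeasure μ] (hm : m ≤ m₀)
    {U : Type*} [MeasurableSpace U] {S : Set (U × Ω)} (hS : MeasurableSet S) :
    ∃ F : U × Ω → ℝ≥0∞, Measurable F ∧
      ∀ u, (fun ω => F (u, ω)) =ᵐ[μ] μ⁻[fun ω => S.indicator 1 (u, ω) | m] := by
  have hsec : ∀ {S : Set (U × Ω)}, MeasurableSet S → ∀ u,
      Measurable fun ω => S.indicator (1 : U × Ω → ℝ≥0∞) (u, ω) := fun hS u =>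
    (measurable_one.indicator hS).comp measurable_prodMk_left
  induction S, hS using MeasurableSpace.induction_on_inter generateFrom_prod.symm
    isPiSystem_prod with
  | empty =>
    refine ⟨0, measurable_const, fun u => ?_⟩
    have := condLExp_zero (mΩ := m) μ
    simp only [indicator_empty]
    rw [show (fun _ : Ω => (0 : ℝ≥0∞)) = 0 from rfl, this]
    rfl
  | basic S hS =>
    obtain ⟨A, hA, B, hB, rfl⟩ := hS
    refine ⟨fun p => A.indicator 1 p.1 * μ⁻[B.indicator 1 | m] p.2,
      ((measurable_one.indicator hA).comp measurable_fst).mul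
        (((measurable_condLExp _ _ _).mono hm le_rfl).comp measurable_snd), fun u => ?_⟩
    by_cases hu : u ∈ A
    · refine Filter.EventuallyEq.of_eq ?_
      have h0 : (fun ω => (A ×ˢ B).indicator (1 : U × Ω → ℝ≥0∞) (u, ω))
          = B.indicator (1 : Ω → ℝ≥0∞) := by
        ext ω
        by_cases hω : ω ∈ B <;> simp [hu, hω]
      simp [hu, h0]
    · have := condLExp_zero (mΩ := m) μ
      have h0 : (fun ω => (A ×ˢ B).indicator (1 : U × Ω → ℝ≥0∞) (u, ω)) = 0 := by
        ext ω; simp [hu]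
      rw [h0, this]
      refine Filter.EventuallyEq.of_eq ?_
      ext ω; simp [hu]
  | compl S hS ih =>
    obtain ⟨F, hF, hF'⟩ := ih
    refine ⟨fun p => 1 - F p, measurable_const.sub hF, fun u => ?_⟩
    have h1 := condLExp_add_left (mΩ := m) (P := μ)
      (X := fun ω => Sᶜ.indicator (1 : U × Ω → ℝ≥0∞) (u, ω))
      (fun ω => S.indicator (1 : U × Ω → ℝ≥0∞) (u, ω)) (hsec hS.compl u).aemeasurable
    have h2 : (fun ω => Sᶜ.indicator (1 : U × Ω → ℝ≥0∞) (u, ω))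
        + (fun ω => S.indicator (1 : U × Ω → ℝ≥0∞) (u, ω)) = fun _ => 1 := by
      ext ω
      by_cases h : (u, ω) ∈ S <;> simp [h]
    rw [h2, condLExp_const hm] at h1
    -- Finiteness is needed because subtraction in `ℝ≥0∞` undoes addition only for finite terms.
    have h3 : ∀ᵐ ω ∂μ, μ⁻[fun ω => S.indicator (1 : U × Ω → ℝ≥0∞) (u, ω) | m] ω ≠ ∞ := by
      refine condLExp_ne_top (ne_top_of_le_ne_top (measure_ne_top μ univ) ?_)
      calc _ ≤ ∫⁻ _ : Ω, 1 ∂μ := lintegral_mono fun ω => by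
            by_cases h : (u, ω) ∈ S <;> simp [h]
        _ = μ univ := by simp
    filter_upwards [h1, h3, hF' u] with ω h1 h3 h4
    rw [h4]
    symm
    exact ENNReal.eq_sub_of_add_eq h3 h1.symm
  | iUnion S hd hS ih =>
    choose F hF hF' using ih
    refine ⟨fun p => ∑' i, F i p, Measurable.tsum hF, fun u => ?_⟩
    have h1 := condLExp_tsum (P := μ) m
      (X := fun i ω => (S i).indicator (1 : U × Ω → ℝ≥0∞) (u, ω))
      fun i => (hsec (hS i) u).aemeasurable
    have h2 : (∑' i, fun ω => (S i).indicator (1 : U × Ω → ℝ≥0∞) (u, ω))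
        = fun ω => (⋃ i, S i).indicator 1 (u, ω) := by
      ext ω
      rw [ENNReal.tsum_apply]
      by_cases h : (u, ω) ∈ ⋃ i, S i
      · obtain ⟨i, hi⟩ := mem_iUnion.1 h
        rw [tsum_eq_single i fun j hj => indicator_of_notMem
          (fun hj' => (disjoint_left.1 (hd hj) hj' hi).elim) _]
        simp [hi, h]
      · rw [indicator_of_notMem h]
        simp only [mem_iUnion, not_exists] at h
        simp [h]
    rw [← h2]
    filter_upwards [h1, ae_all_iff.2 fun i => hF' i u] with ω h1 h3
    rw [h1, ENNReal.tsum_apply]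
    exact tsum_congr h3

theorem exists_measurable_condLExp [IsFiniteMeasure μ] (hm : m ≤ m₀)
    {U : Type*} [MeasurableSpace U] {f : U × Ω → ℝ≥0∞} (hf : Measurable f) :
    ∃ F : U × Ω → ℝ≥0∞, Measurable F ∧
      ∀ u, (fun ω => F (u, ω)) =ᵐ[μ] μ⁻[fun ω => f (u, ω) | m] := by
  refine Measurable.ennreal_induction (motive := fun f => ∃ F : U × Ω → ℝ≥0∞, Measurable F ∧
      ∀ u, (fun ω => F (u, ω)) =ᵐ[μ] μ⁻[fun ω => f (u, ω) | m]) ?_ ?_ ?_ hf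
  · intro c S hS
    obtain ⟨F, hF, hF'⟩ := exists_measurable_condLExp_indicator (μ := μ) hm hS
    refine ⟨fun p => c * F p, hF.const_mul c, fun u => ?_⟩
    have h1 := condLExp_smul (P := μ) (mΩ := m) (fun ω => S.indicator (1 : U × Ω → ℝ≥0∞) (u, ω))
      ((measurable_one.indicator hS).comp measurable_prodMk_left).aemeasurable c
    have h2 : (fun ω => S.indicator (fun _ => c) (u, ω))
        = c • (fun ω => S.indicator (1 : U × Ω → ℝ≥0∞) (u, ω)) := by
      ext ω
      by_cases h : (u, ω) ∈ S <;> simp [h]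
    rw [h2]
    filter_upwards [h1, hF' u] with ω h1 h3
    rw [h1, h3]
    rfl
  · rintro f g - hf - ⟨F, hF, hF'⟩ ⟨G, hG, hG'⟩
    refine ⟨F + G, hF.add hG, fun u => ?_⟩
    have h1 := condLExp_add_left (P := μ) (mΩ := m) (X := fun ω => f (u, ω))
      (fun ω => g (u, ω)) (hf.comp measurable_prodMk_left).aemeasurable
    filter_upwards [h1, hF' u, hG' u] with ω h1 h3 h4
    simp only [Pi.add_apply, h3, h4]
    exact h1.symm
  · intro f hf hmono ih
    choose F hF hF' using ih
    refine ⟨fun p => ⨆ i, F i p, Measurable.iSup hF, fun u => ?_⟩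
    have h1 := condLExp_iSup (μ := μ) hm (f := fun i ω => f i (u, ω))
      (fun i => (hf i).comp measurable_prodMk_left) (fun i j h ω => hmono h (u, ω))
    have h2 : (⨆ i, fun ω => f i (u, ω)) = fun ω => (⨆ i, f i (u, ω)) := by
      ext ω; simp
    rw [← h2]
    filter_upwards [h1, ae_all_iff.2 fun i => hF' i u] with ω h1 h3
    rw [h1, iSup_apply]
    exact iSup_congr h3

theorem exists_measurable_condExp [IsFiniteMeasure μ] (hm : m ≤ m₀)
    {U : Type*} [MeasurableSpace U] {f : U × Ω → ℝ} (hf : Measurable f) :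
    ∃ F : U × Ω → ℝ, Measurable F ∧
      ∀ u, Integrable (fun ω => f (u, ω)) μ →
        (fun ω => F (u, ω)) =ᵐ[μ] μ[fun ω => f (u, ω) | m] := by
  obtain ⟨F, hF, hF'⟩ := exists_measurable_condLExp (μ := μ) hm hf.ennreal_ofReal
  obtain ⟨G, hG, hG'⟩ := exists_measurable_condLExp (μ := μ) hm hf.neg.ennreal_ofReal
  refine ⟨fun p => (F p).toReal - (G p).toReal, hF.ennreal_toReal.sub hG.ennreal_toReal,
    fun u hu => ?_⟩
  have hfu : Measurable fun ω => f (u, ω) := hf.comp measurable_prodMk_left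
  have h1 := toReal_condLExp m (μ := μ) (f := fun ω => ENNReal.ofReal (f (u, ω)))
    hfu.ennreal_ofReal.aemeasurable hu.lintegral_lt_top.ne
  have h2 := toReal_condLExp m (μ := μ) (f := fun ω => ENNReal.ofReal (-f (u, ω)))
    hfu.neg.ennreal_ofReal.aemeasurable hu.neg.lintegral_lt_top.ne
  have i1 : Integrable (fun ω => (ENNReal.ofReal (f (u, ω))).toReal) μ :=
    integrable_toReal_of_lintegral_ne_top hfu.ennreal_ofReal.aemeasurable hu.lintegral_lt_top.ne
  have i2 : Integrable (fun ω => (ENNReal.ofReal (-f (u, ω))).toReal) μ :=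
    integrable_toReal_of_lintegral_ne_top hfu.neg.ennreal_ofReal.aemeasurable
      hu.neg.lintegral_lt_top.ne
  have h3 := condExp_sub i1 i2 m
  have h4 : ((fun ω => (ENNReal.ofReal (f (u, ω))).toReal)
      - fun ω => (ENNReal.ofReal (-f (u, ω))).toReal) = fun ω => f (u, ω) := by
    ext ω
    simp only [Pi.sub_apply, ENNReal.toReal_ofReal']
    grind
  rw [h4] at h3
  filter_upwards [h1, h2, h3, hF' u, hG' u] with ω h1 h2 h3 h5 h6
  rw [h3, h5, h6, Pi.sub_apply, ← h1, ← h2]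
  rfl

/-- Self-adjointness of conditional expectation. The event A belongs to m₀ and not necessarily to m,
so the conditioning moves from F to the indicator of A. -/
theorem setIntegral_condExp_eq_integral_mul [IsFiniteMeasure μ] (hm : m ≤ m₀) {F : Ω → ℝ}
    (hF : Integrable F μ) {A : Set Ω} (hA : MeasurableSet A) :
    ∫ ω in A, (μ[F | m]) ω ∂μ = ∫ ω, (μ[A.indicator 1 | m]) ω * F ω ∂μ := by
  have hA1 : Integrable (A.indicator (1 : Ω → ℝ)) μ :=
    (integrable_const (1 : ℝ)).indicator hA
  have hb : ∀ᵐ ω ∂μ, ‖(μ[A.indicator (1 : Ω → ℝ) | m]) ω‖ ≤ 1 := by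
    have := ae_bdd_abs_condExp_of_ae_bdd_abs (m := m) (μ := μ) (R := 1) (f := A.indicator (1 : Ω → ℝ))
      (Filter.Eventually.of_forall fun ω => by by_cases h : ω ∈ A <;> simp [h])
    simpa using this
  have h1 : Integrable (A.indicator (1 : Ω → ℝ) * μ[F | m]) μ :=
    integrable_condExp.bdd_mul (c := 1) hA1.1
      (Filter.Eventually.of_forall fun ω => by by_cases h : ω ∈ A <;> simp [h])
  have h2 := condExp_mul_of_aestronglyMeasurable_right (m := m) (μ := μ)
    (stronglyMeasurable_condExp (m := m) (f := F)).aestronglyMeasurable h1 hA1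
  have h3 := condExp_stronglyMeasurable_mul_of_bound hm
    (stronglyMeasurable_condExp (m := m) (μ := μ) (f := A.indicator (1 : Ω → ℝ))) hF 1 hb
  calc ∫ ω in A, (μ[F | m]) ω ∂μ
      = ∫ ω, (A.indicator (1 : Ω → ℝ) * μ[F | m]) ω ∂μ := by
        rw [← integral_indicator hA]
        congr 1
        ext ω
        by_cases h : ω ∈ A <;> simp [h]
    _ = ∫ ω, (μ[A.indicator (1 : Ω → ℝ) * μ[F | m] | m]) ω ∂μ := (integral_condExp hm).symm
    _ = ∫ ω, (μ[μ[A.indicator (1 : Ω → ℝ) | m] * F | m]) ω ∂μ :=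
        integral_congr_ae (h2.trans h3.symm)
    _ = _ := integral_condExp hm

variable {E : Type*} [MeasurableSpace E] {l : Measure E} [SFinite l]

/-- A parameter integral of `m`-measurable random variables is `m`-measurable. -/
theorem aestronglyMeasurable_integral [IsFiniteMeasure μ] (hm : m ≤ m₀) {Y : E → Ω → ℝ}
    (hY : Integrable (fun p : E × Ω => Y p.1 p.2) (l.prod μ))
    (hYm : ∀ᵐ e ∂l, AEStronglyMeasurable[m] (Y e) μ) :
    AEStronglyMeasurable[m] (fun ω => ∫ e, Y e ω ∂l) μ := by
  have hF : Integrable (fun ω => ∫ e, Y e ω ∂l) μ := hY.integral_prod_right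
  suffices h : (fun ω => ∫ e, Y e ω ∂l) =ᵐ[μ] μ[fun ω => ∫ e, Y e ω ∂l | m] from
    ⟨_, stronglyMeasurable_condExp, h⟩
  -- Two integrable variables with equal integrals over all events of m₀ agree. Moving the
  -- conditioning onto the indicator of A lets Fubini reach each `Y e`, which is its own conditional
  -- expectation.
  refine hF.ae_eq_of_forall_setIntegral_eq _ _ integrable_condExp fun A hA _ => ?_
  rw [setIntegral_condExp_eq_integral_mul hm hF hA]
  set W := μ[A.indicator (1 : Ω → ℝ) | m]
  have hb : ∀ᵐ ω ∂μ, ‖W ω‖ ≤ 1 := by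
    have := ae_bdd_abs_condExp_of_ae_bdd_abs (m := m) (μ := μ) (R := 1) (f := A.indicator (1 : Ω → ℝ))
      (Filter.Eventually.of_forall fun ω => by by_cases h : ω ∈ A <;> simp [h])
    simpa using this
  have hWm : AEStronglyMeasurable (fun p : E × Ω => W p.2) (l.prod μ) :=
    ((stronglyMeasurable_condExp.mono hm).comp_measurable measurable_snd).aestronglyMeasurable
  have hWY : Integrable (fun p : E × Ω => W p.2 * Y p.1 p.2) (l.prod μ) :=
    hY.bdd_mul (c := 1) hWm (Measure.quasiMeasurePreserving_snd.ae hb)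
  have hAY : Integrable (fun p : E × Ω => Y p.1 p.2) (l.prod (μ.restrict A)) :=
    hY.mono_measure (Measure.prod_mono le_rfl Measure.restrict_le_self)
  calc ∫ ω in A, ∫ e, Y e ω ∂l ∂μ = ∫ e, ∫ ω in A, Y e ω ∂μ ∂l :=
        (integral_integral_swap hAY).symm
    _ = ∫ e, ∫ ω, W ω * Y e ω ∂μ ∂l := by
        refine integral_congr_ae ?_
        filter_upwards [hYm, hY.prod_right_ae] with e he hei
        rw [← setIntegral_condExp_eq_integral_mul hm hei hA]
        exact setIntegral_congr_ae hA (by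
          filter_upwards [condExp_of_aestronglyMeasurable' hm he hei] with ω h _ using h.symm)
    _ = ∫ ω, ∫ e, W ω * Y e ω ∂l ∂μ := integral_integral_swap hWY
    _ = ∫ ω, W ω * ∫ e, Y e ω ∂l ∂μ := by simp_rw [integral_const_mul]

/-- Conditional expectation contracts L¹ for almost every e, so the iterated integral of |Y'| is at
most that of |Y|. -/
theorem integrable_prod_of_condExp [IsFiniteMeasure μ] {Y Y' : E → Ω → ℝ}
    (hY : Integrable (fun p : E × Ω => Y p.1 p.2) (l.prod μ))
    (hY' : AEStronglyMeasurable (fun p : E × Ω => Y' p.1 p.2) (l.prod μ))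
    (h : ∀ᵐ e ∂l, Y' e =ᵐ[μ] μ[Y e | m]) :
    Integrable (fun p : E × Ω => Y' p.1 p.2) (l.prod μ) := by
  rw [integrable_prod_iff hY']
  refine ⟨?_, ?_⟩
  · filter_upwards [h] with e he
    exact integrable_condExp.congr he.symm
  · refine hY.integral_norm_prod_left.mono hY'.norm.integral_prod_right' ?_
    filter_upwards [h, hY.prod_right_ae] with e he hei
    rw [Real.norm_of_nonneg (integral_nonneg fun _ => norm_nonneg _),
      Real.norm_of_nonneg (integral_nonneg fun _ => norm_nonneg _)]
    calc ∫ ω, ‖Y' e ω‖ ∂μ = ∫ ω, |(μ[Y e | m]) ω| ∂μ :=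
          integral_congr_ae (by filter_upwards [he] with ω h; rw [h, Real.norm_eq_abs])
      _ ≤ ∫ ω, |Y e ω| ∂μ := integral_abs_condExp_le _
      _ = _ := rfl

/-- Conditional expectation commutes with parameter integrals. -/
theorem condExp_integral [IsFiniteMeasure μ] (hm : m ≤ m₀) {Y Y' : E → Ω → ℝ}
    (hY : Integrable (fun p : E × Ω => Y p.1 p.2) (l.prod μ))
    (hY' : AEStronglyMeasurable (fun p : E × Ω => Y' p.1 p.2) (l.prod μ))
    (h : ∀ᵐ e ∂l, Y' e =ᵐ[μ] μ[Y e | m]) :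
    μ[fun ω => ∫ e, Y e ω ∂l | m] =ᵐ[μ] fun ω => ∫ e, Y' e ω ∂l := by
  have hYi := integrable_prod_of_condExp hY hY' h
  symm
  refine ae_eq_condExp_of_forall_setIntegral_eq hm hY.integral_prod_right
    (fun A _ _ => hYi.integral_prod_right.integrableOn) (fun A hA _ => ?_)
    (aestronglyMeasurable_integral hm hYi (by
      filter_upwards [h] with e he
      exact ⟨_, stronglyMeasurable_condExp, he⟩))
  have h1 : ∀ {Y : E → Ω → ℝ}, Integrable (fun p : E × Ω => Y p.1 p.2) (l.prod μ) →
      ∫ ω in A, ∫ e, Y e ω ∂l ∂μ = ∫ e, ∫ ω in A, Y e ω ∂μ ∂l := fun hY =>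
    (integral_integral_swap
      (hY.mono_measure (Measure.prod_mono le_rfl Measure.restrict_le_self))).symm
  rw [h1 hYi, h1 hY]
  refine integral_congr_ae ?_
  filter_upwards [h, hY.prod_right_ae] with e he hei
  rw [← setIntegral_condExp hm hei hA]
  exact setIntegral_congr_ae (hm _ hA) (by filter_upwards [he] with ω h _ using h)

theorem condExp_ae_eq_of_le_of_le {m' : MeasurableSpace Ω} [IsFiniteMeasure μ] (hm : m ≤ m')
    (hm' : m' ≤ m₀)
    (h : ∀ A, MeasurableSet[m'] A → ∃ B, MeasurableSet[m] B ∧ A =ᵐ[μ] B) {f : Ω → ℝ}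
    (hf : Integrable f μ) : μ[f | m] =ᵐ[μ] μ[f | m'] := by
  refine ae_eq_condExp_of_forall_setIntegral_eq hm' hf
    (fun A _ _ => integrable_condExp.integrableOn) (fun A hA _ => ?_)
    (stronglyMeasurable_condExp.mono hm).aestronglyMeasurable
  obtain ⟨B, hB, hAB⟩ := h A hA
  rw [setIntegral_congr_set hAB, setIntegral_congr_set hAB, setIntegral_condExp (hm.trans hm') hf hB]

/-- Both sides are compared with conditioning on the events of m₀ that differ from an event of m by
a null set. The intersection with m₀ is taken because a set differing from such an event by a null
set need not lie in m₀. -/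
theorem condExp_ae_eq_of_ae_eq_sets {m' : MeasurableSpace Ω} [IsFiniteMeasure μ] (hm : m ≤ m₀)
    (hm' : m' ≤ m₀) (h : m ≤ eventuallyMeasurableSpace m' (ae μ))
    (h' : m' ≤ eventuallyMeasurableSpace m (ae μ)) {f : Ω → ℝ}
    (hf : Integrable f μ) : μ[f | m] =ᵐ[μ] μ[f | m'] := by
  have key : ∀ A, MeasurableSet[eventuallyMeasurableSpace m (ae μ) ⊓ m₀] A →
      ∃ B, MeasurableSet[m] B ∧ A =ᵐ[μ] B := fun A hA =>
    (MeasurableSpace.measurableSet_inf.1 hA).1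
  have h1 := condExp_ae_eq_of_le_of_le (μ := μ) (m := m)
    (m' := eventuallyMeasurableSpace m (ae μ) ⊓ m₀)
    (le_inf le_eventuallyMeasurableSpace hm) inf_le_right key hf
  have h2 := condExp_ae_eq_of_le_of_le (μ := μ) (m := m')
    (m' := eventuallyMeasurableSpace m (ae μ) ⊓ m₀)
    (le_inf h' hm') inf_le_right (fun A hA => by
      obtain ⟨B, hB, hAB⟩ := key A hA
      obtain ⟨C, hC, hBC⟩ := h B hB
      exact ⟨C, hC, hAB.trans hBC⟩) hf
  exact h1.trans h2.symm

/-- Replacing f by an m-measurable version changes each preimage by a null set. Inclusions of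
generated σ-algebras modulo null sets thus reduce to measurability of the generators. -/
theorem comap_le_eventuallyMeasurableSpace {β : Type*} [MeasurableSpace β] [TopologicalSpace β]
    [TopologicalSpace.PseudoMetrizableSpace β] [BorelSpace β]
    {f : Ω → β} (hf : AEStronglyMeasurable[m] f μ) :
    MeasurableSpace.comap f inferInstance ≤ eventuallyMeasurableSpace m (ae μ) := by
  rintro _ ⟨B, hB, rfl⟩
  refine ⟨hf.mk f ⁻¹' B, hf.stronglyMeasurable_mk.measurable hB, ?_⟩
  filter_upwards [hf.ae_eq_mk] with ω h
  change (f ω ∈ B) = (hf.mk f ω ∈ B)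
  rw [h]

end CondExp


/-! ### Laplace transforms of scalar signed measures. -/

section Symbol

open Complex Filter

/-- The Laplace transform of a signed measure. -/
noncomputable def lap (η : SignedMeasure ℝ) (z : ℂ) : ℂ := ∫ u, sgn η u • exp (z * u) ∂η.variation

theorem laplace_apply {n : ℕ} (η : Matrix (Fin n) (Fin n) (SignedMeasure ℝ)) (z : ℂ)
    (j k : Fin n) : laplace η z j k = lap (η j k) z :=
  integral_signedMeasure _ _

theorem hFun_apply {n : ℕ} (η : Matrix (Fin n) (Fin n) (SignedMeasure ℝ)) (z : ℂ)
    (j k : Fin n) : hFun η z j k = -(z * (1 : Matrix (Fin n) (Fin n) ℂ) j k) - lap (η j k) z := by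
  rw [← laplace_apply]; rfl

variable {η : SignedMeasure ℝ}

theorem ae_nonneg (hη : η.variation (Iio 0) = 0) : ∀ᵐ u ∂η.variation, 0 ≤ u := by
  filter_upwards [compl_mem_ae_iff.2 hη] with u hu
  simpa using hu

theorem norm_sgn_smul {E : Type*} [NormedAddCommGroup E] [NormedSpace ℝ E] (η : SignedMeasure ℝ)
    (u : ℝ) (x : E) : ‖sgn η u • x‖ = ‖x‖ := by
  rw [norm_smul, Real.norm_eq_abs, abs_sgn, one_mul]

theorem norm_exp_mul_le {z : ℂ} (hz : z.re ≤ 0) {u : ℝ} (hu : 0 ≤ u) : ‖exp (z * u)‖ ≤ 1 := by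
  rw [norm_exp, Real.exp_le_one_iff]
  simpa using mul_nonpos_of_nonpos_of_nonneg hz hu

theorem aestronglyMeasurable_lap (z : ℂ) :
    AEStronglyMeasurable (fun u : ℝ => sgn η u • exp (z * u)) η.variation :=
  (measurable_sgn η).aestronglyMeasurable.smul
    (by fun_prop : Continuous fun u : ℝ => exp (z * u)).aestronglyMeasurable

theorem norm_lap_le (hη : η.variation (Iio 0) = 0) {z : ℂ} (hz : z.re ≤ 0) :
    ‖lap η z‖ ≤ η.variation.real univ := by
  refine (norm_integral_le_of_norm_le_const (C := 1) ?_).trans (by simp)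
  filter_upwards [ae_nonneg hη] with u hu
  rw [norm_sgn_smul]
  exact norm_exp_mul_le hz hu

theorem continuousOn_lap (hη : η.variation (Iio 0) = 0) :
    ContinuousOn (lap η) {z | z.re ≤ 0} := by
  refine continuousOn_of_dominated (bound := fun _ => 1)
    (fun z _ => aestronglyMeasurable_lap z) (fun z hz => ?_) (integrable_const _)
    (Eventually.of_forall fun u => ?_)
  · filter_upwards [ae_nonneg hη] with u hu
    rw [norm_sgn_smul]
    exact norm_exp_mul_le hz hu
  · exact Continuous.continuousOn (by fun_prop)

theorem integrable_abs_of_sq (hm : Integrable (fun u : ℝ => |u| ^ 2) η.variation) :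
    Integrable (fun u : ℝ => |u|) η.variation := by
  refine ((integrable_const (1 : ℝ)).add hm).mono (by fun_prop) (Eventually.of_forall fun u => ?_)
  rw [Real.norm_eq_abs, abs_abs, Real.norm_eq_abs]
  refine le_trans ?_ (le_abs_self _)
  simp only [Pi.add_apply]
  nlinarith [sq_nonneg (|u| - 1), abs_nonneg u]

/-- Differentiation under the integral, dominated by |u|, which is integrable because |u| ≤ 1 + u².
-/
theorem differentiableOn_lap (hη : η.variation (Iio 0) = 0)
    (hm : Integrable (fun u : ℝ => |u| ^ 2) η.variation) :
    DifferentiableOn ℂ (lap η) {z | z.re < 0} := by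
  intro z hz
  have hopen : IsOpen {z : ℂ | z.re < 0} := isOpen_lt continuous_re continuous_const
  refine DifferentiableAt.differentiableWithinAt ?_
  have h := hasDerivAt_integral_of_dominated_loc_of_deriv_le (μ := η.variation) (𝕜 := ℂ)
    (F := fun (z : ℂ) (u : ℝ) => sgn η u • exp (z * u))
    (F' := fun z u => sgn η u • (u * exp (z * u))) (x₀ := z) (s := {z : ℂ | z.re < 0})
    (bound := fun u => |u|) (hopen.mem_nhds hz)
    (Eventually.of_forall fun z => aestronglyMeasurable_lap z) ?_ ?_ ?_
    (integrable_abs_of_sq hm) ?_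
  · exact h.2.differentiableAt
  · refine (integrable_const (1 : ℝ)).mono' (aestronglyMeasurable_lap z) ?_
    filter_upwards [ae_nonneg hη] with u hu
    rw [norm_sgn_smul]
    exact norm_exp_mul_le (le_of_lt hz) hu
  · exact (measurable_sgn η).aestronglyMeasurable.smul
      (by fun_prop : Continuous fun u : ℝ => u * exp (z * u)).aestronglyMeasurable
  · filter_upwards [ae_nonneg hη] with u hu w hw
    rw [norm_sgn_smul, norm_mul, norm_real, Real.norm_eq_abs]
    exact mul_le_of_le_one_right (abs_nonneg u) (norm_exp_mul_le (le_of_lt hw) hu)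
  · refine Eventually.of_forall fun u w _ => ?_
    have : HasDerivAt (fun w : ℂ => exp (w * u)) (u * exp (w * u)) w := by
      have := ((hasDerivAt_id w).mul_const (u : ℂ)).cexp
      simpa [mul_comm] using this
    exact this.const_smul (sgn η u)

/-- Each derivative in ξ brings down a factor −2πiu and so costs one moment. The general factor φ
permits a second application, with −2πi u φ(u) in place of φ. -/
theorem hasDerivAt_integral_exp {ν : Measure ℝ} {φ : ℝ → ℂ} (hφ : Integrable φ ν)
    (hφ' : Integrable (fun u : ℝ => (u : ℂ) * φ u) ν) (ξ : ℝ) :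
    HasDerivAt (fun ξ : ℝ => ∫ u, exp (I * (-(2 * Real.pi * ξ) : ℝ) * u) * φ u ∂ν)
      (∫ u, exp (I * (-(2 * Real.pi * ξ) : ℝ) * u) * (-(2 * Real.pi * I) * (u * φ u)) ∂ν) ξ := by
  have hn : ∀ ξ u : ℝ, ‖exp (I * (-(2 * Real.pi * ξ) : ℝ) * u)‖ = 1 := fun ξ u => by
    rw [show I * ((-(2 * Real.pi * ξ) : ℝ) : ℂ) * u = ((-(2 * Real.pi * ξ) * u : ℝ) : ℂ) * I by
      push_cast; ring, norm_exp_ofReal_mul_I]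
  have hmeas : ∀ ξ : ℝ, AEStronglyMeasurable
      (fun u : ℝ => exp (I * (-(2 * Real.pi * ξ) : ℝ) * u)) ν :=
    fun ξ => Continuous.aestronglyMeasurable (by fun_prop)
  refine (hasDerivAt_integral_of_dominated_loc_of_deriv_le (μ := ν) (𝕜 := ℝ)
    (F := fun (ξ : ℝ) (u : ℝ) => exp (I * (-(2 * Real.pi * ξ) : ℝ) * u) * φ u)
    (F' := fun ξ u => exp (I * (-(2 * Real.pi * ξ) : ℝ) * u) * (-(2 * Real.pi * I) * (u * φ u)))
    (x₀ := ξ) (s := univ) (bound := fun u => ‖-(2 * Real.pi * I) * (u * φ u)‖) Filter.univ_mem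
    (Eventually.of_forall fun z => (hmeas z).mul hφ.1) ?_ ?_ ?_ ?_ ?_).2
  · exact hφ.bdd_mul (c := 1) (hmeas ξ) (Eventually.of_forall fun u => (hn ξ u).le)
  · exact (hmeas ξ).mul (hφ'.const_mul _).1
  · exact Eventually.of_forall fun u w _ => by rw [norm_mul, hn, one_mul]
  · exact (hφ'.const_mul _).norm
  · refine Eventually.of_forall fun u w _ => ?_
    have h1 : HasDerivAt (fun w : ℝ => I * ((-(2 * Real.pi * w) : ℝ) : ℂ) * u)
        (-(2 * Real.pi * I) * u) w := by
      have h2 : HasDerivAt (fun w : ℝ => (w : ℂ)) 1 w := ofRealCLM.hasDerivAt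
      have h3 := h2.mul_const (-(2 * Real.pi * I) * u)
      refine (h3.congr_deriv (by ring)).congr_of_eventuallyEq (Eventually.of_forall fun w => ?_)
      push_cast
      ring
    have := (h1.cexp).mul_const (φ u)
    exact this.congr_deriv (by ring)

end Symbol


/-! ### The symbol h, its inverse and its derivatives, in the submultiplicative ℓ^∞ operator norm.
-/

section MatrixSymbol

open Complex Filter

attribute [local instance] Matrix.linftyOpNormedRing Matrix.linftyOpNormedAlgebra

variable {n : ℕ} {η : Matrix (Fin n) (Fin n) (SignedMeasure ℝ)}

/-- The expansion in matrix units transfers continuity, differentiability and bounds from the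
entries to the matrix as an element of a normed algebra. -/
theorem matrix_eq_sum_smul (M : Matrix (Fin n) (Fin n) ℂ) :
    M = ∑ i, ∑ j, M i j • Matrix.single i j (1 : ℂ) := by
  conv_lhs => rw [Matrix.matrix_eq_sum_single M]
  simp [Matrix.smul_single]

theorem norm_apply_le (M : Matrix (Fin n) (Fin n) ℂ) (i j : Fin n) : ‖M i j‖ ≤ ‖M‖ := by
  rw [Matrix.linfty_opNorm_def]
  have h1 : ‖M i j‖₊ ≤ ∑ j, ‖M i j‖₊ :=
    Finset.single_le_sum (f := fun j => ‖M i j‖₊) (fun _ _ => zero_le) (Finset.mem_univ j)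
  exact_mod_cast h1.trans (Finset.le_sup (f := fun i => ∑ j, ‖M i j‖₊) (Finset.mem_univ i))

theorem norm_le_of_apply_le {M : Matrix (Fin n) (Fin n) ℂ} {c : ℝ} (h : ∀ i j, ‖M i j‖ ≤ c) :
    ‖M‖ ≤ ∑ i : Fin n, ∑ j : Fin n, c * ‖Matrix.single i j (1 : ℂ)‖ := by
  conv_lhs => rw [matrix_eq_sum_smul M]
  refine (norm_sum_le _ _).trans (Finset.sum_le_sum fun i _ => (norm_sum_le _ _).trans
    (Finset.sum_le_sum fun j _ => ?_))
  rw [norm_smul]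
  gcongr
  exact h i j

theorem continuousOn_matrix {T : Type*} [TopologicalSpace T] {s : Set T}
    {M : T → Matrix (Fin n) (Fin n) ℂ}
    (h : ∀ i j, ContinuousOn (fun t => M t i j) s) : ContinuousOn M s := by
  have : M = fun t => ∑ i, ∑ j, M t i j • Matrix.single i j (1 : ℂ) := by
    ext1 t; exact matrix_eq_sum_smul _
  rw [this]
  exact continuousOn_finsetSum _ fun i _ => continuousOn_finsetSum _ fun j _ =>
    (h i j).smul continuousOn_const

theorem differentiableOn_matrix {s : Set ℂ} {M : ℂ → Matrix (Fin n) (Fin n) ℂ}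
    (h : ∀ i j, DifferentiableOn ℂ (fun t => M t i j) s) : DifferentiableOn ℂ M s := by
  have : M = fun t => ∑ i, ∑ j, M t i j • Matrix.single i j (1 : ℂ) := by
    ext1 t; exact matrix_eq_sum_smul _
  rw [this]
  exact DifferentiableOn.fun_sum fun i _ => DifferentiableOn.fun_sum fun j _ =>
    (h i j).smul_const _

theorem hasDerivAt_matrix {M : ℝ → Matrix (Fin n) (Fin n) ℂ} {M' : Matrix (Fin n) (Fin n) ℂ}
    {t : ℝ} (h : ∀ i j, HasDerivAt (fun t => M t i j) (M' i j) t) : HasDerivAt M M' t := by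
  have : M = fun t => ∑ i, ∑ j, M t i j • Matrix.single i j (1 : ℂ) := by
    ext1 t; exact matrix_eq_sum_smul _
  rw [this, matrix_eq_sum_smul M']
  exact HasDerivAt.fun_sum fun i _ => HasDerivAt.fun_sum fun j _ => (h i j).smul_const _

/-- The continuous linear map extracting an entry. -/
noncomputable def entryCLM (i j : Fin n) : Matrix (Fin n) (Fin n) ℂ →L[ℂ] ℂ :=
  LinearMap.mkContinuous (Matrix.entryLinearMap ℂ ℂ i j) 1 fun M => by
    simpa using norm_apply_le M i j

theorem continuousOn_hFun (hη : ConcentratedOnNonneg η) :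
    ContinuousOn (hFun η) {z | z.re ≤ 0} := by
  refine continuousOn_matrix fun i j => ?_
  simp only [hFun_apply]
  exact (by fun_prop : Continuous fun z : ℂ => -(z * (1 : Matrix (Fin n) (Fin n) ℂ) i j))
    |>.continuousOn.sub (continuousOn_lap (hη i j))

theorem differentiableOn_hFun (hη : ConcentratedOnNonneg η) (hm : HasMoment η 2) :
    DifferentiableOn ℂ (hFun η) {z | z.re < 0} := by
  refine differentiableOn_matrix fun i j => ?_
  simp only [hFun_apply]
  exact (by fun_prop : Differentiable ℂ fun z : ℂ => -(z * (1 : Matrix (Fin n) (Fin n) ℂ) i j))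
    |>.differentiableOn.sub (differentiableOn_lap (hη i j) (hm i j))

variable (hdet : ∀ z : ℂ, z.re ≤ 0 → (hFun η z).det ≠ 0)

include hdet in
theorem isUnit_hFun {z : ℂ} (hz : z.re ≤ 0) : IsUnit (hFun η z) :=
  (Matrix.isUnit_iff_isUnit_det _).2 (isUnit_iff_ne_zero.2 (hdet z hz))

include hdet in
theorem continuousOn_hInv (hη : ConcentratedOnNonneg η) :
    ContinuousOn (fun z => (hFun η z)⁻¹) {z | z.re ≤ 0} := by
  intro z hz
  obtain ⟨u, hu⟩ := isUnit_hFun hdet hz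
  have h1 := NormedRing.inverse_continuousAt u
  rw [hu] at h1
  simp only [Matrix.nonsing_inv_eq_ringInverse]
  exact h1.comp_continuousWithinAt (continuousOn_hFun hη z hz)

include hdet in
theorem differentiableOn_hInv (hη : ConcentratedOnNonneg η) (hm : HasMoment η 2) :
    DifferentiableOn ℂ (fun z => (hFun η z)⁻¹) {z | z.re < 0} := by
  intro z hz
  obtain ⟨u, hu⟩ := isUnit_hFun hdet (le_of_lt hz)
  have h1 := differentiableAt_inverse (𝕜 := ℂ) (R := Matrix (Fin n) (Fin n) ℂ) ⟨u, rfl⟩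
  rw [hu] at h1
  simp only [Matrix.nonsing_inv_eq_ringInverse]
  exact h1.comp_differentiableWithinAt z (differentiableOn_hFun hη hm z hz)

include hdet in
theorem hInv_mul {z : ℂ} (hz : z.re ≤ 0) : (hFun η z)⁻¹ * hFun η z = 1 :=
  Matrix.nonsing_inv_mul _ (isUnit_iff_ne_zero.2 (hdet z hz))

include hdet in
-- This is h⁻¹ h = 1 with the second factor written out. It drives both the decay at infinity and
-- the resolvent equation of the kernel.
theorem smul_hInv {z : ℂ} (hz : z.re ≤ 0) :
    z • (hFun η z)⁻¹ = -1 - (hFun η z)⁻¹ * laplace η z := by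
  rw [← hInv_mul hdet hz]
  nth_rewrite 3 [hFun]
  rw [mul_sub, mul_neg, mul_smul_comm, mul_one]
  abel

theorem exists_norm_laplace_le (hη : ConcentratedOnNonneg η) :
    ∃ c, 0 ≤ c ∧ ∀ z : ℂ, z.re ≤ 0 → ‖laplace η z‖ ≤ c := by
  let c₀ := ∑ i, ∑ j, (η i j).variation.real univ
  have h0 : ∀ i j, (η i j).variation.real univ ≤ c₀ := fun i j =>
    (Finset.single_le_sum (f := fun j => (η i j).variation.real univ)
      (fun _ _ => measureReal_nonneg) (Finset.mem_univ j)).trans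
      (Finset.single_le_sum (f := fun i => ∑ j, (η i j).variation.real univ)
      (fun _ _ => Finset.sum_nonneg fun _ _ => measureReal_nonneg) (Finset.mem_univ i))
  have hc₀ : 0 ≤ c₀ := Finset.sum_nonneg fun _ _ => Finset.sum_nonneg fun _ _ => measureReal_nonneg
  refine ⟨_, Finset.sum_nonneg fun i _ => Finset.sum_nonneg fun j _ => by positivity,
    fun z hz => norm_le_of_apply_le (c := c₀) fun i j => ?_⟩
  rw [laplace_apply]
  exact (norm_lap_le (hη i j) hz).trans (h0 i j)

include hdet in
-- By `smul_hInv`, |z| ‖h⁻¹‖ ≤ ‖1‖ + c ‖h⁻¹‖, where c bounds L[η]; for large |z| the last term is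
-- absorbed on the left. The remaining half disc is compact.
theorem exists_norm_hInv_le (hη : ConcentratedOnNonneg η) :
    ∃ c, 0 ≤ c ∧ ∀ z : ℂ, z.re ≤ 0 → ‖(hFun η z)⁻¹‖ ≤ c / (1 + ‖z‖) := by
  obtain ⟨c, hc, hL⟩ := exists_norm_laplace_le hη
  -- Outside the radius 2c + 1 one has 1 + ‖z‖ ≤ 4 (‖z‖ − c), which is what the absorption needs.
  have hK : IsCompact ({z : ℂ | z.re ≤ 0} ∩ Metric.closedBall 0 (2 * c + 1)) :=
    (isCompact_closedBall _ _).inter_left (isClosed_le continuous_re continuous_const)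
  obtain ⟨M, hM⟩ := hK.exists_bound_of_continuousOn
    ((continuousOn_hInv hdet hη).mono inter_subset_left)
  have hM' : 0 ≤ M := (norm_nonneg _).trans (hM 0 ⟨by simp, by simp; positivity⟩)
  set N := ‖(1 : Matrix (Fin n) (Fin n) ℂ)‖
  have hN : 0 ≤ N := norm_nonneg _
  refine ⟨M * (2 * c + 2) + 4 * N, by positivity, fun z hz => ?_⟩
  rw [le_div_iff₀ (by positivity)]
  rcases le_total ‖z‖ (2 * c + 1) with h | h
  · have := hM z ⟨hz, by simpa using h⟩
    calc ‖(hFun η z)⁻¹‖ * (1 + ‖z‖) ≤ M * (1 + (2 * c + 1)) := by gcongr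
      _ ≤ _ := by nlinarith
  · have h2 := smul_hInv hdet hz
    set A := (hFun η z)⁻¹
    have h3 : ‖z‖ * ‖A‖ ≤ N + ‖A‖ * c := by
      rw [← norm_smul, h2]
      refine (norm_sub_le _ _).trans ?_
      rw [norm_neg]
      gcongr
      exact (norm_mul_le _ _).trans (by gcongr; exact hL z hz)
    have h4 : ‖A‖ * (‖z‖ - c) ≤ N := by linarith
    have h5 : 0 ≤ ‖A‖ := norm_nonneg _
    have h6 : ‖A‖ * (1 + ‖z‖) ≤ 4 * N := by
      have : 1 + ‖z‖ ≤ 4 * (‖z‖ - c) := by linarith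
      nlinarith
    nlinarith

/-- The regularised symbol `h(z)⁻¹ - (1 - z)⁻¹ I`. -/
noncomputable def regSymbol (η : Matrix (Fin n) (Fin n) (SignedMeasure ℝ)) (z : ℂ) :
    Matrix (Fin n) (Fin n) ℂ :=
  (hFun η z)⁻¹ - (1 - z)⁻¹ • 1

theorem one_sub_ne_zero {z : ℂ} (hz : z.re ≤ 0) : 1 - z ≠ 0 := fun h => by
  have := congrArg re h
  simp at this
  linarith

theorem le_norm_one_sub {z : ℂ} (hz : z.re ≤ 0) : (1 + ‖z‖) / 2 ≤ ‖1 - z‖ := by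
  have h1 : 1 ≤ ‖1 - z‖ := by
    have := abs_re_le_norm (1 - z)
    rw [abs_of_nonneg (by simp; linarith)] at this
    simp at this
    linarith
  have h2 : ‖z‖ ≤ ‖1 - z‖ := by
    rw [norm_def, norm_def]
    apply Real.sqrt_le_sqrt
    simp [normSq_apply]
    nlinarith
  linarith

include hdet in
-- The leading terms −1/z cancel: the difference equals (1 − z)⁻¹ h⁻¹ (1 + L[η]), a product with two
-- decaying factors.
theorem exists_norm_regSymbol_le (hη : ConcentratedOnNonneg η) :
    ∃ c, 0 ≤ c ∧ ∀ z : ℂ, z.re ≤ 0 → ‖regSymbol η z‖ ≤ c / (1 + ‖z‖) ^ 2 := by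
  obtain ⟨c, hc, hL⟩ := exists_norm_laplace_le hη
  obtain ⟨d, hd, hA⟩ := exists_norm_hInv_le hdet hη
  set N := ‖(1 : Matrix (Fin n) (Fin n) ℂ)‖
  have hN : 0 ≤ N := norm_nonneg _
  refine ⟨2 * d * (N + c), by positivity, fun z hz => ?_⟩
  have h0 := one_sub_ne_zero hz
  have h1 : regSymbol η z = (1 - z)⁻¹ • ((hFun η z)⁻¹ * (1 + laplace η z)) := by
    rw [regSymbol, eq_inv_smul_iff₀ h0, smul_sub, smul_smul, mul_inv_cancel₀ h0, one_smul,
      sub_smul, one_smul, smul_hInv hdet hz, mul_add, mul_one]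
    abel
  have h2 := le_norm_one_sub hz
  have h3 : ‖(1 - z)⁻¹‖ ≤ 2 / (1 + ‖z‖) := by
    rw [norm_inv, ← one_div, div_le_div_iff₀ (by positivity) (by positivity)]
    linarith
  calc ‖regSymbol η z‖ ≤ ‖(1 - z)⁻¹‖ * (‖(hFun η z)⁻¹‖ * ‖1 + laplace η z‖) := by
        rw [h1, norm_smul]
        gcongr
        exact norm_mul_le _ _
    _ ≤ 2 / (1 + ‖z‖) * (d / (1 + ‖z‖) * (N + c)) := by
        gcongr
        · exact hA z hz
        · exact (norm_add_le _ _).trans (by gcongr; exact hL z hz)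
    _ = _ := by field_simp

include hdet in
theorem continuousOn_regSymbol (hη : ConcentratedOnNonneg η) :
    ContinuousOn (regSymbol η) {z | z.re ≤ 0} :=
  (continuousOn_hInv hdet hη).sub (ContinuousOn.smul (ContinuousOn.inv₀
    (by fun_prop) fun _ hz => one_sub_ne_zero hz) continuousOn_const)

include hdet in
theorem differentiableOn_regSymbol (hη : ConcentratedOnNonneg η) (hm : HasMoment η 2) :
    DifferentiableOn ℂ (regSymbol η) {z | z.re < 0} :=
  (differentiableOn_hInv hdet hη hm).sub (DifferentiableOn.smul_const (DifferentiableOn.inv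
    (by fun_prop) fun _ hz => one_sub_ne_zero (le_of_lt hz)) _)

/-- The point `-2πiξ` of the imaginary axis. -/
noncomputable def axis (ξ : ℝ) : ℂ := I * ((-(2 * Real.pi * ξ) : ℝ) : ℂ)

theorem axis_re (ξ : ℝ) : (axis ξ).re = 0 := by simp [axis]

theorem axis_re_le (ξ : ℝ) : (axis ξ).re ≤ 0 := (axis_re ξ).le

theorem norm_axis (ξ : ℝ) : ‖axis ξ‖ = 2 * Real.pi * |ξ| := by
  rw [axis, norm_mul, norm_I, one_mul, norm_real, Real.norm_eq_abs, abs_neg, abs_mul,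
    abs_of_pos Real.two_pi_pos]

theorem continuous_axis : Continuous axis := by unfold axis; fun_prop

theorem hasDerivAt_axis (ξ : ℝ) : HasDerivAt axis (-(2 * Real.pi * I)) ξ := by
  have h2 : HasDerivAt (fun w : ℝ => (w : ℂ)) 1 ξ := ofRealCLM.hasDerivAt
  have h3 := h2.mul_const (-(2 * Real.pi * I))
  refine (h3.congr_deriv (by ring)).congr_of_eventuallyEq (Eventually.of_forall fun w => ?_)
  simp only [axis]
  push_cast
  ring

theorem inv_one_add_norm_axis_sq_le (ξ : ℝ) : (1 / (1 + ‖axis ξ‖)) ^ 2 ≤ 1 / (1 + ξ ^ 2) := by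
  rw [div_pow, one_pow]
  gcongr
  rw [norm_axis, ← sq_abs ξ]
  have : 1 ≤ 2 * Real.pi := by linarith [Real.pi_gt_three]
  have h : |ξ| ≤ 2 * Real.pi * |ξ| := le_mul_of_one_le_left (abs_nonneg ξ) this
  nlinarith [abs_nonneg ξ]

/-- Up to powers of 2π, the first and second absolute moments of η bound the two derivatives
uniformly in ξ. -/
theorem hasDerivAt_lap_axis {η : SignedMeasure ℝ}
    (hm : Integrable (fun u : ℝ => |u| ^ 2) η.variation) :
    ∃ (l1 l2 : ℝ → ℂ) (c : ℝ), (∀ ξ, HasDerivAt (fun ξ => lap η (axis ξ)) (l1 ξ) ξ) ∧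
      (∀ ξ, HasDerivAt l1 (l2 ξ) ξ) ∧ ∀ ξ, ‖l1 ξ‖ ≤ c ∧ ‖l2 ξ‖ ≤ c := by
  let φ : ℝ → ℂ := fun u => (sgn η u : ℂ)
  have hφm : Measurable φ := measurable_ofReal.comp (measurable_sgn η)
  have hφn : ∀ u, ‖φ u‖ = 1 := fun u => by simp [φ, abs_sgn]
  have hφ : Integrable φ η.variation :=
    (integrable_const (1 : ℝ)).mono hφm.aestronglyMeasurable
      (Eventually.of_forall fun u => by simp [hφn])
  have h1 : Integrable (fun u : ℝ => (u : ℂ) * φ u) η.variation :=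
    (integrable_abs_of_sq hm).mono (by fun_prop)
      (Eventually.of_forall fun u => by simp [hφn])
  have h2 : Integrable (fun u : ℝ => (u : ℂ) * (-(2 * Real.pi * I) * (u * φ u))) η.variation := by
    refine (hm.const_mul (2 * Real.pi)).mono (by fun_prop)
      (Eventually.of_forall fun u => ?_)
    simp only [norm_mul, norm_neg, norm_real, hφn, norm_I, Complex.norm_ofNat, Real.norm_eq_abs,
      abs_pow, abs_abs, mul_one, Nat.abs_ofNat]
    exact le_of_eq (by ring)
  have hn : ∀ ξ u : ℝ, ‖exp (I * (-(2 * Real.pi * ξ) : ℝ) * u)‖ = 1 := fun ξ u => by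
    rw [show I * ((-(2 * Real.pi * ξ) : ℝ) : ℂ) * u = ((-(2 * Real.pi * ξ) * u : ℝ) : ℂ) * I by
      push_cast; ring, norm_exp_ofReal_mul_I]
  refine ⟨_, _, max (∫ u, ‖-(2 * Real.pi * I) * ((u : ℂ) * φ u)‖ ∂η.variation)
    (∫ u, ‖-(2 * Real.pi * I) * ((u : ℂ) * (-(2 * Real.pi * I) * (u * φ u)))‖ ∂η.variation),
    fun ξ => ?_, fun ξ => hasDerivAt_integral_exp (h1.const_mul _) h2 ξ,
    fun ξ => ⟨le_max_of_le_left ?_, le_max_of_le_right ?_⟩⟩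
  · refine (hasDerivAt_integral_exp hφ h1 ξ).congr_of_eventuallyEq (Eventually.of_forall fun ξ => ?_)
    simp only [lap, axis]
    congr 1
    ext u
    rw [real_smul, mul_comm]
  · refine (norm_integral_le_integral_norm _).trans (le_of_eq ?_)
    congr 1
    ext u
    rw [norm_mul, hn, one_mul]
  · refine (norm_integral_le_integral_norm _).trans (le_of_eq ?_)
    congr 1
    ext u
    rw [norm_mul, hn, one_mul]

theorem hasDerivAt_hFun_axis (hm : HasMoment η 2) :
    ∃ (H1 H2 : ℝ → Matrix (Fin n) (Fin n) ℂ) (c : ℝ), 0 ≤ c ∧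
      (∀ ξ, HasDerivAt (fun ξ => hFun η (axis ξ)) (H1 ξ) ξ) ∧
      (∀ ξ, HasDerivAt H1 (H2 ξ) ξ) ∧ ∀ ξ, ‖H1 ξ‖ ≤ c ∧ ‖H2 ξ‖ ≤ c := by
  choose l1 l2 c hl1 hl2 hc using fun i j => hasDerivAt_lap_axis (hm i j)
  let c₀ := 2 * Real.pi + ∑ i, ∑ j, c i j
  have hcn : ∀ i j, 0 ≤ c i j := fun i j => (norm_nonneg _).trans (hc i j 0).1
  have h0 : ∀ i j, 2 * Real.pi + c i j ≤ c₀ := fun i j => by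
    have := (Finset.single_le_sum (f := fun j => c i j)
      (fun j _ => hcn i j) (Finset.mem_univ j)).trans
      (Finset.single_le_sum (f := fun i => ∑ j, c i j)
      (fun i _ => Finset.sum_nonneg fun j _ => hcn i j) (Finset.mem_univ i))
    simp only [c₀]
    linarith
  have hc₀ : 0 ≤ c₀ := add_nonneg Real.two_pi_pos.le
    (Finset.sum_nonneg fun i _ => Finset.sum_nonneg fun j _ => hcn i j)
  have hone : ∀ i j : Fin n, ‖(2 * Real.pi * I) * (1 : Matrix (Fin n) (Fin n) ℂ) i j‖
      ≤ 2 * Real.pi := fun i j => by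
    rw [Matrix.one_apply]
    split_ifs <;> simp [abs_of_pos Real.pi_pos, Real.pi_pos.le]
  refine ⟨fun ξ i j => (2 * Real.pi * I) * (1 : Matrix (Fin n) (Fin n) ℂ) i j - l1 i j ξ,
    fun ξ i j => - l2 i j ξ, _, Finset.sum_nonneg fun i _ => Finset.sum_nonneg fun j _ =>
      mul_nonneg hc₀ (norm_nonneg _), fun ξ => hasDerivAt_matrix fun i j => ?_,
    fun ξ => hasDerivAt_matrix fun i j => ?_,
    fun ξ => ⟨norm_le_of_apply_le fun i j => ?_, norm_le_of_apply_le fun i j => ?_⟩⟩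
  · simp only [hFun_apply]
    refine HasDerivAt.sub ?_ (hl1 i j ξ)
    exact ((hasDerivAt_axis ξ).mul_const _).neg.congr_deriv (by ring)
  · exact (hl2 i j ξ).const_sub _
  · exact (norm_sub_le _ _).trans ((add_le_add (hone i j) (hc i j ξ).1).trans (h0 i j))
  · rw [norm_neg]
    linarith [h0 i j, (hc i j ξ).2, Real.two_pi_pos]

include hdet in
-- The derivative of h⁻¹ is −h⁻¹ h' h⁻¹. Every term of the first two derivatives contains at least
-- two decaying factors h⁻¹ or (1 − z)⁻¹, while h' and h'' are bounded on the axis.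
theorem exists_deriv_regSymbol (hη : ConcentratedOnNonneg η) (hm : HasMoment η 2) :
    ∃ (R1 R2 : ℝ → Matrix (Fin n) (Fin n) ℂ) (c : ℝ),
      (∀ ξ, HasDerivAt (fun ξ => regSymbol η (axis ξ)) (R1 ξ) ξ) ∧
      (∀ ξ, HasDerivAt R1 (R2 ξ) ξ) ∧
      ∀ ξ, ‖R1 ξ‖ ≤ c * (1 / (1 + ξ ^ 2)) ∧ ‖R2 ξ‖ ≤ c * (1 / (1 + ξ ^ 2)) := by
  obtain ⟨H1, H2, M, hM, hH1, hH2, hb⟩ := hasDerivAt_hFun_axis hm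
  obtain ⟨d, hd, hA⟩ := exists_norm_hInv_le hdet hη
  set B : ℝ → Matrix (Fin n) (Fin n) ℂ := fun ξ => (hFun η (axis ξ))⁻¹ with hB
  set N := ‖(1 : Matrix (Fin n) (Fin n) ℂ)‖
  have hN : 0 ≤ N := norm_nonneg _
  have hB1 : ∀ ξ, HasDerivAt B (-(B ξ * H1 ξ * B ξ)) ξ := fun ξ => by
    obtain ⟨u, hu⟩ := isUnit_hFun hdet (axis_re_le ξ)
    have h1 := hasFDerivAt_ringInverse (𝕜 := ℝ) u
    rw [hu] at h1
    have h2 := h1.comp_hasDerivAt ξ (hH1 ξ)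
    have h3 : B = Ring.inverse ∘ fun ξ => hFun η (axis ξ) := by
      ext1 ξ; simp [hB, Matrix.nonsing_inv_eq_ringInverse]
    have h4 : (↑u⁻¹ : Matrix (Fin n) (Fin n) ℂ) = B ξ := by
      change _ = (hFun η (axis ξ))⁻¹
      rw [← hu, Matrix.coe_units_inv]
    rw [← h3] at h2
    refine h2.congr_deriv ?_
    rw [h4]
    simp
  have hQ : ∀ ξ, HasDerivAt (fun ξ => (1 - axis ξ)⁻¹)
      (-(2 * Real.pi * I) * ((1 - axis ξ)⁻¹) ^ 2) ξ := fun ξ => by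
    refine (((hasDerivAt_axis ξ).const_sub 1).inv (one_sub_ne_zero (axis_re_le ξ))).congr_deriv ?_
    rw [inv_pow]
    ring
  -- The common decay factor: two occurrences of it are kept in each term and all other factors are
  -- bounded by constants.
  set e : ℝ → ℝ := fun ξ => 1 / (1 + ‖axis ξ‖)
  have he0 : ∀ ξ, 0 ≤ e ξ := fun ξ => by positivity
  have he1 : ∀ ξ, e ξ ≤ 1 := fun ξ => by
    simp only [e]
    rw [div_le_one (by positivity)]
    linarith [norm_nonneg (axis ξ)]
  have hBn : ∀ ξ, ‖B ξ‖ ≤ d * e ξ := fun ξ => by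
    refine (hA _ (axis_re_le ξ)).trans (le_of_eq ?_)
    simp only [e]; ring
  have hBn' : ∀ ξ, ‖B ξ‖ ≤ d := fun ξ => (hBn ξ).trans (mul_le_of_le_one_right hd (he1 ξ))
  have hQn : ∀ ξ, ‖(1 - axis ξ)⁻¹‖ ≤ 2 * e ξ := fun ξ => by
    have := le_norm_one_sub (axis_re_le ξ)
    have h0 := one_sub_ne_zero (axis_re_le ξ)
    simp only [e]
    rw [norm_inv, ← one_div, mul_one_div, div_le_div_iff₀ (by positivity) (by positivity)]
    linarith
  have hQn' : ∀ ξ, ‖(1 - axis ξ)⁻¹‖ ≤ 2 := fun ξ => (hQn ξ).trans (by linarith [he1 ξ])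
  have hBHB : ∀ ξ (K : Matrix (Fin n) (Fin n) ℂ), ‖K‖ ≤ M → ‖B ξ * K * B ξ‖ ≤ d ^ 2 * M * e ξ ^ 2 :=
    fun ξ K hK => by
      calc ‖B ξ * K * B ξ‖ ≤ ‖B ξ‖ * ‖K‖ * ‖B ξ‖ :=
            (norm_mul_le _ _).trans (by gcongr; exact norm_mul_le _ _)
        _ ≤ (d * e ξ) * M * (d * e ξ) := by
            have := hBn ξ; have := he0 ξ
            gcongr
        _ = _ := by ring
  have hB1n : ∀ ξ, ‖-(B ξ * H1 ξ * B ξ)‖ ≤ d ^ 2 * M * e ξ ^ 2 := fun ξ => by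
    rw [norm_neg]; exact hBHB ξ _ (hb ξ).1
  have hpi : ‖-(2 * Real.pi * I)‖ = 2 * Real.pi := by
    simp [abs_of_pos Real.pi_pos]
  set c₁ := d ^ 2 * M + 2 * Real.pi * 4 * N
  set c₂ := (d ^ 2 * M) * M * d + d ^ 2 * M + d * M * (d ^ 2 * M)
    + 2 * Real.pi * (2 * 2 * (2 * Real.pi * 4)) * N
  have hp := Real.pi_pos
  have hc₁ : 0 ≤ c₁ := by positivity
  have hc₂ : 0 ≤ c₂ := by positivity
  refine ⟨fun ξ => -(B ξ * H1 ξ * B ξ) - (-(2 * Real.pi * I) * ((1 - axis ξ)⁻¹) ^ 2) • 1,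
    fun ξ => -((-(B ξ * H1 ξ * B ξ) * H1 ξ + B ξ * H2 ξ) * B ξ
      + B ξ * H1 ξ * -(B ξ * H1 ξ * B ξ))
      - (-(2 * Real.pi * I) * (2 * (1 - axis ξ)⁻¹
        * (-(2 * Real.pi * I) * ((1 - axis ξ)⁻¹) ^ 2))) • 1,
    c₁ + c₂, fun ξ => (hB1 ξ).sub ((hQ ξ).smul_const _), fun ξ => ?_, fun ξ => ⟨?_, ?_⟩⟩
  · refine HasDerivAt.sub ?_ (HasDerivAt.smul_const ?_ _)
    · exact (((hB1 ξ).mul (hH2 ξ)).mul (hB1 ξ)).neg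
    · exact (((hQ ξ).pow 2).const_mul _).congr_deriv (by simp)
  · calc _ ≤ d ^ 2 * M * e ξ ^ 2 + 2 * Real.pi * (2 * e ξ) ^ 2 * N := by
          refine (norm_sub_le _ _).trans (add_le_add (hB1n ξ) ?_)
          rw [norm_smul, norm_mul, hpi, norm_pow]
          gcongr
          exact hQn ξ
      _ = c₁ * e ξ ^ 2 := by ring
      _ ≤ (c₁ + c₂) * (1 / (1 + ξ ^ 2)) :=
          mul_le_mul (by linarith) (inv_one_add_norm_axis_sq_le ξ) (sq_nonneg _) (by positivity)
  · calc _ ≤ ((d ^ 2 * M * e ξ ^ 2) * M * d + d ^ 2 * M * e ξ ^ 2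
            + d * M * (d ^ 2 * M * e ξ ^ 2))
            + 2 * Real.pi * (2 * 2 * (2 * Real.pi * (2 * e ξ) ^ 2)) * N := by
          refine (norm_sub_le _ _).trans (add_le_add ?_ ?_)
          · rw [norm_neg]
            refine (norm_add_le _ _).trans (add_le_add ?_ ?_)
            · rw [add_mul]
              refine (norm_add_le _ _).trans (add_le_add ?_ (hBHB ξ _ (hb ξ).2))
              refine (norm_mul_le _ _).trans ?_
              have := hB1n ξ; have := hBn' ξ; have := (hb ξ).1
              gcongr
              exact (norm_mul_le _ _).trans (by gcongr)
            · refine (norm_mul_le _ _).trans ?_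
              have := hB1n ξ; have := hBn' ξ; have := (hb ξ).1
              gcongr
              exact (norm_mul_le _ _).trans (by gcongr)
          · rw [norm_smul, norm_mul, hpi, norm_mul, norm_mul, norm_mul, hpi, norm_pow,
              Complex.norm_ofNat]
            gcongr
            · exact hQn' ξ
            · exact hQn ξ
      _ = c₂ * e ξ ^ 2 := by ring
      _ ≤ (c₁ + c₂) * (1 / (1 + ξ ^ 2)) :=
          mul_le_mul (by linarith) (inv_one_add_norm_axis_sq_le ξ) (sq_nonneg _) (by positivity)

end MatrixSymbol


/-! ### Fourier analysis on the line: causality, decay, convolution, primitives, uniqueness. -/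

section FourierScalar

open Complex Filter

theorem integrable_inv_one_add_abs_sq (c : ℝ) : Integrable (fun y : ℝ => c / (1 + |y|) ^ 2) := by
  refine (integrable_inv_one_add_sq.const_mul |c|).mono (Measurable.aestronglyMeasurable (by fun_prop))
    (Eventually.of_forall fun y => ?_)
  rw [norm_div, norm_mul, norm_inv, Real.norm_eq_abs, Real.norm_eq_abs |c|, abs_abs,
    Real.norm_of_nonneg (by positivity), Real.norm_of_nonneg (by positivity), div_eq_mul_inv,
    ← sq_abs y]
  gcongr
  nlinarith [abs_nonneg y]

/-- Cauchy's theorem in the closed left half plane. -/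
theorem integral_imaginary_axis_eq_zero {F : ℂ → ℂ} (hc : ContinuousOn F {z | z.re ≤ 0})
    (hd : DifferentiableOn ℂ F {z | z.re < 0}) {c : ℝ}
    (hb : ∀ z : ℂ, z.re ≤ 0 → ‖F z‖ ≤ c / (1 + ‖z‖) ^ 2) : ∫ y : ℝ, F (y * I) = 0 := by
  have hc0 : 0 ≤ c := by simpa using (norm_nonneg _).trans (hb 0 (by simp))
  have hcont : Continuous fun y : ℝ => F (y * I) :=
    hc.comp_continuous (by fun_prop) fun y => by simp
  have hint : Integrable fun y : ℝ => F (y * I) := by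
    refine (integrable_inv_one_add_abs_sq c).mono' hcont.aestronglyMeasurable
      (Eventually.of_forall fun y => ?_)
    simpa using hb (y * I) (by simp)
  have h1 := intervalIntegral_tendsto_integral hint tendsto_neg_atTop_atBot tendsto_id
  -- For the rectangle [−N, 0] × [−N, N] the three sides off the axis have total length 4N, and F is
  -- at most c/(1 + N)² on them.
  have key : ∀ N : ℝ, 0 < N → ‖∫ y in (-N)..N, F (y * I)‖ ≤ 4 * c / (1 + N) := fun N hN => by
    have hs := Complex.integral_boundary_rect_eq_zero_of_continuousOn_of_differentiableOn F
      (-N + -N * I) (N * I) ?_ ?_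
    · simp only [add_re, neg_re, ofReal_re, mul_re, I_re, mul_zero, ofReal_im, neg_im, I_im,
        mul_one, sub_self, add_zero, neg_zero, add_im, mul_im, zero_add, ofReal_neg,
        ofReal_zero, smul_eq_mul] at hs
      have hb' : ∀ z : ℂ, z.re ≤ 0 → N ≤ ‖z‖ → ‖F z‖ ≤ c / (1 + N) ^ 2 := fun z hz hzN =>
        (hb z hz).trans (by gcongr)
      have e1 : ‖∫ x : ℝ in (-N)..0, F (x + -N * I)‖ ≤ c / (1 + N) ^ 2 * N := by
        refine (intervalIntegral.norm_integral_le_of_norm_le_const fun x hx => ?_).trans_eq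
          (by rw [zero_sub, neg_neg, abs_of_pos hN])
        rw [uIoc_of_le (by linarith)] at hx
        refine hb' _ (by simpa using hx.2) ?_
        have := abs_im_le_norm (x + -N * I)
        simpa [abs_of_pos hN] using this
      have e2 : ‖∫ x : ℝ in (-N)..0, F (x + N * I)‖ ≤ c / (1 + N) ^ 2 * N := by
        refine (intervalIntegral.norm_integral_le_of_norm_le_const fun x hx => ?_).trans_eq
          (by rw [zero_sub, neg_neg, abs_of_pos hN])
        rw [uIoc_of_le (by linarith)] at hx
        refine hb' _ (by simpa using hx.2) ?_
        have := abs_im_le_norm (x + N * I)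
        simpa [abs_of_pos hN] using this
      have e3 : ‖∫ y : ℝ in (-N)..N, F (-N + y * I)‖ ≤ c / (1 + N) ^ 2 * (2 * N) := by
        refine (intervalIntegral.norm_integral_le_of_norm_le_const fun x hx => ?_).trans_eq
          (by rw [sub_neg_eq_add, ← two_mul, abs_of_pos (by positivity)])
        refine hb' _ (by simpa using hN.le) ?_
        have := abs_re_le_norm (-N + x * I)
        simpa [abs_of_pos hN] using this
      have e4 : I * (∫ y : ℝ in (-N)..N, F (y * I)) = I * (∫ y : ℝ in (-N)..N, F (-N + y * I))
          + (∫ x : ℝ in (-N)..0, F (x + N * I)) - ∫ x : ℝ in (-N)..0, F (x + -N * I) := by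
        linear_combination hs
      calc ‖∫ y in (-N)..N, F (y * I)‖ = ‖I * (∫ y : ℝ in (-N)..N, F (y * I))‖ := by simp
        _ ≤ c / (1 + N) ^ 2 * (2 * N) + c / (1 + N) ^ 2 * N + c / (1 + N) ^ 2 * N := by
            rw [e4]
            refine (norm_sub_le _ _).trans (add_le_add ((norm_add_le _ _).trans
              (add_le_add ?_ e2)) e1)
            rwa [norm_mul, norm_I, one_mul]
        _ = 4 * c * N / (1 + N) ^ 2 := by ring
        _ ≤ 4 * c / (1 + N) := by
            rw [div_le_div_iff₀ (by positivity) (by positivity)]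
            nlinarith [mul_nonneg hc0 hN.le]
    · refine hc.mono fun z hz => ?_
      have := hz.1
      simp at this
      rw [uIcc_of_le (by linarith)] at this
      exact this.2
    · refine hd.mono fun z hz => ?_
      have := hz.1
      simp [hN.le] at this
      exact this.2
  have h2 : Tendsto (fun N : ℝ => ∫ y in (-N)..N, F (y * I)) atTop (nhds 0) := by
    refine squeeze_zero_norm' (a := fun N => 4 * c / (1 + N)) ?_ ?_
    · filter_upwards [eventually_gt_atTop 0] with N hN using key N hN
    · exact Tendsto.div_atTop tendsto_const_nhds (tendsto_atTop_add_const_left _ _ tendsto_id)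
  exact tendsto_nhds_unique h1 h2

theorem fourierInv_axis_eq (f : ℝ → ℂ) (t : ℝ) :
    𝓕⁻ f t = ∫ v : ℝ, exp (-(axis v) * t) * f v := by
  rw [Real.fourierInv_eq']
  congr 1
  ext v
  rw [smul_eq_mul]
  congr 2
  simp only [axis, RCLike.inner_apply, conj_trivial]
  push_cast
  ring

theorem fourier_axis_eq (f : ℝ → ℂ) (ξ : ℝ) : 𝓕 f ξ = ∫ t : ℝ, exp (axis ξ * t) * f t := by
  rw [Real.fourier_real_eq_integral_exp_smul]
  congr 1
  ext v
  rw [smul_eq_mul]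
  congr 2
  simp only [axis]
  push_cast
  ring

theorem norm_exp_axis (ξ t : ℝ) : ‖exp (axis ξ * t)‖ = 1 := by
  rw [norm_exp]
  simp [axis_re]

/-- For Re z ≤ 0 and t ≤ 0 the factor e^{−zt} has modulus at most 1, so the hypotheses of Cauchy's
theorem persist. This is the source of the causality of the kernel. -/
theorem fourierInv_axis_eq_zero {F : ℂ → ℂ} (hc : ContinuousOn F {z | z.re ≤ 0})
    (hd : DifferentiableOn ℂ F {z | z.re < 0}) {c : ℝ}
    (hb : ∀ z : ℂ, z.re ≤ 0 → ‖F z‖ ≤ c / (1 + ‖z‖) ^ 2) {t : ℝ} (ht : t ≤ 0) :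
    𝓕⁻ (fun ξ => F (axis ξ)) t = 0 := by
  rw [fourierInv_axis_eq]
  have h1 := integral_imaginary_axis_eq_zero (F := fun z => exp (-z * t) * F z) (c := c)
    ((by fun_prop : Continuous fun z : ℂ => exp (-z * t)).continuousOn.mul hc)
    ((by fun_prop : Differentiable ℂ fun z : ℂ => exp (-z * t)).differentiableOn.mul hd)
    fun z hz => by
      rw [norm_mul]
      refine (mul_le_of_le_one_left (norm_nonneg _) ?_).trans (hb z hz)
      rw [norm_exp, Real.exp_le_one_iff]
      simp
      nlinarith
  have h2 := Measure.integral_comp_mul_left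
    (fun y : ℝ => exp (-(y * I) * t) * F (y * I)) (-(2 * Real.pi))
  rw [h1, smul_zero] at h2
  rw [← h2]
  congr 1
  ext v
  have : ((-(2 * Real.pi) * v : ℝ) : ℂ) * I = axis v := by
    simp only [axis]; push_cast; ring
  rw [this]

/-- Two derivatives in the frequency become a factor of modulus (2πt)² ≥ t² in time. The integral of
|f| bounds the transform itself, that of |f''| its product with t². -/
theorem exists_norm_fourierInv_le {f f1 f2 : ℝ → ℂ} (h1 : ∀ ξ, HasDerivAt f (f1 ξ) ξ)
    (h2 : ∀ ξ, HasDerivAt f1 (f2 ξ) ξ) (hf : Integrable f) (hf1 : Integrable f1)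
    (hf2 : Integrable f2) : ∃ c, 0 ≤ c ∧ ∀ t, ‖𝓕⁻ f t‖ ≤ c / (1 + t ^ 2) := by
  have hd1 : deriv f = f1 := funext fun ξ => (h1 ξ).deriv
  have hd2 : deriv f1 = f2 := funext fun ξ => (h2 ξ).deriv
  have e1 := Real.fourier_deriv hf (fun ξ => (h1 ξ).differentiableAt) (hd1 ▸ hf1)
  have e2 := Real.fourier_deriv hf1 (fun ξ => (h2 ξ).differentiableAt) (hd2 ▸ hf2)
  rw [hd1] at e1
  rw [hd2, e1] at e2
  have hn : ∀ (f : ℝ → ℂ) t, ‖𝓕 f t‖ ≤ ∫ x, ‖f x‖ := fun f t => by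
    rw [fourier_axis_eq]
    refine (norm_integral_le_integral_norm _).trans (le_of_eq ?_)
    congr 1
    ext x
    rw [norm_mul, norm_exp_axis, one_mul]
  refine ⟨(∫ x, ‖f x‖) + ∫ x, ‖f2 x‖, add_nonneg (integral_nonneg fun _ => norm_nonneg _)
    (integral_nonneg fun _ => norm_nonneg _), fun t => ?_⟩
  rw [Real.fourierInv_eq_fourier_neg, le_div_iff₀ (by positivity)]
  have h3 := hn f2 (-t)
  rw [e2] at h3
  simp only [smul_eq_mul, norm_mul, norm_real, Complex.norm_ofNat, norm_I, Real.norm_eq_abs,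
    abs_neg, abs_of_pos Real.pi_pos] at h3
  have h4 := hn f (-t)
  have h5 : t ^ 2 * ‖𝓕 f (-t)‖ ≤ ∫ x, ‖f2 x‖ := by
    refine le_trans ?_ h3
    rw [← sq_abs t]
    have : 1 ≤ (2 * Real.pi) ^ 2 := by nlinarith [Real.pi_gt_three]
    have h6 : 0 ≤ |t| ^ 2 * ‖𝓕 f (-t)‖ := by positivity
    nlinarith
  nlinarith

/-- The causal exponential `e^{-t} 1_{t ≥ 0}`. -/
noncomputable def causalExp : ℝ → ℂ := (Ici (0 : ℝ)).indicator fun t => exp (-t)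

theorem measurable_causalExp : Measurable causalExp :=
  (by fun_prop : Continuous fun t : ℝ => exp (-t)).measurable.indicator measurableSet_Ici

theorem integrable_causalExp : Integrable causalExp := by
  unfold causalExp
  rw [integrable_indicator_iff measurableSet_Ici, integrableOn_Ici_iff_integrableOn_Ioi]
  have := integrableOn_exp_mul_complex_Ioi (a := -1) (by simp) 0
  simpa using this

theorem fourier_causalExp (ξ : ℝ) : 𝓕 causalExp ξ = (1 - axis ξ)⁻¹ := by
  rw [fourier_axis_eq]
  have h1 : (fun t : ℝ => exp (axis ξ * t) * causalExp t)
      = (Ici (0 : ℝ)).indicator fun t : ℝ => exp ((axis ξ - 1) * t) := by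
    ext t
    by_cases ht : t ∈ Ici (0 : ℝ)
    · simp only [causalExp, ht, indicator_of_mem, ← exp_add]
      congr 1; ring
    · simp [causalExp, ht]
  rw [h1, integral_indicator measurableSet_Ici, integral_Ici_eq_integral_Ioi,
    integral_exp_mul_complex_Ioi (by simp [axis_re])]
  simp only [ofReal_zero, mul_zero, exp_zero]
  rw [← neg_sub 1 (axis ξ), inv_eq_one_div, neg_div_neg_eq]

theorem norm_causalExp_le (t : ℝ) : ‖causalExp t‖ ≤ 2 / (1 + t ^ 2) := by
  by_cases ht : t ∈ Ici (0 : ℝ)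
  · simp only [causalExp, ht, indicator_of_mem]
    rw [norm_exp, neg_re, ofReal_re, Real.exp_neg, ← one_div,
      div_le_div_iff₀ (Real.exp_pos _) (by positivity)]
    have := Real.quadratic_le_exp_of_nonneg (mem_Ici.1 ht)
    have h0 : 0 ≤ t := ht
    nlinarith
  · simp only [causalExp, ht, not_false_eq_true, indicator_of_notMem, norm_zero]
    positivity

/-- Translates of an integrable function are jointly integrable against a finite measure. -/
theorem integrable_sub_prod {E : Type*} [NormedAddCommGroup E] {f : ℝ → E}
    (hf : Integrable f) (hfm : StronglyMeasurable f) (ν : Measure ℝ) [IsFiniteMeasure ν] :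
    Integrable (fun p : ℝ × ℝ => f (p.1 - p.2)) (volume.prod ν) := by
  have hm : AEStronglyMeasurable (fun p : ℝ × ℝ => f (p.1 - p.2)) (volume.prod ν) :=
    (hfm.comp_measurable (measurable_fst.sub measurable_snd)).aestronglyMeasurable
  rw [integrable_prod_iff' hm]
  refine ⟨Eventually.of_forall fun v => hf.comp_sub_right v, ?_⟩
  have : ∀ v, ∫ t, ‖f (t - v)‖ = ∫ t, ‖f t‖ := fun v =>
    integral_sub_right_eq_self (fun t => ‖f t‖) v
  simp only [this]
  exact integrable_const _

variable {ν : Measure ℝ} [IsFiniteMeasure ν] {φ : ℝ → ℝ}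

theorem integrable_smul_sub_prod {E : Type*} [NormedAddCommGroup E] [NormedSpace ℝ E] {f : ℝ → E}
    (hf : Integrable f) (hfm : StronglyMeasurable f) (hφ : Measurable φ) (hφ1 : ∀ v, |φ v| ≤ 1) :
    Integrable (fun p : ℝ × ℝ => φ p.2 • f (p.1 - p.2)) (volume.prod ν) :=
  (integrable_sub_prod hf hfm ν).bdd_smul 1 (hφ.comp measurable_snd).aestronglyMeasurable
    (Eventually.of_forall fun p => hφ1 p.2)

/-- Fubini and translation invariance. The weight φ will be the sign of a signed measure, or the
constant 1. -/
theorem fourier_conv_measure {f : ℝ → ℂ} (hf : Integrable f) (hfm : StronglyMeasurable f)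
    (hφ : Measurable φ) (hφ1 : ∀ v, |φ v| ≤ 1) (ξ : ℝ) :
    𝓕 (fun t => ∫ v, φ v • f (t - v) ∂ν) ξ = 𝓕 f ξ * ∫ v, φ v • exp (axis ξ * v) ∂ν := by
  rw [fourier_axis_eq, fourier_axis_eq]
  have hi : Integrable (fun p : ℝ × ℝ => exp (axis ξ * p.1) * (φ p.2 • f (p.1 - p.2)))
      (volume.prod ν) :=
    Integrable.bdd_mul (c := 1) (integrable_smul_sub_prod hf hfm hφ hφ1)
      (Continuous.aestronglyMeasurable (by fun_prop))
      (Eventually.of_forall fun p => (norm_exp_axis _ _).le)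
  calc ∫ t : ℝ, exp (axis ξ * t) * ∫ v, φ v • f (t - v) ∂ν
      = ∫ t : ℝ, ∫ v, exp (axis ξ * t) * (φ v • f (t - v)) ∂ν := by
        simp_rw [integral_const_mul]
    _ = ∫ v, (∫ t : ℝ, exp (axis ξ * t) * (φ v • f (t - v))) ∂ν :=
        integral_integral_swap hi
    _ = ∫ v, (∫ t : ℝ, exp (axis ξ * t) * f t) * (φ v • exp (axis ξ * v)) ∂ν := by
        congr 1
        ext v
        rw [← integral_sub_right_eq_self (fun t : ℝ => exp (axis ξ * t) * f t) v,
          ← integral_mul_const]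
        congr 1
        ext t
        have : exp (axis ξ * t) = exp (axis ξ * ((t - v : ℝ) : ℂ)) * exp (axis ξ * v) := by
          rw [← exp_add]; congr 1; push_cast; ring
        rw [this, real_smul, real_smul]
        ring
    _ = _ := by rw [integral_const_mul]

theorem integrable_conv_measure {E : Type*} [NormedAddCommGroup E] [NormedSpace ℝ E] {f : ℝ → E}
    (hf : Integrable f) (hfm : StronglyMeasurable f)
    (hφ : Measurable φ) (hφ1 : ∀ v, |φ v| ≤ 1) :
    Integrable (fun t => ∫ v, φ v • f (t - v) ∂ν) :=
  (integrable_smul_sub_prod hf hfm hφ hφ1).integral_prod_left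

theorem fourier_add_apply {f g : ℝ → ℂ} (hf : Integrable f) (hg : Integrable g) (ξ : ℝ) :
    𝓕 (fun t => f t + g t) ξ = 𝓕 f ξ + 𝓕 g ξ := by
  simp only [fourier_axis_eq, mul_add]
  have h : ∀ {f : ℝ → ℂ}, Integrable f → Integrable fun t : ℝ => exp (axis ξ * t) * f t :=
    fun hf => hf.bdd_mul (c := 1) (Continuous.aestronglyMeasurable (by fun_prop))
      (Eventually.of_forall fun p => (norm_exp_axis _ _).le)
  exact integral_add (h hf) (h hg)

theorem fourier_sum_apply {ι : Type*} (s : Finset ι) {f : ι → ℝ → ℂ}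
    (hf : ∀ i ∈ s, Integrable (f i)) (ξ : ℝ) :
    𝓕 (fun t => ∑ i ∈ s, f i t) ξ = ∑ i ∈ s, 𝓕 (f i) ξ := by
  simp only [fourier_axis_eq, Finset.mul_sum]
  have h : ∀ {f : ℝ → ℂ}, Integrable f → Integrable fun t : ℝ => exp (axis ξ * t) * f t :=
    fun hf => hf.bdd_mul (c := 1) (Continuous.aestronglyMeasurable (by fun_prop))
      (Eventually.of_forall fun p => (norm_exp_axis _ _).le)
  exact integral_finsetSum s fun i hi => h (hf i hi)

theorem fourier_const_mul_apply (c : ℂ) (f : ℝ → ℂ) (ξ : ℝ) :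
    𝓕 (fun t => c * f t) ξ = c * 𝓕 f ξ := by
  simp only [fourier_axis_eq, ← integral_const_mul]
  congr 1
  ext t
  ring

/-- If `𝓕 q` is `2πiξ 𝓕 r`, then `q` is the derivative of `r` in the integrated sense. -/
theorem fourierInv_sub_eq_integral {R q : ℝ → ℂ} (hR : Integrable R) (hq : Integrable q)
    (hqm : StronglyMeasurable q) (h : ∀ ξ, 𝓕 q ξ = -axis ξ * R ξ) {T : ℝ} (hT : 0 ≤ T) :
    𝓕⁻ R T - 𝓕⁻ R 0 = ∫ b in (0 : ℝ)..T, q b := by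
  -- G is the integral of q over the sliding window [t, t + T]. It is continuous and integrable, and
  -- so is its transform (e^{−zT} − 1) R with z = `axis ξ` integrable; hence Fourier inversion holds
  -- pointwise, in particular at t = 0, even if q is discontinuous.
  set G : ℝ → ℂ := fun t => ∫ v in Ioc (-T) 0, (1 : ℝ) • q (t - v)
  have hone : Measurable fun _ : ℝ => (1 : ℝ) := measurable_const
  have hone' : ∀ v : ℝ, |(fun _ : ℝ => (1 : ℝ)) v| ≤ 1 := fun v => by simp
  have hGi : Integrable G := integrable_conv_measure (ν := volume.restrict (Ioc (-T) 0)) hq hqm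
    hone hone'
  have hG : ∀ t, G t = ∫ b in t..(t + T), q b := fun t => by
    simp only [G, one_smul]
    rw [← intervalIntegral.integral_of_le (by linarith), intervalIntegral.integral_comp_sub_left]
    simp
  have hqi : ∀ a b, IntervalIntegrable q volume a b := fun a b => hq.intervalIntegrable
  have hGc : Continuous G := by
    have h1 : G = fun t => (∫ b in (0 : ℝ)..(t + T), q b) - ∫ b in (0 : ℝ)..t, q b := by
      ext t
      rw [hG, intervalIntegral.integral_interval_sub_left (hqi _ _) (hqi _ _)]
    rw [h1]
    have h2 := intervalIntegral.continuous_primitive hqi 0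
    exact (h2.comp (continuous_id.add continuous_const)).sub h2
  have hFG : ∀ ξ, 𝓕 G ξ = (exp (-axis ξ * T) - 1) * R ξ := fun ξ => by
    have h1 := fourier_conv_measure (ν := volume.restrict (Ioc (-T) 0)) hq hqm hone hone' ξ
    rw [h] at h1
    have h2 : ∫ v in Ioc (-T) 0, (1 : ℝ) • exp (axis ξ * v)
        = ∫ v in (-T)..0, exp (axis ξ * v) := by
      rw [intervalIntegral.integral_of_le (by linarith)]
      simp
    refine h1.trans ?_
    rw [h2]
    -- At zero frequency the formula for the exponential integral would divide by zero; both sides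
    -- vanish there.
    by_cases h0 : axis ξ = 0
    · simp [h0]
    · rw [integral_exp_mul_complex h0]
      simp only [ofReal_zero, mul_zero, exp_zero, ofReal_neg, mul_neg, neg_mul]
      field_simp
      ring
  have hFGi : Integrable (𝓕 G) := by
    have h1 : 𝓕 G = fun ξ => (exp (-axis ξ * T) - 1) * R ξ := funext hFG
    rw [h1]
    refine hR.bdd_mul (c := 2) (Continuous.aestronglyMeasurable ?_) (Eventually.of_forall fun ξ => ?_)
    · have := continuous_axis
      fun_prop
    · refine (norm_sub_le _ _).trans ?_
      have := norm_exp_axis ξ (-T)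
      rw [ofReal_neg, mul_neg, ← neg_mul] at this
      rw [this, norm_one]
      norm_num
  have h1 := congrFun (hGc.fourierInv_fourier_eq hGi hFGi) 0
  rw [hG, zero_add] at h1
  rw [← h1, fourierInv_axis_eq, fourierInv_axis_eq, fourierInv_axis_eq, ← integral_sub]
  · congr 1
    ext v
    rw [hFG]
    simp only [ofReal_zero, mul_zero, exp_zero]
    ring
  · refine hR.bdd_mul (c := 1) (Continuous.aestronglyMeasurable ?_) (Eventually.of_forall fun ξ => ?_)
    · have := continuous_axis
      fun_prop
    · have := norm_exp_axis ξ (-T)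
      rw [ofReal_neg, mul_neg, ← neg_mul] at this
      rw [this]
  · simpa using hR

theorem ae_comp_mul_left {p : ℝ → Prop} (h : ∀ᵐ y, p y) {c : ℝ} (hc : c ≠ 0) :
    ∀ᵐ x : ℝ, p (c * x) := by
  refine ae_of_ae_map (f := fun x => c * x) (by fun_prop) ?_
  rw [Real.map_volume_mul_left hc]
  exact Measure.ae_smul_measure h _

/-- On L¹ ∩ L² the L² transform is the integral transform: this is tested against Schwartz
functions, since Lᵖ embeds injectively into the tempered distributions. Injectivity of the L²
transform then identifies g with f. -/
theorem ae_eq_of_fourierL2_eq {g f : ℝ → ℂ} (hg : MemLp g 2 volume) (hf : Integrable f)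
    (hf2 : MemLp f 2 volume) (h : ∀ᵐ y : ℝ, fourierL2 (hg.toLp g) y = 𝓕 f (-(y / (2 * Real.pi)))) :
    g =ᵐ[volume] f := by
  have h1 : ((𝓕 (hg.toLp g) : Lp ℂ 2 (volume : Measure ℝ)) : ℝ → ℂ) =ᵐ[volume] 𝓕 f := by
    -- The substitution y = −2πξ undoes the change of normalisation in `fourierL2`.
    filter_upwards [ae_comp_mul_left h (c := -(2 * Real.pi)) (by simp [Real.pi_ne_zero])] with ξ hξ
    have e : -(-(2 * Real.pi) * ξ / (2 * Real.pi)) = ξ := by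
      have := Real.pi_ne_zero
      field_simp
    simpa only [fourierL2, e] using hξ
  have key : (𝓕 (hf2.toLp f) : Lp ℂ 2 (volume : Measure ℝ)) = 𝓕 (hg.toLp g) := by
    have hinj := LinearMap.ker_eq_bot.1
      (Lp.ker_toTemperedDistributionCLM_eq_bot (F := ℂ) (μ := (volume : Measure ℝ)) (p := 2))
    apply hinj
    ext φ
    have hs : ∫ x, 𝓕 (φ : ℝ → ℂ) x • f x = ∫ x, φ x • 𝓕 f x := by
      simpa using! VectorFourier.integral_bilin_fourierIntegral_eq_flip (.lsmul ℂ ℂ) (L := innerₗ ℝ)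
        Real.continuous_fourierChar continuous_inner φ.integrable hf
    simp only [ContinuousLinearMap.coe_coe, Lp.toTemperedDistributionCLM_apply,
      ← Lp.fourier_toTemperedDistribution_eq (hf2.toLp f), TemperedDistribution.fourier_apply,
      Lp.toTemperedDistribution_apply, SchwartzMap.fourier_coe]
    rw [integral_congr_ae (hf2.coeFn_toLp.mono fun x hx => by rw [hx]), hs]
    exact integral_congr_ae (h1.mono fun x hx => by simp only [hx])
  have h2 : hf2.toLp f = hg.toLp g := (Lp.fourierTransformₗᵢ ℝ ℂ).injective key
  exact (hg.coeFn_toLp.symm.trans (by rw [h2])).trans hf2.coeFn_toLp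

end FourierScalar


/-! ### Construction of the kernel by Fourier inversion, and its resolvent equation. -/

section ComplexKernel

open Complex Filter

theorem continuous_fourierInv {f : ℝ → ℂ} (hf : Integrable f) : Continuous (𝓕⁻ f) := by
  have h : 𝓕⁻ f = fun x => 𝓕 f (-x) := by ext x; exact Real.fourierInv_eq_fourier_neg _ _
  have h1 : Continuous (𝓕 f) := VectorFourier.fourierIntegral_continuous
    Real.continuous_fourierChar (L := innerₗ ℝ) continuous_inner hf
  rw [h]
  exact h1.comp continuous_neg

theorem continuousWithinAt_causalExp (t : ℝ) : ContinuousWithinAt causalExp (Ici t) t := by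
  have hc : Continuous fun t : ℝ => exp (-t) := by fun_prop
  rcases lt_or_ge t 0 with ht | ht
  · have : causalExp =ᶠ[nhds t] fun _ => 0 := by
      filter_upwards [Iio_mem_nhds ht] with x hx
      simp only [causalExp, indicator_of_notMem (by simpa using hx : x ∉ Ici (0 : ℝ))]
    exact (continuousAt_const.congr this.symm).continuousWithinAt
  · refine hc.continuousWithinAt.congr (fun x hx => ?_) ?_
    · exact indicator_of_mem (mem_Ici.2 (ht.trans hx)) _
    · exact indicator_of_mem (mem_Ici.2 ht) _

theorem integral_causalExp {T : ℝ} (hT : 0 ≤ T) :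
    ∫ b in (0 : ℝ)..T, causalExp b = 1 - causalExp T := by
  have h1 : ∫ b in (0 : ℝ)..T, causalExp b = ∫ b in (0 : ℝ)..T, exp (-1 * (b : ℂ)) := by
    refine intervalIntegral.integral_congr fun b hb => ?_
    rw [uIcc_of_le hT] at hb
    simp only [causalExp, indicator_of_mem (mem_Ici.2 hb.1), neg_one_mul]
  rw [h1, integral_exp_mul_complex (by simp)]
  simp only [causalExp, indicator_of_mem (mem_Ici.2 hT)]
  simp [div_neg]

variable {n : ℕ} {η : Matrix (Fin n) (Fin n) (SignedMeasure ℝ)}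

/-- The part of the kernel with a continuous density. -/
noncomputable def smoothPart (η : Matrix (Fin n) (Fin n) (SignedMeasure ℝ)) (i k : Fin n) :
    ℝ → ℂ :=
  𝓕⁻ fun ξ => regSymbol η (axis ξ) i k

/-- The right-continuous kernel with Fourier transform `h⁻¹`, with complex values. -/
noncomputable def cKernel (η : Matrix (Fin n) (Fin n) (SignedMeasure ℝ)) (i k : Fin n) (t : ℝ) :
    ℂ :=
  (1 : Matrix (Fin n) (Fin n) ℂ) i k * causalExp t + smoothPart η i k t

variable (hdet : ∀ z : ℂ, z.re ≤ 0 → (hFun η z).det ≠ 0) (hη : ConcentratedOnNonneg η)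
  (hm : HasMoment η 2)

include hdet hη

theorem continuous_regSymbol_axis (i k : Fin n) :
    Continuous fun ξ => regSymbol η (axis ξ) i k := by
  let _ := Matrix.linftyOpNormedRing (n := Fin n) (α := ℂ)
  let _ := Matrix.linftyOpNormedAlgebra (R := ℂ) (n := Fin n) (α := ℂ)
  exact (entryCLM i k).continuous.comp
    ((continuousOn_regSymbol hdet hη).comp_continuous continuous_axis axis_re_le)

theorem exists_norm_regSymbol_apply_le :
    ∃ c, 0 ≤ c ∧ ∀ i k, ∀ z : ℂ, z.re ≤ 0 → ‖regSymbol η z i k‖ ≤ c / (1 + ‖z‖) ^ 2 := by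
  obtain ⟨c, hc, h⟩ := exists_norm_regSymbol_le hdet hη
  exact ⟨c, hc, fun i k z hz => (norm_apply_le _ i k).trans (h z hz)⟩

theorem integrable_regSymbol_axis (i k : Fin n) :
    Integrable fun ξ => regSymbol η (axis ξ) i k := by
  obtain ⟨c, hc, h⟩ := exists_norm_regSymbol_apply_le hdet hη
  refine (integrable_inv_one_add_sq.const_mul c).mono
    (continuous_regSymbol_axis hdet hη i k).aestronglyMeasurable (Eventually.of_forall fun ξ => ?_)
  refine (h i k _ (axis_re_le ξ)).trans ?_
  have h1 := inv_one_add_norm_axis_sq_le ξ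
  rw [div_pow, one_pow] at h1
  rw [Real.norm_of_nonneg (by positivity), div_eq_mul_one_div, ← one_div]
  gcongr

theorem continuous_smoothPart (i k : Fin n) : Continuous (smoothPart η i k) :=
  continuous_fourierInv (integrable_regSymbol_axis hdet hη i k)

theorem measurable_cKernel (i k : Fin n) : Measurable (cKernel η i k) :=
  (measurable_causalExp.const_mul _).add (continuous_smoothPart hdet hη i k).measurable

theorem continuousWithinAt_cKernel (i k : Fin n) (t : ℝ) :
    ContinuousWithinAt (cKernel η i k) (Ici t) t :=
  (continuousWithinAt_const.mul (continuousWithinAt_causalExp t)).add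
    (continuous_smoothPart hdet hη i k).continuousWithinAt

include hm

/-- Cauchy's theorem for the regularised symbol. The case t = 0 matters too: it fixes the initial
value I of the kernel. -/
theorem smoothPart_eq_zero (i k : Fin n) {t : ℝ} (ht : t ≤ 0) : smoothPart η i k t = 0 := by
  let _ := Matrix.linftyOpNormedRing (n := Fin n) (α := ℂ)
  let _ := Matrix.linftyOpNormedAlgebra (R := ℂ) (n := Fin n) (α := ℂ)
  obtain ⟨c, hc, h⟩ := exists_norm_regSymbol_apply_le hdet hη
  exact fourierInv_axis_eq_zero (F := fun z => regSymbol η z i k)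
    ((entryCLM i k).continuous.comp_continuousOn (continuousOn_regSymbol hdet hη))
    ((entryCLM i k).differentiable.comp_differentiableOn (differentiableOn_regSymbol hdet hη hm))
    (h i k) ht

theorem cKernel_eq_zero (i k : Fin n) {t : ℝ} (ht : t < 0) : cKernel η i k t = 0 := by
  rw [cKernel, smoothPart_eq_zero hdet hη hm i k ht.le, causalExp,
    indicator_of_notMem (by simpa using ht), mul_zero, add_zero]

theorem exists_norm_smoothPart_le (i k : Fin n) :
    ∃ c, 0 ≤ c ∧ ∀ t, ‖smoothPart η i k t‖ ≤ c / (1 + t ^ 2) := by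
  let _ := Matrix.linftyOpNormedRing (n := Fin n) (α := ℂ)
  let _ := Matrix.linftyOpNormedAlgebra (R := ℂ) (n := Fin n) (α := ℂ)
  obtain ⟨R1, R2, c, h1, h2, hc⟩ := exists_deriv_regSymbol hdet hη hm
  have hd1 : ∀ ξ, HasDerivAt (fun ξ => regSymbol η (axis ξ) i k) (R1 ξ i k) ξ := fun ξ =>
    ((entryCLM i k).restrictScalars ℝ).hasFDerivAt.comp_hasDerivAt ξ (h1 ξ)
  have hd2 : ∀ ξ, HasDerivAt (fun ξ => R1 ξ i k) (R2 ξ i k) ξ := fun ξ =>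
    ((entryCLM i k).restrictScalars ℝ).hasFDerivAt.comp_hasDerivAt ξ (h2 ξ)
  -- The second derivative is known to be bounded but not continuous; being a derivative, it is
  -- measurable.
  have hm2 : Measurable fun ξ => R2 ξ i k := by
    have : (fun ξ => R2 ξ i k) = deriv fun ξ => R1 ξ i k := funext fun ξ => (hd2 ξ).deriv.symm
    rw [this]
    exact measurable_deriv _
  have hi : ∀ f : ℝ → ℂ, AEStronglyMeasurable f → (∀ ξ, ‖f ξ‖ ≤ c * (1 / (1 + ξ ^ 2))) →
      Integrable f := fun f hf hb =>
    (integrable_inv_one_add_sq.const_mul c).mono' hf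
      (Eventually.of_forall fun ξ => by simpa only [one_div] using hb ξ)
  exact exists_norm_fourierInv_le hd1 hd2 (integrable_regSymbol_axis hdet hη i k)
    (hi _ (continuous_iff_continuousAt.2 fun ξ => (hd2 ξ).continuousAt).aestronglyMeasurable
      fun ξ => (norm_apply_le _ i k).trans (hc ξ).1)
    (hi _ hm2.aestronglyMeasurable fun ξ => (norm_apply_le _ i k).trans (hc ξ).2)

theorem exists_norm_cKernel_le : ∃ c, 0 ≤ c ∧ ∀ i k t, ‖cKernel η i k t‖ ≤ c / (1 + t ^ 2) := by
  choose c hc h using exists_norm_smoothPart_le hdet hη hm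
  refine ⟨2 + ∑ i, ∑ k, c i k, add_nonneg zero_le_two
    (Finset.sum_nonneg fun i _ => Finset.sum_nonneg fun k _ => hc i k), fun i k t => ?_⟩
  have h1 : c i k ≤ ∑ i, ∑ k, c i k :=
    (Finset.single_le_sum (f := fun k => c i k) (fun k _ => hc i k) (Finset.mem_univ k)).trans
      (Finset.single_le_sum (f := fun i => ∑ k, c i k)
        (fun i _ => Finset.sum_nonneg fun k _ => hc i k) (Finset.mem_univ i))
  have h2 : ‖(1 : Matrix (Fin n) (Fin n) ℂ) i k‖ ≤ 1 := by
    rw [Matrix.one_apply]; split_ifs <;> simp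
  calc ‖cKernel η i k t‖ ≤ 1 * (2 / (1 + t ^ 2)) + c i k / (1 + t ^ 2) := by
        refine (norm_add_le _ _).trans (add_le_add ?_ (h i k t))
        rw [norm_mul]
        exact mul_le_mul h2 (norm_causalExp_le t) (norm_nonneg _) zero_le_one
    _ = (2 + c i k) / (1 + t ^ 2) := by ring
    _ ≤ _ := by gcongr

theorem integrable_smoothPart (i k : Fin n) : Integrable (smoothPart η i k) := by
  obtain ⟨c, hc, h⟩ := exists_norm_smoothPart_le hdet hη hm i k
  exact (integrable_inv_one_add_sq.const_mul c).mono'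
    (continuous_smoothPart hdet hη i k).aestronglyMeasurable
    (Eventually.of_forall fun t => by simpa only [div_eq_mul_inv] using h t)

theorem integrable_cKernel (i k : Fin n) : Integrable (cKernel η i k) :=
  (integrable_causalExp.const_mul _).add (integrable_smoothPart hdet hη hm i k)

theorem memLp_cKernel (i k : Fin n) : MemLp (cKernel η i k) 2 volume := by
  obtain ⟨c, hc, h⟩ := exists_norm_cKernel_le hdet hη hm
  have hi := integrable_cKernel hdet hη hm i k
  refine (memLp_two_iff_integrable_sq_norm hi.1).2 ((hi.norm.const_mul c).mono'
    (hi.1.norm.pow 2) (Eventually.of_forall fun t => ?_))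
  rw [Real.norm_of_nonneg (by positivity), sq]
  gcongr
  exact (h i k t).trans (div_le_self hc (by nlinarith [sq_nonneg t]))

/-- The decay of the smooth part makes it integrable, so Fourier inversion also holds in this
direction. -/
theorem fourier_smoothPart (i k : Fin n) (ξ : ℝ) :
    𝓕 (smoothPart η i k) ξ = regSymbol η (axis ξ) i k := by
  have hi : Integrable (𝓕 fun ξ => regSymbol η (axis ξ) i k) := by
    have h : (𝓕 fun ξ => regSymbol η (axis ξ) i k) = fun t => smoothPart η i k (-t) := by
      ext t
      rw [smoothPart, Real.fourierInv_eq_fourier_neg, neg_neg]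
    rw [h]
    exact (integrable_smoothPart hdet hη hm i k).comp_neg
  exact congrFun ((continuous_regSymbol_axis hdet hη i k).fourier_fourierInv_eq
    (integrable_regSymbol_axis hdet hη i k) hi) ξ

theorem fourier_cKernel (i k : Fin n) (ξ : ℝ) :
    𝓕 (cKernel η i k) ξ = (hFun η (axis ξ))⁻¹ i k := by
  unfold cKernel
  rw [fourier_add_apply (integrable_causalExp.const_mul _) (integrable_smoothPart hdet hη hm i k),
    fourier_const_mul_apply, fourier_causalExp, fourier_smoothPart hdet hη hm, regSymbol,
    Matrix.sub_apply, Matrix.smul_apply, smul_eq_mul]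
  ring

/-- The kernel solves the resolvent equation `f' = f ∗ η`. -/
theorem cKernel_eq_integral (i k : Fin n) {T : ℝ} (hT : 0 ≤ T) :
    cKernel η i k T = (1 : Matrix (Fin n) (Fin n) ℂ) i k + ∫ b in (0 : ℝ)..T,
      ∑ j, ∫ v, sgn (η j k) v • cKernel η i j (b - v) ∂(η j k).variation := by
  have hfi := integrable_cKernel hdet hη hm
  have hfm := fun i k => (measurable_cKernel hdet hη i k).stronglyMeasurable
  have habs : ∀ j k v, |sgn (η j k) v| ≤ 1 := fun j k v => (abs_sgn _ v).le
  have hci : ∀ j, Integrable fun b =>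
      ∫ v, sgn (η j k) v • cKernel η i j (b - v) ∂(η j k).variation := fun j =>
    integrable_conv_measure (hfi i j) (hfm i j) (measurable_sgn _) (habs j k)
  have hcm : ∀ j, StronglyMeasurable fun b =>
      ∫ v, sgn (η j k) v • cKernel η i j (b - v) ∂(η j k).variation := fun j => by
    refine StronglyMeasurable.integral_prod_right (f := fun b v =>
      sgn (η j k) v • cKernel η i j (b - v)) ?_
    exact (((measurable_sgn _).comp measurable_snd).smul
      ((measurable_cKernel hdet hη i j).comp
        (measurable_fst.sub measurable_snd))).stronglyMeasurable
  -- With z = `axis ξ`, the first summand has transform h⁻¹ L[η] = −1 − z h⁻¹, and the second adds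
  -- (1 − z)⁻¹ = 1 + z (1 − z)⁻¹ times the identity. So the transform of q is −z times the
  -- regularised symbol, and q is the derivative of the smooth part.
  set q : ℝ → ℂ := fun b => (∑ j, ∫ v, sgn (η j k) v • cKernel η i j (b - v) ∂(η j k).variation)
    + (1 : Matrix (Fin n) (Fin n) ℂ) i k * causalExp b with hqdef
  have hqs : Integrable fun b =>
      ∑ j, ∫ v, sgn (η j k) v • cKernel η i j (b - v) ∂(η j k).variation :=
    integrable_finsetSum _ fun j _ => hci j
  have h := fourierInv_sub_eq_integral (R := fun ξ => regSymbol η (axis ξ) i k) (q := q)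
    (integrable_regSymbol_axis hdet hη i k) (hqs.add (integrable_causalExp.const_mul _)) ?_ ?_ hT
  · change smoothPart η i k T - smoothPart η i k 0 = _ at h
    rw [smoothPart_eq_zero hdet hη hm i k le_rfl, sub_zero, hqdef,
      intervalIntegral.integral_add hqs.intervalIntegrable
        (integrable_causalExp.const_mul _).intervalIntegrable,
      intervalIntegral.integral_const_mul, integral_causalExp hT] at h
    rw [cKernel, h]
    ring
  · refine StronglyMeasurable.add ?_ (measurable_causalExp.const_mul _).stronglyMeasurable
    exact Finset.stronglyMeasurable_fun_sum _ fun j _ => hcm j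
  · intro ξ
    rw [hqdef, fourier_add_apply hqs (integrable_causalExp.const_mul _),
      fourier_const_mul_apply, fourier_causalExp, fourier_sum_apply _ fun j _ => hci j]
    have h1 : ∀ j, 𝓕 (fun b => ∫ v, sgn (η j k) v • cKernel η i j (b - v) ∂(η j k).variation) ξ
        = (hFun η (axis ξ))⁻¹ i j * laplace η (axis ξ) j k := fun j => by
      rw [fourier_conv_measure (hfi i j) (hfm i j) (measurable_sgn _) (habs j k),
        fourier_cKernel hdet hη hm, laplace_apply, lap]
    simp only [h1]
    rw [← Matrix.mul_apply]
    have h2 := congrFun (congrFun (smul_hInv hdet (axis_re_le ξ)) i) k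
    simp only [Matrix.sub_apply, Matrix.neg_apply, Matrix.smul_apply, smul_eq_mul] at h2
    have h3 : (1 - axis ξ) * (1 - axis ξ)⁻¹ = 1 :=
      mul_inv_cancel₀ (one_sub_ne_zero (axis_re_le ξ))
    simp only [regSymbol, Matrix.sub_apply, Matrix.smul_apply, smul_eq_mul]
    linear_combination h2 + (1 : Matrix (Fin n) (Fin n) ℂ) i k * h3

end ComplexKernel


/-! ### Identification of g with the constructed kernel. -/

section RealKernel

open Filter

/-- Every interval to the right of t has positive measure and hence contains points of agreement, so
the right limits at t coincide. -/
theorem eq_of_ae_eq_of_continuousWithinAt {f g : ℝ → ℂ} (h : f =ᵐ[volume] g)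
    (hf : ∀ t, ContinuousWithinAt f (Ici t) t) (hg : ∀ t, ContinuousWithinAt g (Ici t) t) :
    f = g := by
  ext t
  have hfr : ∃ᶠ x in nhdsWithin t (Ioi t), f x = g x := by
    intro hne
    obtain ⟨u, hu, hu'⟩ := (mem_nhdsGT_iff_exists_Ioo_subset).1 hne
    have h0 : volume (Ioo t u) = 0 := measure_mono_null hu' (ae_iff.1 h)
    rw [Real.volume_Ioo, ENNReal.ofReal_eq_zero] at h0
    have : t < u := hu
    linarith
  exact tendsto_nhds_unique_of_frequently_eq ((hf t).mono Ioi_subset_Ici_self)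
    ((hg t).mono Ioi_subset_Ici_self) hfr

variable {n : ℕ} {η : Matrix (Fin n) (Fin n) (SignedMeasure ℝ)}

/-- The density `g ∗ η` of the absolutely continuous part of the kernel. -/
noncomputable def kdens (η : Matrix (Fin n) (Fin n) (SignedMeasure ℝ))
    (g : ℝ → Matrix (Fin n) (Fin n) ℝ) (i k : Fin n) (b : ℝ) : ℝ :=
  ∑ j, ∫ v, sgn (η j k) v * g (b - v) i j ∂(η j k).variation

variable {g : ℝ → Matrix (Fin n) (Fin n) ℝ}
  (hdet : ∀ z : ℂ, z.re ≤ 0 → (hFun η z).det ≠ 0) (hη : ConcentratedOnNonneg η)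
  (hm : HasMoment η 2) (hg : IsKernel η g)

include hdet hη hm hg

/-- Equal L² transforms give equality almost everywhere, and right continuity of both sides gives it
everywhere. Causality, decay and the resolvent equation thereby pass to g. -/
theorem ofReal_kernel (i k : Fin n) (t : ℝ) : (g t i k : ℂ) = cKernel η i k t := by
  refine congrFun (eq_of_ae_eq_of_continuousWithinAt (f := fun t => (g t i k : ℂ)) ?_ (fun t => ?_)
    fun t => continuousWithinAt_cKernel hdet hη i k t) t
  · refine ae_eq_of_fourierL2_eq (hg.memLp i k) (integrable_cKernel hdet hη hm i k)
      (memLp_cKernel hdet hη hm i k) ?_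
    filter_upwards [hg.fourier_eq i k] with y hy
    rw [hy, fourier_cKernel hdet hη hm]
    have : axis (-(y / (2 * Real.pi))) = Complex.I * y := by
      have := Real.pi_ne_zero
      rw [axis]
      congr 2
      field_simp
    rw [this]
  · exact Complex.continuous_ofReal.continuousAt.comp_continuousWithinAt
      (hg.right_continuous i k t)

theorem kernel_eq_zero (i k : Fin n) {t : ℝ} (ht : t < 0) : g t i k = 0 := by
  have h := ofReal_kernel hdet hη hm hg i k t
  rw [cKernel_eq_zero hdet hη hm i k ht] at h
  exact_mod_cast h

theorem exists_abs_kernel_le : ∃ c, 0 ≤ c ∧ ∀ i k t, |g t i k| ≤ c / (1 + t ^ 2) := by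
  obtain ⟨c, hc, h⟩ := exists_norm_cKernel_le hdet hη hm
  refine ⟨c, hc, fun i k t => ?_⟩
  have := h i k t
  rwa [← ofReal_kernel hdet hη hm hg, Complex.norm_real] at this

theorem measurable_kernel (i k : Fin n) : Measurable fun t => g t i k := by
  have : (fun t => g t i k) = fun t => (cKernel η i k t).re := by
    ext t; rw [← ofReal_kernel hdet hη hm hg, Complex.ofReal_re]
  rw [this]
  exact Complex.measurable_re.comp (measurable_cKernel hdet hη i k)

theorem integrable_kernel (i k : Fin n) : Integrable fun t => g t i k := by
  obtain ⟨c, hc, h⟩ := exists_abs_kernel_le hdet hη hm hg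
  exact (integrable_inv_one_add_sq.const_mul c).mono'
    (measurable_kernel hdet hη hm hg i k).aestronglyMeasurable
    (Eventually.of_forall fun t => by
      simpa only [div_eq_mul_inv, Real.norm_eq_abs] using h i k t)

theorem measurable_kdens (i k : Fin n) : Measurable (kdens η g i k) := by
  refine Finset.measurable_fun_sum _ fun j _ => ?_
  refine (StronglyMeasurable.integral_prod_right (f := fun b v =>
      sgn (η j k) v * g (b - v) i j) ?_).measurable
  exact (((measurable_sgn _).comp measurable_snd).mul
      ((measurable_kernel hdet hη hm hg i j).comp
        (measurable_fst.sub measurable_snd))).stronglyMeasurable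

theorem integrable_kdens (i k : Fin n) : Integrable (kdens η g i k) :=
  integrable_finsetSum _ fun j _ => integrable_conv_measure
    (integrable_kernel hdet hη hm hg i j) (measurable_kernel hdet hη hm hg i j).stronglyMeasurable
    (measurable_sgn _) fun v => (abs_sgn _ v).le

theorem kdens_eq_zero (i k : Fin n) {b : ℝ} (hb : b < 0) : kdens η g i k b = 0 := by
  refine Finset.sum_eq_zero fun j _ => integral_eq_zero_of_ae ?_
  filter_upwards [ae_nonneg (hη j k)] with v hv
  rw [kernel_eq_zero hdet hη hm hg i j (by linarith), mul_zero, Pi.zero_apply]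

/-- Boundedness, beyond integrability, is what allows products of the density with merely integrable
paths. -/
theorem exists_abs_kdens_le : ∃ c, 0 ≤ c ∧ ∀ i k b, |kdens η g i k b| ≤ c := by
  obtain ⟨c, hc, h⟩ := exists_abs_kernel_le hdet hη hm hg
  have h' : ∀ i k t, |g t i k| ≤ c := fun i k t =>
    (h i k t).trans (div_le_self hc (by nlinarith [sq_nonneg t]))
  have h0 : ∀ k, 0 ≤ ∑ j, c * (η j k).variation.real univ := fun k =>
    Finset.sum_nonneg fun j _ => mul_nonneg hc measureReal_nonneg
  refine ⟨∑ k, ∑ j, c * (η j k).variation.real univ, Finset.sum_nonneg fun k _ => h0 k,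
    fun i k b => ?_⟩
  refine ((Finset.abs_sum_le_sum_abs _ _).trans (Finset.sum_le_sum fun j _ => ?_)).trans
    (Finset.single_le_sum (f := fun k => ∑ j, c * (η j k).variation.real univ)
      (fun k _ => h0 k) (Finset.mem_univ k))
  refine norm_integral_le_of_norm_le_const (μ := (η j k).variation)
    (f := fun v => sgn (η j k) v * g (b - v) i j)
    (Eventually.of_forall fun v => ?_)
  rw [norm_mul, Real.norm_eq_abs, abs_sgn, one_mul]
  exact h' i j _

theorem kernel_eq_integral (i k : Fin n) {T : ℝ} (hT : 0 ≤ T) :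
    g T i k = (1 : Matrix (Fin n) (Fin n) ℝ) i k + ∫ b in (0 : ℝ)..T, kdens η g i k b := by
  have h := cKernel_eq_integral hdet hη hm i k hT
  simp only [← ofReal_kernel hdet hη hm hg] at h
  have h1 : ∀ b, (∑ j, ∫ v, sgn (η j k) v • (g (b - v) i j : ℂ) ∂(η j k).variation)
      = ((kdens η g i k b : ℝ) : ℂ) := fun b => by
    rw [kdens, Complex.ofReal_sum]
    refine Finset.sum_congr rfl fun j _ => ?_
    refine Eq.trans ?_ integral_complex_ofReal
    simp
  simp only [h1] at h
  rw [intervalIntegral.integral_ofReal] at h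
  have h2 : (1 : Matrix (Fin n) (Fin n) ℂ) i k = (((1 : Matrix (Fin n) (Fin n) ℝ) i k : ℝ) : ℂ) := by
    rw [Matrix.one_apply, Matrix.one_apply]; split_ifs <;> simp
  rw [h2] at h
  exact_mod_cast h

end RealKernel


/-! ### Distribution functions of finite signed measures. -/

section DistributionFunction

open Filter

variable {f : ℝ → ℝ} {m : SignedMeasure ℝ} (hf : ∀ t, f t = m (Iic t))

include hf

theorem sub_eq_of_distribution {a b : ℝ} (hab : a ≤ b) : f b - f a = m (Ioc a b) := by
  rw [hf, hf, ← Iic_union_Ioc_eq_Iic hab, VectorMeasure.of_union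
    (Iic_disjoint_Ioc le_rfl) measurableSet_Iic measurableSet_Ioc]
  ring

/-- The distribution function of a finite signed measure has bounded variation. -/
theorem boundedVariationOn_of_distribution : BoundedVariationOn f univ := by
  refine ne_top_of_le_ne_top (measure_ne_top m.variation univ) (iSup_le ?_)
  rintro ⟨N, u, hu, -⟩
  have hd : Pairwise (Function.onFun Disjoint fun i => Ioc (u i) (u (i + 1))) := by
    simpa using hu.pairwise_disjoint_on_Ioc_succ
  calc ∑ i ∈ Finset.range N, edist (f (u (i + 1))) (f (u i))
      ≤ ∑ i ∈ Finset.range N, m.variation (Ioc (u i) (u (i + 1))) := by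
        refine Finset.sum_le_sum fun i _ => ?_
        rw [edist_eq_enorm_sub, sub_eq_of_distribution hf (hu i.le_succ)]
        exact VectorMeasure.enorm_measure_le_variation _ _
    _ = m.variation (⋃ i ∈ Finset.range N, Ioc (u i) (u (i + 1))) :=
        (measure_biUnion_finset (fun i _ j _ hij => hd hij) fun i _ => measurableSet_Ioc).symm
    _ ≤ _ := measure_mono (subset_univ _)

/-- The half-lines form a π-system generating the Borel sets. Right continuity identifies the right
limits in the Stieltjes measure with f, and continuity of m along monotone sequences of half-lines
gives the limits 0 at −∞ and m(ℝ) at +∞. -/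
theorem vectorMeasure_of_distribution (hbv : BoundedVariationOn f univ)
    (hr : ∀ t, ContinuousWithinAt f (Ici t) t) : hbv.vectorMeasure = m := by
  have hrl : ∀ t, f.rightLim t = f t := fun t => (hr t).rightLim_eq
  have htop : limUnder atTop f = m univ := by
    have hl : Tendsto f atTop (nhds (limUnder atTop f)) := hbv.tendsto_atTop_limUnder
    have hl' := hl.comp (tendsto_natCast_atTop_atTop (R := ℝ))
    refine tendsto_nhds_unique hl' ?_
    have h := m.tendsto_vectorMeasure_iUnion_atTop_nat (s := fun i : ℕ => Iic (i : ℝ))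
      (fun i j hij => Iic_subset_Iic.2 (by exact_mod_cast hij)) fun i => measurableSet_Iic
    have hU : ⋃ i : ℕ, Iic (i : ℝ) = univ := by
      ext x; simpa using exists_nat_ge x
    rw [hU] at h
    simpa only [Function.comp_def, hf] using h
  have hbot : limUnder atBot f = 0 := by
    have hl : Tendsto f atBot (nhds (limUnder atBot f)) := hbv.tendsto_atBot_limUnder
    have hl' := hl.comp (tendsto_neg_atTop_atBot.comp (tendsto_natCast_atTop_atTop (R := ℝ)))
    refine tendsto_nhds_unique hl' ?_
    have h := m.tendsto_vectorMeasure_iInter_atTop_nat (s := fun i : ℕ => Iic (-(i : ℝ)))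
      (fun i j hij => Iic_subset_Iic.2 (neg_le_neg (by exact_mod_cast hij)))
      fun i => measurableSet_Iic
    have hU : ⋂ i : ℕ, Iic (-(i : ℝ)) = ∅ := by
      ext x
      obtain ⟨i, hi⟩ := exists_nat_gt (-x)
      simp only [mem_iInter, mem_Iic, mem_empty_iff_false, iff_false, not_forall]
      exact ⟨i, by linarith⟩
    rw [hU, VectorMeasure.empty] at h
    simpa only [Function.comp_def, hf] using h
  refine VectorMeasure.ext_of_generateFrom (range Iic) ?_ ?_ isPiSystem_Iic ?_
  · rintro _ ⟨t, rfl⟩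
    rw [hbv.vectorMeasure_Iic, hrl, hbot, sub_zero, hf]
  · rw [← borel_eq_generateFrom_Iic]; exact BorelSpace.measurable_eq
  · rw [hbv.vectorMeasure_univ, htop, hbot, sub_zero]

end DistributionFunction

/-! ### The Lebesgue–Stieltjes measure of g: an atom at 0 and a density. -/

section KernelMeasure

open Filter

variable {n : ℕ} {η : Matrix (Fin n) (Fin n) (SignedMeasure ℝ)}
  {g : ℝ → Matrix (Fin n) (Fin n) ℝ}
  (hdet : ∀ z : ℂ, z.re ≤ 0 → (hFun η z).det ≠ 0) (hη : ConcentratedOnNonneg η)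
  (hm : HasMoment η 2) (hg : IsKernel η g)

/-- The Lebesgue-Stieltjes measure of the kernel. -/
noncomputable def kernelMeasure (η : Matrix (Fin n) (Fin n) (SignedMeasure ℝ))
    (g : ℝ → Matrix (Fin n) (Fin n) ℝ) (i k : Fin n) : SignedMeasure ℝ :=
  VectorMeasure.dirac 0 ((1 : Matrix (Fin n) (Fin n) ℝ) i k)
    + volume.withDensityᵥ (kdens η g i k)

include hdet hη hm hg

/-- The atom at 0 is the jump of g from 0 to I; the density comes from the resolvent equation. -/
theorem kernel_eq_kernelMeasure (i k : Fin n) (t : ℝ) :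
    g t i k = kernelMeasure η g i k (Iic t) := by
  rw [kernelMeasure, add_apply, withDensityᵥ_apply
    (integrable_kdens hdet hη hm hg i k) measurableSet_Iic]
  rcases lt_or_ge t 0 with ht | ht
  · rw [kernel_eq_zero hdet hη hm hg i k ht, setIntegral_eq_zero_of_forall_eq_zero
      fun x (hx : x ∈ Iic t) => kdens_eq_zero hdet hη hm hg i k (lt_of_le_of_lt hx ht)]
    simp [VectorMeasure.dirac, ht]
  · rw [kernel_eq_integral hdet hη hm hg i k ht, intervalIntegral.integral_of_le ht]
    congr 1
    · simp [VectorMeasure.dirac, ht]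
    · have h0 : ∫ x in Iio 0, kdens η g i k x = 0 := setIntegral_eq_zero_of_forall_eq_zero
        fun x hx => kdens_eq_zero hdet hη hm hg i k hx
      rw [← Iic_union_Ioc_eq_Iic ht, setIntegral_union
        (Iic_disjoint_Ioc le_rfl) measurableSet_Ioc
        (integrable_kdens hdet hη hm hg i k).integrableOn
        (integrable_kdens hdet hη hm hg i k).integrableOn,
        setIntegral_congr_set Iio_ae_eq_Iic.symm, h0, zero_add]

theorem boundedVariationOn_kernel (i k : Fin n) : BoundedVariationOn (fun r => g r i k) univ :=
  boundedVariationOn_of_distribution (kernel_eq_kernelMeasure hdet hη hm hg i k)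

theorem vectorMeasure_kernel {i k : Fin n} (hbv : BoundedVariationOn (fun r => g r i k) univ) :
    hbv.vectorMeasure = kernelMeasure η g i k :=
  vectorMeasure_of_distribution (kernel_eq_kernelMeasure hdet hη hm hg i k) hbv
    (hg.right_continuous i k)

/-- The atom reads off f 0, and its location 0 belongs to [0, T) only if T > 0. For the rest,
integrability of f on (0, T] suffices because the density is bounded. -/
theorem integrableOn_kernelMeasure {i k : Fin n} {f : ℝ → ℝ} {T : ℝ} (hf : Measurable f)
    (hfi : IntegrableOn f (Ioc 0 T)) :
    VectorMeasure.IntegrableOn (kernelMeasure η g i k) f (Ico 0 T) ∧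
      (0 < T → ∫ᵛ v in Ico 0 T, f v ∂<•(kernelMeasure η g i k)
        = (1 : Matrix (Fin n) (Fin n) ℝ) i k * f 0
          + ∫ v in (0 : ℝ)..T, kdens η g i k v * f v) := by
  have hi : IntegrableOn f (Ico 0 T) := hfi.congr_set_ae Ico_ae_eq_Ioc
  obtain ⟨c, hc, hb⟩ := exists_abs_kdens_le hdet hη hm hg
  have hfm : Measurable ((Ico 0 T).indicator f) := hf.indicator measurableSet_Ico
  have hκ := integrable_kdens hdet hη hm hg i k
  have h1 : Integrable fun v => kdens η g i k v • (Ico 0 T).indicator f v :=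
    (hi.integrable_indicator measurableSet_Ico).bdd_smul c
      (measurable_kdens hdet hη hm hg i k).aestronglyMeasurable
      (Eventually.of_forall fun v => hb i k v)
  have hd1 := integrable_withDensityᵥ hκ hfm.aestronglyMeasurable h1
  have hd2 : (VectorMeasure.dirac (0 : ℝ) ((1 : Matrix (Fin n) (Fin n) ℝ) i k)).Integrable
      ((Ico 0 T).indicator f) := by
    rw [VectorMeasure.Integrable, VectorMeasure.variation_dirac]
    exact (integrable_dirac (by simp)).smul_measure (by simp)
  refine ⟨(VectorMeasure.integrable_indicator_iff measurableSet_Ico).1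
    (hd2.add_vectorMeasure hd1), fun hT => ?_⟩
  rw [← VectorMeasure.integral_indicator measurableSet_Ico, kernelMeasure,
    VectorMeasure.integral_add_vectorMeasure hd2 hd1, VectorMeasure.integral_dirac,
    integral_withDensityᵥ hκ (measurable_kdens hdet hη hm hg i k) hfm.aestronglyMeasurable h1]
  congr 1
  · simp [hT, mul_comm]
  · rw [intervalIntegral.integral_of_le hT.le, ← setIntegral_congr_set Ico_ae_eq_Ioc,
      ← integral_indicator measurableSet_Ico]
    congr 1
    ext v
    by_cases hv : v ∈ Ico 0 T <;> simp [hv]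

end KernelMeasure


/-! ### Variation of constants for a single path. -/

section VariationOfConstants

open Filter

variable {s t : ℝ}

/-- Cutting x down to (s, t] encodes the constraint v < u − s, since v ≥ 0 almost everywhere, and
the vanishing of w at negative arguments removes u > t. Both integrals then run over the whole line,
where Fubini and the substitution a = u − v apply. -/
theorem integral_mul_conv_eq {ν : Measure ℝ} [IsFiniteMeasure ν] (hν : ν (Iio 0) = 0) {σ : ℝ → ℝ}
    (hσ : Measurable σ) (hσ1 : ∀ v, |σ v| ≤ 1) {w : ℝ → ℝ} (hw : Measurable w) {c : ℝ}
    (hwc : ∀ b, |w b| ≤ c) (hw0 : ∀ b < 0, w b = 0) {x : ℝ → ℝ} (hx : Measurable x)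
    (hxi : IntegrableOn x (Ioc s t)) (hst : s ≤ t) :
    ∫ u in s..t, w (t - u) * ∫ v in Iio (u - s), σ v * x (u - v) ∂ν
      = ∫ a in s..t, (∫ v, σ v * w (t - a - v) ∂ν) * x a := by
  set y : ℝ → ℝ := (Ioc s t).indicator x
  have hy : Measurable y := hx.indicator measurableSet_Ioc
  have hyi : Integrable y := hxi.integrable_indicator measurableSet_Ioc
  have hν' : ∀ᵐ v ∂ν, 0 ≤ v := by
    filter_upwards [compl_mem_ae_iff.2 hν] with v hv
    simpa using hv
  have h1 : ∫ u in s..t, w (t - u) * ∫ v in Iio (u - s), σ v * x (u - v) ∂ν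
      = ∫ u, w (t - u) * ∫ v, σ v * y (u - v) ∂ν := by
    rw [intervalIntegral.integral_of_le hst, ← integral_indicator measurableSet_Ioc]
    congr 1
    ext u
    by_cases hu : u ∈ Ioc s t
    · rw [indicator_of_mem hu, ← integral_indicator measurableSet_Iio]
      congr 1
      refine integral_congr_ae ?_
      filter_upwards [hν'] with v hv
      by_cases hv' : v ∈ Iio (u - s)
      · have : u - v ∈ Ioc s t := ⟨by linarith [mem_Iio.1 hv'], by linarith [hu.2]⟩
        simp [y, hv', this]
      · have : u - v ∉ Ioc s t := fun h => hv' (by rw [mem_Iio]; linarith [h.1])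
        simp [y, hv', this]
    · rw [indicator_of_notMem hu]
      rcases le_or_gt u s with h | h
      · have : ∫ v, σ v * y (u - v) ∂ν = 0 := by
          refine integral_eq_zero_of_ae ?_
          filter_upwards [hν'] with v hv
          have : u - v ∉ Ioc s t := fun h' => by linarith [h'.1]
          simp [y, this]
        rw [this, mul_zero]
      · have : t < u := by by_contra h'; exact hu ⟨h, not_lt.1 h'⟩
        rw [hw0 _ (by linarith), zero_mul]
  have h2 : ∫ a in s..t, (∫ v, σ v * w (t - a - v) ∂ν) * x a
      = ∫ a, (∫ v, σ v * w (t - a - v) ∂ν) * y a := by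
    rw [intervalIntegral.integral_of_le hst, ← integral_indicator measurableSet_Ioc]
    congr 1
    ext a
    by_cases ha : a ∈ Ioc s t <;> simp [y, ha]
  rw [h1, h2]
  have hF : Integrable (fun p : ℝ × ℝ => w (t - p.1) * (σ p.2 * y (p.1 - p.2)))
      (volume.prod ν) :=
    (integrable_smul_sub_prod hyi hy.stronglyMeasurable hσ hσ1).bdd_mul (c := c)
      (hw.comp (measurable_const.sub measurable_fst)).aestronglyMeasurable
      (Eventually.of_forall fun p => hwc _)
  have hG : Integrable (fun p : ℝ × ℝ => (σ p.2 * w (t - p.1 - p.2)) * y p.1)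
      (volume.prod ν) := by
    refine (hyi.comp_fst ν).bdd_mul (c := c) (by fun_prop) (Eventually.of_forall fun p => ?_)
    rw [norm_mul, Real.norm_eq_abs, Real.norm_eq_abs]
    exact (mul_le_of_le_one_left (abs_nonneg _) (hσ1 _)).trans (hwc _)
  calc ∫ u, w (t - u) * ∫ v, σ v * y (u - v) ∂ν
      = ∫ u, ∫ v, w (t - u) * (σ v * y (u - v)) ∂ν := by simp_rw [integral_const_mul]
    _ = ∫ v, (∫ u, w (t - u) * (σ v * y (u - v))) ∂ν := integral_integral_swap hF
    _ = ∫ v, (∫ a, (σ v * w (t - a - v)) * y a) ∂ν := by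
        congr 1
        ext v
        rw [← integral_sub_right_eq_self (fun a => (σ v * w (t - a - v)) * y a) v]
        congr 1
        ext u
        rw [show t - (u - v) - v = t - u by ring]
        ring
    _ = ∫ a, ∫ v, (σ v * w (t - a - v)) * y a ∂ν := (integral_integral_swap hG).symm
    _ = _ := by simp_rw [integral_mul_const]

/-- Integration by parts for a merely integrable Y, that is, Fubini on the triangle s < u < w ≤ t.
-/
theorem integral_mul_eq_of_primitive {G κ Y : ℝ → ℝ} {δ : ℝ} (hκ : Integrable κ)
    (hG : ∀ T, 0 ≤ T → G T = δ + ∫ b in (0 : ℝ)..T, κ b) (hY : IntegrableOn Y (Ioc s t))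
    (hst : s ≤ t) :
    ∫ u in s..t, G (t - u) * Y u
      = δ * (∫ u in s..t, Y u) + ∫ w in s..t, κ (t - w) * ∫ u in s..w, Y u := by
  have hκt : Integrable fun w => κ (t - w) := hκ.comp_sub_left t
  set A : Set (ℝ × ℝ) := {p | p.1 < p.2}
  have hA : MeasurableSet A := measurableSet_lt measurable_fst measurable_snd
  have hF : Integrable (A.indicator fun p : ℝ × ℝ => Y p.1 * κ (t - p.2))
      ((volume.restrict (Ioc s t)).prod (volume.restrict (Ioc s t))) :=
    (Integrable.mul_prod hY hκt.integrableOn).indicator hA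
  have h1 : ∀ u ∈ Ioc s t, G (t - u) * Y u
      = δ * Y u + ∫ w in Ioc s t, A.indicator (fun p : ℝ × ℝ => Y p.1 * κ (t - p.2)) (u, w) := by
    intro u hu
    have e : ∀ w, A.indicator (fun p : ℝ × ℝ => Y p.1 * κ (t - p.2)) (u, w)
        = (Ioi u).indicator (fun w => Y u * κ (t - w)) w := fun w => by
      by_cases h : u < w <;> simp [A, h]
    simp only [e]
    rw [setIntegral_indicator measurableSet_Ioi]
    have : Ioc s t ∩ Ioi u = Ioc u t := by
      ext w; simp only [mem_inter_iff, mem_Ioc, mem_Ioi]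
      exact ⟨fun h => ⟨h.2, h.1.2⟩, fun h => ⟨⟨hu.1.trans h.1, h.2⟩, h.1⟩⟩
    rw [this, integral_const_mul, ← intervalIntegral.integral_of_le hu.2,
      intervalIntegral.integral_comp_sub_left, sub_self, hG _ (by linarith [hu.2])]
    ring
  have h2 : ∀ w ∈ Ioc s t, κ (t - w) * (∫ u in s..w, Y u)
      = ∫ u in Ioc s t, A.indicator (fun p : ℝ × ℝ => Y p.1 * κ (t - p.2)) (u, w) := by
    intro w hw
    have e : ∀ u, A.indicator (fun p : ℝ × ℝ => Y p.1 * κ (t - p.2)) (u, w)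
        = (Iio w).indicator (fun u => Y u * κ (t - w)) u := fun u => by
      by_cases h : u < w <;> simp [A, h]
    simp only [e]
    rw [setIntegral_indicator measurableSet_Iio]
    have : Ioc s t ∩ Iio w = Ioo s w := by
      ext u; simp only [mem_inter_iff, mem_Ioc, mem_Iio, mem_Ioo]
      exact ⟨fun h => ⟨h.1.1, h.2⟩, fun h => ⟨⟨h.1, (h.2.trans_le hw.2).le⟩, h.2⟩⟩
    rw [this, ← integral_Ioc_eq_integral_Ioo, integral_mul_const,
      ← intervalIntegral.integral_of_le hw.1.le, mul_comm]
  rw [intervalIntegral.integral_of_le hst, intervalIntegral.integral_of_le hst,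
    intervalIntegral.integral_of_le hst, setIntegral_congr_fun measurableSet_Ioc h1,
    setIntegral_congr_fun measurableSet_Ioc h2, integral_add (hY.const_mul δ) hF.integral_prod_left,
    integral_const_mul]
  congr 1
  exact integral_integral_swap hF

variable {n : ℕ} {η : Matrix (Fin n) (Fin n) (SignedMeasure ℝ)}

/-- The drift `∫ x^k_{u-v} η_{jk}(dv)` of a path. -/
noncomputable def drift (η : Matrix (Fin n) (Fin n) (SignedMeasure ℝ)) (x : ℝ → Fin n → ℝ)
    (j k : Fin n) (u : ℝ) : ℝ :=
  ∫ v, sgn (η j k) v * x (u - v) k ∂(η j k).variation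

/-- The part of the drift that depends on the path up to time `s`. -/
noncomputable def pastDrift (η : Matrix (Fin n) (Fin n) (SignedMeasure ℝ)) (x : ℝ → Fin n → ℝ)
    (s : ℝ) (j k : Fin n) (u : ℝ) : ℝ :=
  ∫ v in Ici (u - s), sgn (η j k) v * x (u - v) k ∂(η j k).variation

theorem delayConv_apply (x : ℝ → Fin n → ℝ) (s u : ℝ) (j : Fin n) :
    delayConv η x s u j = ∑ k, pastDrift η x s j k u :=
  Finset.sum_congr rfl fun _ _ => setIntegral_signedMeasure _ measurableSet_Ici _

theorem setIntegral_Ici_eq_drift (hη : ConcentratedOnNonneg η) (x : ℝ → Fin n → ℝ) (j k : Fin n)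
    (u : ℝ) : ∫ᵛ v in Ici (0 : ℝ), x (u - v) k ∂<•(η j k) = drift η x j k u := by
  have h : (η j k).variation.restrict (Ici 0) = (η j k).variation :=
    Measure.restrict_eq_self_of_ae_mem (ae_nonneg (hη j k))
  rw [setIntegral_signedMeasure _ measurableSet_Ici, h]
  rfl

/-- The path `x` is integrable on `(s, t]` together with its delayed values. -/
structure DelayIntegrable (η : Matrix (Fin n) (Fin n) (SignedMeasure ℝ)) (x : ℝ → Fin n → ℝ)
    (s t : ℝ) : Prop where
  measurable : ∀ k, Measurable fun u => x u k
  integrableOn : ∀ k, IntegrableOn (fun u => x u k) (Ioc s t)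
  integrable_prod : ∀ j k, Integrable (fun p : ℝ × ℝ => x (p.1 - p.2) k)
    ((volume.restrict (Ioc s t)).prod (η j k).variation)

section

variable {x : ℝ → Fin n → ℝ} (hx : DelayIntegrable η x s t)

include hx

theorem DelayIntegrable.integrable_sgn_mul (j k : Fin n) :
    Integrable (fun p : ℝ × ℝ => sgn (η j k) p.2 * x (p.1 - p.2) k)
      ((volume.restrict (Ioc s t)).prod (η j k).variation) :=
  (hx.integrable_prod j k).bdd_mul (c := 1)
    ((measurable_sgn _).comp measurable_snd).aestronglyMeasurable
    (Eventually.of_forall fun _ => (abs_sgn _ _).le)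

theorem DelayIntegrable.integrableOn_drift (j k : Fin n) :
    IntegrableOn (drift η x j k) (Ioc s t) :=
  (hx.integrable_sgn_mul j k).integral_prod_left

theorem DelayIntegrable.ae_integrable (j k : Fin n) :
    ∀ᵐ u ∂volume.restrict (Ioc s t), Integrable (fun v => x (u - v) k) (η j k).variation :=
  (hx.integrable_prod j k).prod_right_ae

theorem DelayIntegrable.integrableOn_pastDrift (j k : Fin n) :
    IntegrableOn (pastDrift η x s j k) (Ioc s t) := by
  have hA : MeasurableSet {p : ℝ × ℝ | p.1 - s ≤ p.2} :=
    measurableSet_le (measurable_fst.sub_const s) measurable_snd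
  have h := ((hx.integrable_sgn_mul j k).indicator hA).integral_prod_left
  refine h.congr (Eventually.of_forall fun u => ?_)
  rw [pastDrift, ← integral_indicator measurableSet_Ici]
  rfl

theorem DelayIntegrable.drift_eq (j k : Fin n) :
    ∀ᵐ u ∂volume.restrict (Ioc s t), drift η x j k u
      = pastDrift η x s j k u + ∫ v in Iio (u - s), sgn (η j k) v * x (u - v) k
        ∂(η j k).variation := by
  filter_upwards [hx.ae_integrable j k] with u hu
  have hi : Integrable (fun v => sgn (η j k) v * x (u - v) k) (η j k).variation :=
    (integrable_sgn_smul_iff _ _ _).2 hu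
  rw [drift, pastDrift, add_comm, ← setIntegral_union (Iio_disjoint_Ici le_rfl) measurableSet_Ici
    hi.integrableOn hi.integrableOn, Iio_union_Ici, setIntegral_univ]

end

variable {g : ℝ → Matrix (Fin n) (Fin n) ℝ}
  (hdet : ∀ z : ℂ, z.re ≤ 0 → (hFun η z).det ≠ 0) (hη : ConcentratedOnNonneg η)
  (hm : HasMoment η 2) (hg : IsKernel η g)

include hdet hη hm hg

theorem exists_abs_kernel_le_const : ∃ c, 0 ≤ c ∧ ∀ i k t, |g t i k| ≤ c := by
  obtain ⟨c, hc, h⟩ := exists_abs_kernel_le hdet hη hm hg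
  exact ⟨c, hc, fun i k t => (h i k t).trans (div_le_self hc (by nlinarith [sq_nonneg t]))⟩

theorem integrableOn_kernel_mul {f : ℝ → ℝ} (hf : IntegrableOn f (Ioc s t)) (i k : Fin n) (a : ℝ) :
    IntegrableOn (fun u => g (a - u) i k * f u) (Ioc s t) := by
  obtain ⟨c, hc, h⟩ := exists_abs_kernel_le_const hdet hη hm hg
  exact hf.bdd_mul (c := c) ((measurable_kernel hdet hη hm hg i k).comp
    (measurable_const.sub measurable_id)).aestronglyMeasurable (Eventually.of_forall fun p => h i k _)

theorem integrableOn_kdens_mul {f : ℝ → ℝ} (hf : IntegrableOn f (Ioc s t)) (i k : Fin n) (a : ℝ) :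
    IntegrableOn (fun u => kdens η g i k (a - u) * f u) (Ioc s t) := by
  obtain ⟨c, hc, h⟩ := exists_abs_kdens_le hdet hη hm hg
  exact hf.bdd_mul (c := c) ((measurable_kdens hdet hη hm hg i k).comp
    (measurable_const.sub measurable_id)).aestronglyMeasurable (Eventually.of_forall fun p => h i k _)

/-- The drift generated after time `s`, convolved with the kernel. -/
theorem sum_integral_kernel_mul_drift {x : ℝ → Fin n → ℝ} (hx : DelayIntegrable η x s t)
    (hst : s ≤ t) (i : Fin n) :
    ∑ j, ∫ u in s..t, g (t - u) i j * ∑ k, drift η x j k u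
      = (∑ j, ∫ u in s..t, g (t - u) i j * ∑ k, pastDrift η x s j k u)
        + ∑ k, ∫ a in s..t, kdens η g i k (t - a) * x a k := by
  obtain ⟨c, hc, hgc⟩ := exists_abs_kernel_le_const hdet hη hm hg
  have hgm := measurable_kernel hdet hη hm hg
  have hII : ∀ {f : ℝ → ℝ}, IntegrableOn f (Ioc s t) → IntervalIntegrable f volume s t :=
    fun h => (intervalIntegrable_iff_integrableOn_Ioc_of_le hst).2 h
  set y : Fin n → Fin n → ℝ → ℝ := fun j k u =>
    ∫ v in Iio (u - s), sgn (η j k) v * x (u - v) k ∂(η j k).variation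
  have hyi : ∀ j k, IntegrableOn (y j k) (Ioc s t) := fun j k => by
    refine ((hx.integrableOn_drift j k).sub (hx.integrableOn_pastDrift j k)).congr ?_
    filter_upwards [hx.drift_eq j k] with u hu
    simp only [Pi.sub_apply, hu, y]
    ring
  have h1 : ∀ j, ∫ u in s..t, g (t - u) i j * ∑ k, drift η x j k u
      = (∫ u in s..t, g (t - u) i j * ∑ k, pastDrift η x s j k u)
        + ∑ k, ∫ u in s..t, g (t - u) i j * y j k u := fun j => by
    rw [← intervalIntegral.integral_finsetSum fun k _ =>
      hII (integrableOn_kernel_mul hdet hη hm hg (hyi j k) i j t), ← intervalIntegral.integral_add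
        (hII (integrableOn_kernel_mul hdet hη hm hg (integrable_finsetSum _ fun k _ =>
          hx.integrableOn_pastDrift j k) i j t))
        (hII (integrable_finsetSum _ fun k _ =>
          integrableOn_kernel_mul hdet hη hm hg (hyi j k) i j t))]
    refine intervalIntegral.integral_congr_ae ?_
    rw [uIoc_of_le hst, ← ae_restrict_iff' measurableSet_Ioc]
    filter_upwards [ae_all_iff.2 fun k => hx.drift_eq j k] with u hu
    rw [Finset.sum_congr rfl fun k _ => hu k, Finset.sum_add_distrib, mul_add, Finset.mul_sum,
      Finset.mul_sum]
  have h2 : ∀ j k, ∫ u in s..t, g (t - u) i j * y j k u = ∫ a in s..t,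
      (∫ v, sgn (η j k) v * g (t - a - v) i j ∂(η j k).variation) * x a k := fun j k =>
    integral_mul_conv_eq (hη j k) (measurable_sgn _) (fun v => (abs_sgn _ v).le)
      (w := fun b => g b i j) (hgm i j) (hgc i j)
      (fun b hb => kernel_eq_zero hdet hη hm hg i j hb) (hx.measurable k) (hx.integrableOn k) hst
  simp only [h1, h2]
  rw [Finset.sum_add_distrib, Finset.sum_comm]
  congr 1
  refine Finset.sum_congr rfl fun k _ => ?_
  rw [← intervalIntegral.integral_finsetSum fun j _ => hII ?_]
  · simp only [kdens, Finset.sum_mul]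
  · refine (hx.integrableOn k).bdd_mul (c := c * (η j k).variation.real univ) ?_
      (Eventually.of_forall fun a => norm_integral_le_of_norm_le_const
        (Eventually.of_forall fun v => ?_))
    · refine (StronglyMeasurable.integral_prod_right (f := fun a v =>
        sgn (η j k) v * g (t - a - v) i j) ?_).aestronglyMeasurable
      have := hgm i j
      have := measurable_sgn (η j k)
      exact (by fun_prop : Measurable _).stronglyMeasurable
    · rw [norm_mul, Real.norm_eq_abs, abs_sgn, one_mul]
      exact hgc i j _

/-- The variation of constants formula for the equation with noise `ζ` on `(s, t]`. -/
theorem variation_of_constants {x ζ : ℝ → Fin n → ℝ} (hx : DelayIntegrable η x s t)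
    (hζ : ∀ k, IntegrableOn (fun u => ζ u k) (Ioc s t)) (hst : s ≤ t)
    (h : ∀ᵐ u ∂volume.restrict (Ioc s t), ∀ j,
      x u j = x s j + (∫ r in s..u, ∑ k, drift η x j k r) + ζ u j)
    (ht : ∀ j, x t j = x s j + (∫ r in s..t, ∑ k, drift η x j k r) + ζ t j) (i : Fin n) :
    x t i = ∑ k, g (t - s) i k * x s k
      + (∑ j, ∫ u in s..t, g (t - u) i j * ∑ k, pastDrift η x s j k u)
      + (ζ t i + ∑ k, ∫ u in s..t, kdens η g i k (t - u) * ζ u k) := by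
  have hII : ∀ {f : ℝ → ℝ}, IntegrableOn f (Ioc s t) → IntervalIntegrable f volume s t :=
    fun h => (intervalIntegrable_iff_integrableOn_Ioc_of_le hst).2 h
  have hdi : ∀ j, IntegrableOn (fun u => ∑ k, drift η x j k u) (Ioc s t) := fun j =>
    integrable_finsetSum _ fun k _ => hx.integrableOn_drift j k
  have hκ : ∀ {f : ℝ → ℝ}, IntegrableOn f (Ioc s t) → ∀ k,
      IntervalIntegrable (fun u => kdens η g i k (t - u) * f u) volume s t := fun hf k =>
    hII (integrableOn_kdens_mul hdet hη hm hg hf i k t)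
  -- The drift integrated against g is computed twice: here by splitting off the past, and in `h2`
  -- by parts, with g a primitive of g ∗ η and the integrated drift replaced through the equation.
  -- The integrals of `kdens` against x cancel.
  have h1 := sum_integral_kernel_mul_drift hdet hη hm hg hx hst i
  have h2 : ∀ j, ∫ u in s..t, g (t - u) i j * ∑ k, drift η x j k u
      = (1 : Matrix (Fin n) (Fin n) ℝ) i j * (x t j - x s j - ζ t j)
        + ((∫ w in s..t, kdens η g i j (t - w) * x w j)
          - (g (t - s) i j - (1 : Matrix (Fin n) (Fin n) ℝ) i j) * x s j
          - ∫ w in s..t, kdens η g i j (t - w) * ζ w j) := fun j => by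
    rw [integral_mul_eq_of_primitive (integrable_kdens hdet hη hm hg i j)
      (fun T hT => kernel_eq_integral hdet hη hm hg i j hT) (hdi j) hst]
    congr 1
    · rw [ht j]; ring
    · have h3 : g (t - s) i j - (1 : Matrix (Fin n) (Fin n) ℝ) i j
          = ∫ w in s..t, kdens η g i j (t - w) := by
        rw [kernel_eq_integral hdet hη hm hg i j (sub_nonneg.2 hst),
          intervalIntegral.integral_comp_sub_left, sub_self]
        ring
      rw [h3, ← intervalIntegral.integral_mul_const, ← intervalIntegral.integral_sub
        (hκ (hx.integrableOn j) j) (hκ (integrable_const _) j), ← intervalIntegral.integral_sub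
        ((hκ (hx.integrableOn j) j).sub (hκ (integrable_const _) j)) (hκ (hζ j) j)]
      refine intervalIntegral.integral_congr_ae ?_
      rw [uIoc_of_le hst, ← ae_restrict_iff' measurableSet_Ioc]
      filter_upwards [h] with u hu
      rw [hu j]
      ring
  simp only [h2, Finset.sum_add_distrib, Finset.sum_sub_distrib, sub_mul, Matrix.one_apply,
    ite_mul, one_mul, zero_mul, Finset.sum_ite_eq, Finset.mem_univ, if_true] at h1
  linarith

end VariationOfConstants


/-! ### Integrability of stationary solutions. -/

section Stationary

open Filter

variable {n : ℕ} {Ω : Type*} [MeasurableSpace Ω] {μ : Measure Ω}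
  {η : Matrix (Fin n) (Fin n) (SignedMeasure ℝ)} {Z X : ℝ → Ω → Fin n → ℝ}
  (hX : IsStationarySolution μ η Z X)

include hX

theorem IsStationarySolution.measurable_comp {E : Type*} [MeasurableSpace E] {τ : E → ℝ}
    (hτ : Measurable τ) (k : Fin n) : Measurable fun p : E × Ω => X (τ p.1) p.2 k :=
  (measurable_pi_apply k).comp (hX.measurable.comp
    ((hτ.comp measurable_fst).prodMk measurable_snd))

theorem IsStationarySolution.integrable_apply (r : ℝ) (k : Fin n) :
    Integrable (fun ω => X r ω k) μ :=
  (hX.integrable r).eval k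

theorem IsStationarySolution.integral_abs_eq (r : ℝ) (k : Fin n) :
    ∫ ω, |X r ω k| ∂μ = ∫ ω, |X 0 ω k| ∂μ := by
  have h := (hX.stationary r).comp (u := fun f : ℝ → Fin n → ℝ => |f 0 k|) (by fun_prop)
  simpa [Function.comp_def] using h.integral_eq

variable [IsProbabilityMeasure μ] {E : Type*} [MeasurableSpace E] (l : Measure E) [IsFiniteMeasure l] {τ : E → ℝ}
  (hτ : Measurable τ)

include hτ

/-- Values of a stationary process at measurable parameters are jointly integrable. -/
theorem IsStationarySolution.integrable_prod (k : Fin n) :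
    Integrable (fun p : E × Ω => X (τ p.1) p.2 k) (l.prod μ) := by
  rw [integrable_prod_iff (hX.measurable_comp hτ k).aestronglyMeasurable]
  refine ⟨Eventually.of_forall fun e => hX.integrable_apply (τ e) k, ?_⟩
  simp only [Real.norm_eq_abs, hX.integral_abs_eq]
  exact integrable_const _

theorem IsStationarySolution.integrable_prod_mul {w : E → ℝ} (hw : Measurable w) {c : ℝ}
    (hc : ∀ e, |w e| ≤ c) (k : Fin n) :
    Integrable (fun p : E × Ω => w p.1 * X (τ p.1) p.2 k) (l.prod μ) :=
  (hX.integrable_prod l hτ k).bdd_mul (c := c) (hw.comp measurable_fst).aestronglyMeasurable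
    (Eventually.of_forall fun p => hc p.1)

/-- By Fubini and stationarity the bound involves only the mass of the weight, wherever the time
points lie. It controls the contribution of the remote past. -/
theorem IsStationarySolution.integral_abs_integral_le {w : E → ℝ} (hw : Measurable w) {c : ℝ}
    (hc : ∀ e, |w e| ≤ c) (k : Fin n) :
    ∫ ω, |∫ e, w e * X (τ e) ω k ∂l| ∂μ ≤ (∫ e, |w e| ∂l) * ∫ ω, |X 0 ω k| ∂μ := by
  have hi := hX.integrable_prod_mul l hτ hw hc k
  calc ∫ ω, |∫ e, w e * X (τ e) ω k ∂l| ∂μ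
      ≤ ∫ ω, (∫ e, ‖w e * X (τ e) ω k‖ ∂l) ∂μ :=
        integral_mono hi.integral_prod_right.abs hi.norm.integral_prod_right
          fun ω => norm_integral_le_integral_norm (fun e => w e * X (τ e) ω k)
    _ = ∫ e, (∫ ω, ‖w e * X (τ e) ω k‖ ∂μ) ∂l := (integral_integral_swap hi.norm).symm
    _ = _ := by
        simp only [norm_mul, Real.norm_eq_abs, integral_const_mul, hX.integral_abs_eq]
        rw [integral_mul_const]

end Stationary

/-! ### From the equation in ω to an equation along paths. -/

section Solution

open Filter

variable {n : ℕ} {Ω : Type*} [MeasurableSpace Ω] {μ : Measure Ω}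
  {η : Matrix (Fin n) (Fin n) (SignedMeasure ℝ)} {Z X : ℝ → Ω → Fin n → ℝ}
  (hX : IsStationarySolution μ η Z X) (s t : ℝ)

include hX

theorem IsStationarySolution.measurable_drift (j k : Fin n) :
    Measurable fun p : ℝ × Ω => drift η (fun r => X r p.2) j k p.1 := by
  refine (StronglyMeasurable.integral_prod_right (f := fun (p : ℝ × Ω) v =>
    sgn (η j k) v * X (p.1 - v) p.2 k) ?_).measurable
  have h1 : Measurable fun q : (ℝ × Ω) × ℝ => X (q.1.1 - q.2) q.1.2 k :=
    (measurable_pi_apply k).comp (hX.measurable.comp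
      ((measurable_fst.fst.sub measurable_snd).prodMk measurable_fst.snd))
  exact (((measurable_sgn _).comp measurable_snd).mul h1).stronglyMeasurable

/-- The moving upper limit is absorbed in an indicator, so that the measurability of parameter
integrals applies. -/
theorem IsStationarySolution.measurable_integral_drift (j k : Fin n) :
    Measurable fun p : ℝ × Ω => ∫ r in Ioc s p.1, drift η (fun r => X r p.2) j k r := by
  have h0 : (fun p : ℝ × Ω => ∫ r in Ioc s p.1, drift η (fun r => X r p.2) j k r)
      = fun p => ∫ r, {q : (ℝ × Ω) × ℝ | s < q.2 ∧ q.2 ≤ q.1.1}.indicator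
        (fun q => drift η (fun r => X r q.1.2) j k q.2) (p, r) := by
    ext p
    rw [← integral_indicator measurableSet_Ioc]
    rfl
  rw [h0]
  refine (StronglyMeasurable.integral_prod_right (f := fun (p : ℝ × Ω) r =>
    {q : (ℝ × Ω) × ℝ | s < q.2 ∧ q.2 ≤ q.1.1}.indicator
        (fun q => drift η (fun r => X r q.1.2) j k q.2) (p, r)) ?_).measurable
  have h1 : Measurable fun q : (ℝ × Ω) × ℝ => drift η (fun r => X r q.1.2) j k q.2 :=
    (hX.measurable_drift j k).comp (measurable_snd.prodMk measurable_fst.snd)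
  refine (h1.indicator ?_).stronglyMeasurable
  exact (measurableSet_lt measurable_const measurable_snd).inter
    (measurableSet_le measurable_snd measurable_fst.fst)

theorem IsStationarySolution.equation_drift (hη : ConcentratedOnNonneg η) {s t : ℝ} (hst : s ≤ t) :
    ∀ᵐ ω ∂μ, ∀ j, X t ω j = X s ω j
      + (∑ k, ∫ r in Ioc s t, drift η (fun r => X r ω) j k r) + (Z t ω j - Z s ω j) := by
  rcases hst.eq_or_lt with rfl | hst'
  · simp
  filter_upwards [hX.equation s t hst'] with ω hω j
  have := hω j
  simp only [fun k u => setIntegral_Ici_eq_drift hη (fun r => X r ω) j k u,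
    intervalIntegral.integral_of_le hst] at this
  linarith

variable [IsProbabilityMeasure μ]

theorem IsStationarySolution.delayIntegrable :
    ∀ᵐ ω ∂μ, DelayIntegrable η (fun r => X r ω) s t := by
  have h1 := ae_all_iff.2 fun k =>
    (hX.integrable_prod (volume.restrict (Ioc s t)) measurable_id k).prod_left_ae
  have h2 := ae_all_iff.2 fun j => ae_all_iff.2 fun k =>
    (hX.integrable_prod ((volume.restrict (Ioc s t)).prod (η j k).variation)
      (measurable_fst.sub measurable_snd) k).prod_left_ae
  filter_upwards [h1, h2] with ω h1 h2
  exact ⟨fun k => (hX.measurable_comp measurable_id k).comp measurable_prodMk_right, h1, h2⟩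

/-- The integrated drift as an integral over a product space. -/
theorem IsStationarySolution.integral_drift_eq (j k : Fin n) :
    ∀ᵐ ω ∂μ, ∫ r in Ioc s t, drift η (fun r => X r ω) j k r
      = ∫ e, sgn (η j k) e.2 * X (e.1 - e.2) ω k
        ∂((volume.restrict (Ioc s t)).prod (η j k).variation) := by
  filter_upwards [hX.delayIntegrable s t] with ω hω
  rw [integral_prod _ (hω.integrable_sgn_mul j k)]
  rfl

variable (hη : ConcentratedOnNonneg η)

include hη

/-- The equation holds off a null set that depends on u. Joint measurability of both sides allows
the quantifiers over u and ω to be exchanged. -/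
theorem IsStationarySolution.ae_equation_drift (hZ : Measurable fun p : ℝ × Ω => Z p.1 p.2) :
    ∀ᵐ ω ∂μ, ∀ᵐ u ∂volume.restrict (Ioc s t), ∀ j, X u ω j = X s ω j
      + (∑ k, ∫ r in Ioc s u, drift η (fun r => X r ω) j k r) + (Z u ω j - Z s ω j) := by
  refine (Measure.ae_ae_comm (p := fun u ω => ∀ j, X u ω j = X s ω j
    + (∑ k, ∫ r in Ioc s u, drift η (fun r => X r ω) j k r) + (Z u ω j - Z s ω j)) ?_).1 ?_
  · simp only [ofPred_forall]
    refine MeasurableSet.iInter fun j => measurableSet_eq_fun (hX.measurable_comp measurable_id j) ?_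
    have h1 : Measurable fun p : ℝ × Ω => X s p.2 j := hX.measurable_comp measurable_const j
    have h2 : Measurable fun p : ℝ × Ω =>
        ∑ k, ∫ r in Ioc s p.1, drift η (fun r => X r p.2) j k r :=
      Finset.measurable_fun_sum _ fun k _ => hX.measurable_integral_drift s j k
    have h3 : Measurable fun p : ℝ × Ω => Z p.1 p.2 j := (measurable_pi_apply j).comp hZ
    have h4 : Measurable fun p : ℝ × Ω => Z s p.2 j :=
      (measurable_pi_apply j).comp (hZ.comp (measurable_const.prodMk measurable_snd))
    exact (h1.add h2).add (h3.sub h4)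
  · filter_upwards [ae_restrict_mem measurableSet_Ioc] with u hu
    exact hX.equation_drift hη hu.1.le

/-- Solving the equation for Z_u − Z_s bounds it by |X_u| + |X_s| plus the integral of |X| along all
delays over the whole of (s, t]. By stationarity the expectation of this bound does not depend on u.
-/
theorem IsStationarySolution.integrable_noise (hZ : Measurable fun p : ℝ × Ω => Z p.1 p.2)
    (hZi : ∀ r, Integrable (Z r) μ) (j : Fin n) :
    Integrable (fun p : ℝ × Ω => Z p.1 p.2 j - Z s p.2 j)
      ((volume.restrict (Ioc s t)).prod μ) := by
  have h3 : Measurable fun p : ℝ × Ω => Z p.1 p.2 j := (measurable_pi_apply j).comp hZ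
  have h4 : Measurable fun p : ℝ × Ω => Z s p.2 j :=
    (measurable_pi_apply j).comp (hZ.comp (measurable_const.prodMk measurable_snd))
  have hm : Measurable fun p : ℝ × Ω => Z p.1 p.2 j - Z s p.2 j := h3.sub h4
  rw [integrable_prod_iff hm.aestronglyMeasurable]
  refine ⟨Eventually.of_forall fun u => ((hZi u).eval j).sub ((hZi s).eval j), ?_⟩
  have hHi : ∀ k, Integrable (fun ω => ∫ e, ‖(fun e : ℝ × ℝ => X (e.1 - e.2) ω k) e‖
      ∂((volume.restrict (Ioc s t)).prod (η j k).variation)) μ := fun k =>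
    (hX.integrable_prod ((volume.restrict (Ioc s t)).prod (η j k).variation)
      (measurable_fst.sub measurable_snd) k).norm.integral_prod_right
  set H : Fin n → Ω → ℝ := fun k ω => ∫ e, ‖(fun e : ℝ × ℝ => X (e.1 - e.2) ω k) e‖
      ∂((volume.restrict (Ioc s t)).prod (η j k).variation) with hH
  refine Integrable.of_bound (C := 2 * (∫ ω, |X 0 ω j| ∂μ) + ∫ ω, ∑ k, H k ω ∂μ)
    hm.norm.stronglyMeasurable.integral_prod_right.aestronglyMeasurable ?_
  filter_upwards [ae_restrict_mem measurableSet_Ioc] with u hu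
  rw [Real.norm_of_nonneg (integral_nonneg fun _ => norm_nonneg _)]
  have hb : ∀ᵐ ω ∂μ, ‖Z u ω j - Z s ω j‖ ≤ |X u ω j| + |X s ω j| + ∑ k, H k ω := by
    filter_upwards [hX.equation_drift hη hu.1.le, hX.delayIntegrable s t] with ω hω hd
    have h5 : |∑ k, ∫ r in Ioc s u, drift η (fun r => X r ω) j k r| ≤ ∑ k, H k ω := by
      refine (Finset.abs_sum_le_sum_abs _ _).trans (Finset.sum_le_sum fun k _ => ?_)
      calc |∫ r in Ioc s u, drift η (fun r => X r ω) j k r|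
          ≤ ∫ r in Ioc s u, ‖drift η (fun r => X r ω) j k r‖ :=
            norm_integral_le_integral_norm (fun r => drift η (fun r => X r ω) j k r)
        _ ≤ ∫ r in Ioc s t, ‖drift η (fun r => X r ω) j k r‖ :=
            setIntegral_mono_set (hd.integrableOn_drift j k).norm
              (Eventually.of_forall fun _ => norm_nonneg _)
              (Ioc_subset_Ioc_right hu.2).eventuallyLE
        _ ≤ ∫ r in Ioc s t, ∫ v, ‖X (r - v) ω k‖ ∂(η j k).variation := by
            refine integral_mono (hd.integrableOn_drift j k).norm
              (hd.integrable_prod j k).norm.integral_prod_left fun r => ?_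
            refine (norm_integral_le_integral_norm _).trans (le_of_eq ?_)
            simp only [norm_mul, Real.norm_eq_abs, abs_sgn, one_mul]
        _ = H k ω := (integral_prod _ (hd.integrable_prod j k).norm).symm
    have h6 : Z u ω j - Z s ω j = X u ω j - X s ω j
        - ∑ k, ∫ r in Ioc s u, drift η (fun r => X r ω) j k r := by linarith [hω j]
    rw [h6, Real.norm_eq_abs]
    exact ((abs_sub _ _).trans (add_le_add (abs_sub _ _) h5))
  have hsum : Integrable (fun ω => ∑ k, H k ω) μ := integrable_finsetSum _ fun k _ => hHi k
  have hu' := (hX.integrable_apply u j).abs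
  have hs' := (hX.integrable_apply s j).abs
  calc ∫ ω, ‖Z u ω j - Z s ω j‖ ∂μ
      ≤ ∫ ω, (|X u ω j| + |X s ω j| + ∑ k, H k ω) ∂μ :=
        integral_mono_ae (((hZi u).eval j).sub ((hZi s).eval j)).norm ((hu'.add hs').add hsum) hb
    _ = _ := by
        rw [integral_add (f := fun ω => |X u ω j| + |X s ω j|) (hu'.add hs') hsum, integral_add hu' hs', hX.integral_abs_eq,
          hX.integral_abs_eq s]
        ring

variable {g : ℝ → Matrix (Fin n) (Fin n) ℝ}
  (hdet : ∀ z : ℂ, z.re ≤ 0 → (hFun η z).det ≠ 0)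
  (hm : HasMoment η 2) (hg : IsKernel η g) (hZ : Measurable fun p : ℝ × Ω => Z p.1 p.2)
  (hZi : ∀ r, Integrable (Z r) μ)

include hdet hm hg hZ hZi

theorem IsStationarySolution.variation_of_constants {s t : ℝ} (hst : s ≤ t) :
    ∀ᵐ ω ∂μ, ∀ i, X t ω i = ∑ k, g (t - s) i k * X s ω k
      + (∑ j, ∫ u in s..t, g (t - u) i j * ∑ k, pastDrift η (fun r => X r ω) s j k u)
      + ((Z t ω i - Z s ω i)
        + ∑ k, ∫ u in s..t, kdens η g i k (t - u) * (Z u ω k - Z s ω k)) := by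
  have hζ := ae_all_iff.2 fun k => (hX.integrable_noise s t hη hZ hZi k).prod_left_ae
  filter_upwards [hX.delayIntegrable s t, hX.equation_drift hη hst,
    hX.ae_equation_drift s t hη hZ, hζ] with ω hd h1 h2 hζ i
  have hsum : ∀ u, s ≤ u → u ≤ t → ∀ j, ∑ k, ∫ r in Ioc s u, drift η (fun r => X r ω) j k r
      = ∫ r in s..u, ∑ k, drift η (fun r => X r ω) j k r := fun u hsu hut j => by
    rw [intervalIntegral.integral_of_le hsu, integral_finsetSum _ fun k _ =>
      ((hd.integrableOn_drift j k).mono_set (Ioc_subset_Ioc_right hut))]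
  refine MSDDE.variation_of_constants hdet hη hm hg (x := fun r => X r ω)
    (ζ := fun u k => Z u ω k - Z s ω k) hd hζ hst ?_ (fun j => ?_) i
  · filter_upwards [h2, ae_restrict_mem measurableSet_Ioc] with u hu hu' j
    rw [hu j, hsum u hu'.1.le hu'.2]
  · rw [h1 j, hsum t hst le_rfl]

end Solution


/-! ### Measurability of L¹ limits, and vanishing tails. -/

section Approximation

open Filter

variable {Ω : Type*} {m m₀ : MeasurableSpace Ω} {μ : Measure Ω}

/-- Conditioning fixes B and contracts L¹, so the L¹ distance from f to its conditional expectation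
is at most twice that from f to B. -/
theorem aestronglyMeasurable_of_approx [IsFiniteMeasure μ] (hm : m ≤ m₀) {f : Ω → ℝ}
    (hf : Integrable f μ)
    (h : ∀ ε > 0, ∃ B : Ω → ℝ, Integrable B μ ∧ AEStronglyMeasurable[m] B μ ∧
      ∫ ω, |f ω - B ω| ∂μ ≤ ε) : AEStronglyMeasurable[m] f μ := by
  suffices hae : f =ᵐ[μ] μ[f | m] from ⟨_, stronglyMeasurable_condExp, hae⟩
  have hi : Integrable (fun ω => |f ω - (μ[f | m]) ω|) μ := (hf.sub integrable_condExp).abs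
  have h0 : ∫ ω, |f ω - (μ[f | m]) ω| ∂μ ≤ 0 := by
    refine le_of_forall_pos_le_add fun ε hε => ?_
    obtain ⟨B, hB, hBm, hBε⟩ := h (ε / 2) (by positivity)
    have hfB : Integrable (f - B) μ := hf.sub hB
    have h1 : μ[f - B | m] =ᵐ[μ] μ[f | m] - B :=
      (condExp_sub hf hB m).trans
        (EventuallyEq.rfl.sub (condExp_of_aestronglyMeasurable' hm hBm hB))
    calc ∫ ω, |f ω - (μ[f | m]) ω| ∂μ
        ≤ ∫ ω, (|(f - B) ω| + |(μ[f - B | m]) ω|) ∂μ := by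
          refine integral_mono_ae hi (hfB.abs.add integrable_condExp.abs) ?_
          filter_upwards [h1] with ω h1
          rw [h1]
          simp only [Pi.sub_apply]
          calc |f ω - (μ[f | m]) ω| = |(f ω - B ω) - ((μ[f | m]) ω - B ω)| := by ring_nf
            _ ≤ _ := abs_sub _ _
      _ = ∫ ω, |(f - B) ω| ∂μ + ∫ ω, |(μ[f - B | m]) ω| ∂μ :=
          integral_add hfB.abs integrable_condExp.abs
      _ ≤ ∫ ω, |(f - B) ω| ∂μ + ∫ ω, |(f - B) ω| ∂μ := by
          exact add_le_add le_rfl (integral_abs_condExp_le (m := m) (μ := μ) (f - B))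
      _ ≤ 0 + ε := by simp only [Pi.sub_apply]; linarith
  have h2 := (integral_eq_zero_iff_of_nonneg (fun ω => abs_nonneg _) hi).1
    (le_antisymm h0 (integral_nonneg fun ω => abs_nonneg _))
  filter_upwards [h2] with ω hω
  exact sub_eq_zero.1 (abs_eq_zero.1 hω)

theorem aestronglyMeasurable_pi {n : ℕ} {f : Ω → Fin n → ℝ}
    (h : ∀ k, AEStronglyMeasurable[m] (fun ω => f ω k) μ) : AEStronglyMeasurable[m] f μ := by
  refine ⟨fun ω k => (h k).mk _ ω, ?_, ?_⟩
  · have : Measurable[m] fun ω k => (h k).mk _ ω :=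
      (@measurable_pi_iff Ω (Fin n) (fun _ => ℝ) m _ _).2 fun k => (h k).stronglyMeasurable_mk.measurable
    exact this.stronglyMeasurable
  · filter_upwards [ae_all_iff.2 fun k => (h k).ae_eq_mk] with ω hω
    ext k
    exact hω k

theorem aestronglyMeasurable_sum {ι : Type*} {S : Finset ι} {f : ι → Ω → ℝ}
    (h : ∀ k, AEStronglyMeasurable[m] (f k) μ) :
    AEStronglyMeasurable[m] (fun ω => ∑ k ∈ S, f k ω) μ := by
  classical
  induction S using Finset.induction_on with
  | empty => simpa using aestronglyMeasurable_const
  | insert a S ha ih =>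
    simp only [Finset.sum_insert ha]
    exact (h a).add ih

/-- Dominated convergence twice: for the tail of ν at each fixed b, then in b with majorant |f|
ν(ℝ). -/
theorem tendsto_integral_mul_tail {ν : Measure ℝ} [IsFiniteMeasure ν] {f : ℝ → ℝ}
    (hf : Integrable f) :
    Tendsto (fun N : ℕ => ∫ b, f b * ν.real (Ici (N - b))) atTop (nhds 0) := by
  have htail : ∀ b : ℝ, Tendsto (fun N : ℕ => ν.real (Ici (N - b))) atTop (nhds 0) := fun b => by
    have h := tendsto_integral_of_dominated_convergence (μ := ν)
      (F := fun (N : ℕ) v => (Ici (N - b)).indicator (fun _ => (1 : ℝ)) v) (f := fun _ => 0)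
      (fun _ => 1) (fun N => (measurable_const.indicator measurableSet_Ici).aestronglyMeasurable)
      (integrable_const _) (fun N => Eventually.of_forall fun v => by
        by_cases hv : v ∈ Ici (N - b) <;> simp [hv]) (Eventually.of_forall fun v => by
        obtain ⟨M, hM⟩ := exists_nat_gt (v + b)
        refine tendsto_const_nhds.congr' ?_
        filter_upwards [eventually_ge_atTop M] with N hN
        have hN' : (M : ℝ) ≤ N := by exact_mod_cast hN
        rw [indicator_of_notMem]
        rw [mem_Ici, not_le]
        linarith)
    simpa [integral_indicator measurableSet_Ici] using h
  have hmeas : ∀ N : ℕ, Measurable fun b : ℝ => ν.real (Ici (N - b)) := fun N =>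
    (Monotone.measurable fun a b hab => by
      refine measureReal_mono (Ici_subset_Ici.2 ?_)
      linarith)
  have h := tendsto_integral_of_dominated_convergence
    (F := fun (N : ℕ) b => f b * ν.real (Ici (N - b))) (f := fun _ => 0)
    (fun b => |f b| * ν.real univ) (fun N => hf.1.mul (hmeas N).aestronglyMeasurable)
    (hf.abs.mul_const _) (fun N => Eventually.of_forall fun b => by
      rw [norm_mul, Real.norm_eq_abs, Real.norm_of_nonneg measureReal_nonneg]
      exact mul_le_mul_of_nonneg_left (measureReal_mono (subset_univ _)) (abs_nonneg _)) (Eventually.of_forall fun b => by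
      simpa using (htail b).const_mul (f b))
  simpa using h

end Approximation

/-! ### The past of X and the past increments of Z carry the same information. -/

section Past

open Filter

variable {n : ℕ} {Ω : Type*} {m : MeasurableSpace Ω} [m₀ : MeasurableSpace Ω] {μ : Measure Ω}
  {η : Matrix (Fin n) (Fin n) (SignedMeasure ℝ)} {Z X : ℝ → Ω → Fin n → ℝ}

theorem pastSigma_le (hX : Measurable fun p : ℝ × Ω => X p.1 p.2) (s : ℝ) :
    pastSigma X s ≤ m₀ :=
  iSup₂_le fun _ _ => (hX.comp (measurable_const.prodMk measurable_id)).comap_le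

theorem pastIncrements_le (hZ : Measurable fun p : ℝ × Ω => Z p.1 p.2) (s : ℝ) :
    pastIncrements Z s ≤ m₀ := by
  have h : ∀ r, Measurable (Z r) := fun r => hZ.comp (measurable_const.prodMk measurable_id)
  exact iSup₂_le fun r _ => ((h s).sub (h r)).comap_le

theorem aestronglyMeasurable_pastSigma {s r : ℝ} (hr : r ≤ s) (k : Fin n) :
    AEStronglyMeasurable[pastSigma X s] (fun ω => X r ω k) μ := by
  have h : Measurable[pastSigma X s] (X r) :=
    Measurable.of_comap_le (le_iSup₂_of_le r hr le_rfl)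
  exact ((measurable_pi_apply k).comp h).stronglyMeasurable.aestronglyMeasurable

theorem aestronglyMeasurable_pastIncrements {s a r : ℝ} (ha : a ≤ s) (hr : r ≤ s) (k : Fin n) :
    AEStronglyMeasurable[pastIncrements Z s] (fun ω => Z r ω k - Z a ω k) μ := by
  have h : ∀ r ≤ s, StronglyMeasurable[pastIncrements Z s] fun ω => Z s ω k - Z r ω k := by
    intro r hr
    rcases hr.eq_or_lt with rfl | hr'
    · simp only [sub_self]
      exact stronglyMeasurable_const
    · have h : Measurable[pastIncrements Z s] (fun ω => Z s ω - Z r ω) :=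
        Measurable.of_comap_le (le_iSup₂_of_le r hr' le_rfl)
      exact ((measurable_pi_apply k).comp h).stronglyMeasurable
  refine ((h a ha).sub (h r hr)).aestronglyMeasurable.congr (Eventually.of_forall fun ω => ?_)
  simp only [Pi.sub_apply]
  ring

variable [IsProbabilityMeasure μ]

theorem IsStationarySolution.aestronglyMeasurable_integral (hX : IsStationarySolution μ η Z X)
    (hm : m ≤ m₀) {E : Type*} [MeasurableSpace E] (l : Measure E)
    [IsFiniteMeasure l] {τ : E → ℝ} (hτ : Measurable τ) {w : E → ℝ} (hw : Measurable w) {c : ℝ}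
    (hc : ∀ e, |w e| ≤ c) (k : Fin n)
    (h : ∀ᵐ e ∂l, w e = 0 ∨ AEStronglyMeasurable[m] (fun ω => X (τ e) ω k) μ) :
    AEStronglyMeasurable[m] (fun ω => ∫ e, w e * X (τ e) ω k ∂l) μ := by
  refine MSDDE.aestronglyMeasurable_integral hm (hX.integrable_prod_mul l hτ hw hc k) ?_
  filter_upwards [h] with e he
  rcases he with he | he
  · simp only [he, zero_mul]
    exact aestronglyMeasurable_const
  · exact he.const_mul _

/-- Solving the equation for the increment leaves, besides X_s and X_r, only values X_{u−v} with u ≤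
s and v ≥ 0. -/
theorem IsStationarySolution.aestronglyMeasurable_noise (hX : IsStationarySolution μ η Z X)
    (hη : ConcentratedOnNonneg η) {s r : ℝ} (hr : r ≤ s) (j : Fin n) :
    AEStronglyMeasurable[pastSigma X s] (fun ω => Z s ω j - Z r ω j) μ := by
  have h1 : ∀ k, AEStronglyMeasurable[pastSigma X s]
      (fun ω => ∫ e, sgn (η j k) e.2 * X (e.1 - e.2) ω k
        ∂((volume.restrict (Ioc r s)).prod (η j k).variation)) μ := fun k => by
    refine hX.aestronglyMeasurable_integral (pastSigma_le hX.measurable s) _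
      (measurable_fst.sub measurable_snd) (w := fun e => sgn (η j k) e.2)
      ((measurable_sgn _).comp measurable_snd) (c := 1) (fun e => (abs_sgn _ _).le) k ?_
    have e1 : ∀ᵐ e ∂((volume.restrict (Ioc r s)).prod (η j k).variation), e.1 ∈ Ioc r s :=
      Measure.quasiMeasurePreserving_fst.ae (ae_restrict_mem measurableSet_Ioc)
    have e2 : ∀ᵐ e ∂((volume.restrict (Ioc r s)).prod (η j k).variation), 0 ≤ e.2 :=
      Measure.quasiMeasurePreserving_snd.ae (ae_nonneg (hη j k))
    filter_upwards [e1, e2] with e h1 h2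
    exact Or.inr (aestronglyMeasurable_pastSigma (show e.1 - e.2 ≤ s by linarith [h1.2]) k)
  have h2 : AEStronglyMeasurable[pastSigma X s] (fun ω => X s ω j - X r ω j - ∑ k,
      ∫ e, sgn (η j k) e.2 * X (e.1 - e.2) ω k
        ∂((volume.restrict (Ioc r s)).prod (η j k).variation)) μ :=
    ((aestronglyMeasurable_pastSigma le_rfl j).sub (aestronglyMeasurable_pastSigma hr j)).sub
      (aestronglyMeasurable_sum h1)
  refine h2.congr ?_
  filter_upwards [hX.equation_drift hη hr, ae_all_iff.2 fun k => hX.integral_drift_eq r s j k]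
    with ω h3 h4
  rw [← Finset.sum_congr rfl fun k _ => h4 k]
  linarith [h3 j]

/-- The weight of `X^k_{u-v}` in the contribution of the path up to time `s` at time `t`. -/
noncomputable def pastWeight (η : Matrix (Fin n) (Fin n) (SignedMeasure ℝ))
    (g : ℝ → Matrix (Fin n) (Fin n) ℝ) (s t : ℝ) (i j k : Fin n) (e : ℝ × ℝ) : ℝ :=
  if e.1 - s ≤ e.2 then g (t - e.1) i j * sgn (η j k) e.2 else 0

variable {g : ℝ → Matrix (Fin n) (Fin n) ℝ} (hX : IsStationarySolution μ η Z X)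
  (hη : ConcentratedOnNonneg η)
  (hdet : ∀ z : ℂ, z.re ≤ 0 → (hFun η z).det ≠ 0)
  (hm : HasMoment η 2) (hg : IsKernel η g) (hZ : Measurable fun p : ℝ × Ω => Z p.1 p.2)
  (hZi : ∀ r, Integrable (Z r) μ)

theorem abs_pastWeight (s t : ℝ) (i j k : Fin n) (e : ℝ × ℝ) :
    |pastWeight η g s t i j k e|
      = |g (t - e.1) i j| * (Ici (e.1 - s)).indicator (fun _ => 1) e.2 := by
  rw [pastWeight]
  by_cases h : e.1 - s ≤ e.2
  · rw [if_pos h, indicator_of_mem (mem_Ici.2 h), abs_mul, abs_sgn]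
  · rw [if_neg h, indicator_of_notMem (by simpa using h), abs_zero, mul_zero]

include hη hdet hm hg

theorem measurable_pastWeight (s t : ℝ) (i j k : Fin n) :
    Measurable (pastWeight η g s t i j k) :=
  Measurable.ite (measurableSet_le (measurable_fst.sub_const s) measurable_snd)
    (((measurable_kernel hdet hη hm hg i j).comp (measurable_const.sub measurable_fst)).mul
      ((measurable_sgn _).comp measurable_snd)) measurable_const

theorem exists_abs_pastWeight_le :
    ∃ c, ∀ s t i j k e, |pastWeight η g s t i j k e| ≤ c := by
  obtain ⟨c, hc, h⟩ := exists_abs_kernel_le_const hdet hη hm hg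
  refine ⟨c, fun s t i j k e => ?_⟩
  rw [abs_pastWeight]
  refine (mul_le_of_le_one_right (abs_nonneg _) ?_).trans (h i j (t - e.1))
  exact indicator_le_self' (fun _ _ => zero_le_one) _

/-- After the substitution b = t − u the integral is extended to the whole line. The bound depends
on s and t only through t − s, and `tendsto_integral_mul_tail` applies to it. -/
theorem integral_abs_pastWeight_le (s t : ℝ) (i j k : Fin n) :
    ∫ e, |pastWeight η g s t i j k e| ∂((volume.restrict (Ioc s t)).prod (η j k).variation)
      ≤ ∫ b, |g b i j| * (η j k).variation.real (Ici (t - s - b)) := by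
  obtain ⟨c, hc⟩ := exists_abs_pastWeight_le hη hdet hm hg
  have hi : Integrable (fun e => |pastWeight η g s t i j k e|)
      ((volume.restrict (Ioc s t)).prod (η j k).variation) :=
    Integrable.of_bound (measurable_pastWeight hη hdet hm hg s t i j k).abs.aestronglyMeasurable c
      (Eventually.of_forall fun e => by
        rw [Real.norm_eq_abs, abs_abs]; exact hc s t i j k e)
  have hmeas : Measurable fun b : ℝ => (η j k).variation.real (Ici (t - s - b)) :=
    Monotone.measurable fun a b hab => measureReal_mono (Ici_subset_Ici.2 (by linarith))
  have hφ : Integrable fun b => |g b i j| * (η j k).variation.real (Ici (t - s - b)) :=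
    (integrable_kernel hdet hη hm hg i j).abs.mul_bdd (c := (η j k).variation.real univ)
      hmeas.aestronglyMeasurable (Eventually.of_forall fun b => by
        rw [Real.norm_of_nonneg measureReal_nonneg]; exact measureReal_mono (subset_univ _))
  rw [integral_prod _ hi, ← integral_sub_left_eq_self
    (fun b => |g b i j| * (η j k).variation.real (Ici (t - s - b))) volume t]
  refine (integral_congr_ae (Eventually.of_forall fun u => ?_)).trans_le
    (setIntegral_le_integral (hφ.comp_sub_left t) (Eventually.of_forall fun u =>
      mul_nonneg (abs_nonneg _) measureReal_nonneg))
  simp only [abs_pastWeight, integral_const_mul]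
  rw [integral_indicator measurableSet_Ici, setIntegral_const, smul_eq_mul, mul_one,
    show t - s - (t - u) = u - s by ring]

include hX

theorem IsStationarySolution.integrable_past (s t : ℝ) (i j k : Fin n) :
    Integrable (fun ω => ∫ e, pastWeight η g s t i j k e * X (e.1 - e.2) ω k
      ∂((volume.restrict (Ioc s t)).prod (η j k).variation)) μ := by
  obtain ⟨c, hc⟩ := exists_abs_pastWeight_le hη hdet hm hg
  exact (hX.integrable_prod_mul _ (measurable_fst.sub measurable_snd)
    (measurable_pastWeight hη hdet hm hg s t i j k) (hc s t i j k) k).integral_prod_right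

theorem IsStationarySolution.aestronglyMeasurable_past (s t : ℝ) (i j k : Fin n) :
    AEStronglyMeasurable[pastSigma X s] (fun ω => ∫ e, pastWeight η g s t i j k e
      * X (e.1 - e.2) ω k ∂((volume.restrict (Ioc s t)).prod (η j k).variation)) μ := by
  obtain ⟨c, hc⟩ := exists_abs_pastWeight_le hη hdet hm hg
  refine hX.aestronglyMeasurable_integral (pastSigma_le hX.measurable s) _
    (measurable_fst.sub measurable_snd) (measurable_pastWeight hη hdet hm hg s t i j k)
    (hc s t i j k) k (Eventually.of_forall fun e => ?_)
  by_cases h : e.1 - s ≤ e.2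
  · exact Or.inr (aestronglyMeasurable_pastSigma (show e.1 - e.2 ≤ s by linarith) k)
  · exact Or.inl (if_neg h)

/-- As a single integral over a finite product measure, the contribution of the past is accessible
to the L¹ bounds and to the measurability of parameter integrals. -/
theorem IsStationarySolution.sum_integral_pastDrift {s t : ℝ} (hst : s ≤ t) :
    ∀ᵐ ω ∂μ, ∀ i, ∑ j, ∫ u in s..t, g (t - u) i j * ∑ k, pastDrift η (fun r => X r ω) s j k u
      = ∑ j, ∑ k, ∫ e, pastWeight η g s t i j k e * X (e.1 - e.2) ω k
        ∂((volume.restrict (Ioc s t)).prod (η j k).variation) := by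
  obtain ⟨c, hc⟩ := exists_abs_pastWeight_le hη hdet hm hg
  have hi : ∀ i j k, ∀ᵐ ω ∂μ, Integrable (fun e : ℝ × ℝ => pastWeight η g s t i j k e
      * X (e.1 - e.2) ω k) ((volume.restrict (Ioc s t)).prod (η j k).variation) := fun i j k =>
    (hX.integrable_prod_mul _ (measurable_fst.sub measurable_snd)
      (measurable_pastWeight hη hdet hm hg s t i j k) (hc s t i j k) k).prod_left_ae
  filter_upwards [hX.delayIntegrable s t, ae_all_iff.2 fun i => ae_all_iff.2 fun j =>
    ae_all_iff.2 fun k => hi i j k] with ω hd hi i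
  refine Finset.sum_congr rfl fun j _ => ?_
  simp only [Finset.mul_sum]
  rw [intervalIntegral.integral_of_le hst, integral_finsetSum _ fun k _ =>
    integrableOn_kernel_mul hdet hη hm hg (hd.integrableOn_pastDrift j k) i j t]
  refine Finset.sum_congr rfl fun k _ => ?_
  rw [integral_prod _ (hi i j k)]
  congr 1
  ext u
  rw [pastDrift, ← integral_const_mul, ← integral_indicator measurableSet_Ici]
  congr 1
  ext v
  by_cases h : u - s ≤ v
  · rw [indicator_of_mem (mem_Ici.2 h), pastWeight, if_pos h]
    ring
  · rw [indicator_of_notMem (by simpa using h), pastWeight, if_neg h, zero_mul]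

include hZ hZi

theorem IsStationarySolution.integrable_kdens_mul_noise (s t : ℝ) (i k : Fin n) :
    Integrable (fun p : ℝ × Ω => kdens η g i k (t - p.1) * (Z p.1 p.2 k - Z s p.2 k))
      ((volume.restrict (Ioc s t)).prod μ) := by
  obtain ⟨c, hc, h⟩ := exists_abs_kdens_le hdet hη hm hg
  exact (hX.integrable_noise s t hη hZ hZi k).bdd_mul (c := c)
    ((measurable_kdens hdet hη hm hg i k).comp
      (measurable_const.sub measurable_fst)).aestronglyMeasurable
    (Eventually.of_forall fun p => h i k _)

/-- Variation of constants is started at a = r − N. Its noise terms are functions of increments up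
to time s, while the terms in X_a and in the path up to a are small in L¹ for large N. -/
theorem IsStationarySolution.aestronglyMeasurable_pastIncrements {s r : ℝ} (hr : r ≤ s)
    (i : Fin n) : AEStronglyMeasurable[pastIncrements Z s] (fun ω => X r ω i) μ := by
  have hN := pastIncrements_le hZ s
  refine aestronglyMeasurable_of_approx hN (hX.integrable_apply r i) fun ε hε => ?_
  obtain ⟨c, hc, hcg⟩ := exists_abs_kernel_le hdet hη hm hg
  -- This bounds the L¹ error: the first sum comes from g(N) X_{r−N}, the double sum from the path
  -- up to r − N.
  have hlim : Tendsto (fun N : ℕ => ∑ k, c / (1 + (N : ℝ) ^ 2) * ∫ ω, |X 0 ω k| ∂μ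
      + ∑ j, ∑ k, (∫ b, |g b i j| * (η j k).variation.real (Ici (N - b)))
        * ∫ ω, |X 0 ω k| ∂μ) atTop (nhds 0) := by
    have h1 : Tendsto (fun N : ℕ => c / (1 + (N : ℝ) ^ 2)) atTop (nhds 0) :=
      tendsto_const_nhds.div_atTop (tendsto_atTop_add_const_left _ _
        ((tendsto_pow_atTop two_ne_zero).comp tendsto_natCast_atTop_atTop))
    have h2 : ∀ j k, Tendsto (fun N : ℕ =>
        ∫ b, |g b i j| * (η j k).variation.real (Ici (N - b))) atTop (nhds 0) := fun j k =>
      tendsto_integral_mul_tail (integrable_kernel hdet hη hm hg i j).abs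
    have h3 := (tendsto_finsetSum Finset.univ fun k _ =>
      h1.mul_const (∫ ω, |X 0 ω k| ∂μ)).add (tendsto_finsetSum Finset.univ fun j _ =>
        tendsto_finsetSum Finset.univ fun k _ => (h2 j k).mul_const (∫ ω, |X 0 ω k| ∂μ))
    simpa using h3
  obtain ⟨N, hNε⟩ := (hlim.eventually (gt_mem_nhds hε)).exists
  set a : ℝ := r - N
  have har : a ≤ r := sub_le_self _ (Nat.cast_nonneg N)
  have hra : r - a = N := sub_sub_cancel _ _
  have hκi := hX.integrable_kdens_mul_noise hη hdet hm hg hZ hZi a r i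
  refine ⟨fun ω => (Z r ω i - Z a ω i)
    + ∑ k, ∫ u in Ioc a r, kdens η g i k (r - u) * (Z u ω k - Z a ω k), ?_, ?_, ?_⟩
  · exact (((hZi r).eval i).sub ((hZi a).eval i)).add
      (integrable_finsetSum _ fun k _ => (hκi k).integral_prod_right)
  · refine (MSDDE.aestronglyMeasurable_pastIncrements (har.trans hr) hr i).add
      (aestronglyMeasurable_sum fun k => ?_)
    refine MSDDE.aestronglyMeasurable_integral hN (hκi k) ?_
    filter_upwards [ae_restrict_mem measurableSet_Ioc] with u hu
    exact (MSDDE.aestronglyMeasurable_pastIncrements (har.trans hr) (hu.2.trans hr) k).const_mul _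
  · have hpi := hX.integrable_past hη hdet hm hg a r i
    have hae : ∀ᵐ ω ∂μ, |X r ω i - ((Z r ω i - Z a ω i)
        + ∑ k, ∫ u in Ioc a r, kdens η g i k (r - u) * (Z u ω k - Z a ω k))|
        ≤ ∑ k, c / (1 + (N : ℝ) ^ 2) * |X a ω k| + ∑ j, ∑ k,
          |∫ e, pastWeight η g a r i j k e * X (e.1 - e.2) ω k
            ∂((volume.restrict (Ioc a r)).prod (η j k).variation)| := by
      filter_upwards [hX.variation_of_constants hη hdet hm hg hZ hZi har,
        hX.sum_integral_pastDrift hη hdet hm hg har] with ω h1 h2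
      rw [h1 i, h2 i]
      simp only [intervalIntegral.integral_of_le har]
      rw [add_sub_cancel_right]
      refine (abs_add_le _ _).trans (add_le_add ((Finset.abs_sum_le_sum_abs _ _).trans
        (Finset.sum_le_sum fun k _ => ?_)) ((Finset.abs_sum_le_sum_abs _ _).trans
        (Finset.sum_le_sum fun j _ => Finset.abs_sum_le_sum_abs _ _)))
      rw [abs_mul, ← hra]
      gcongr
      exact hcg i k _
    have hi1 : Integrable (fun ω => ∑ k, c / (1 + (N : ℝ) ^ 2) * |X a ω k|) μ :=
      integrable_finsetSum _ fun k _ => (hX.integrable_apply a k).abs.const_mul _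
    have hi2 : Integrable (fun ω => ∑ j, ∑ k,
          |∫ e, pastWeight η g a r i j k e * X (e.1 - e.2) ω k
            ∂((volume.restrict (Ioc a r)).prod (η j k).variation)|) μ :=
      integrable_finsetSum _ fun j _ => integrable_finsetSum _ fun k _ => (hpi j k).abs
    obtain ⟨d, hd⟩ := exists_abs_pastWeight_le hη hdet hm hg
    refine (integral_mono_of_nonneg (Eventually.of_forall fun ω => abs_nonneg _)
      (hi1.add hi2) hae).trans ((le_of_eq (integral_add hi1 hi2)).trans (le_trans ?_ hNε.le))
    rw [integral_finsetSum _ fun k _ => (hX.integrable_apply a k).abs.const_mul _,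
      integral_finsetSum _ fun j _ => integrable_finsetSum _ fun k _ => (hpi j k).abs]
    refine add_le_add (le_of_eq (Finset.sum_congr rfl fun k _ => ?_))
      (Finset.sum_le_sum fun j _ => ?_)
    · rw [integral_const_mul, hX.integral_abs_eq]
    · rw [integral_finsetSum _ fun k _ => (hpi j k).abs]
      refine Finset.sum_le_sum fun k _ => ?_
      refine (hX.integral_abs_integral_le _ (measurable_fst.sub measurable_snd)
        (measurable_pastWeight hη hdet hm hg a r i j k) (hd a r i j k) k).trans ?_
      refine mul_le_mul_of_nonneg_right ?_ (integral_nonneg fun ω => abs_nonneg _)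
      rw [← hra]
      exact integral_abs_pastWeight_le hη hdet hm hg a r i j k

/-- The past of the solution and the past of the noise carry the same information. -/
theorem IsStationarySolution.condExp_pastIncrements (s : ℝ) {f : Ω → ℝ} (hf : Integrable f μ) :
    μ[f | pastIncrements Z s] =ᵐ[μ] μ[f | pastSigma X s] := by
  refine condExp_ae_eq_of_ae_eq_sets (pastIncrements_le hZ s) (pastSigma_le hX.measurable s)
    (iSup₂_le fun r hr => comap_le_eventuallyMeasurableSpace ?_)
    (iSup₂_le fun r hr => comap_le_eventuallyMeasurableSpace ?_) hf
  · exact aestronglyMeasurable_pi fun k => hX.aestronglyMeasurable_noise hη (le_of_lt hr) k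
  · exact aestronglyMeasurable_pi fun k =>
      hX.aestronglyMeasurable_pastIncrements hη hdet hm hg hZ hZi hr k

end Past


/-! ### Conditioning the variation of constants formula. -/

section Prediction

open Filter

variable {n : ℕ} {Ω : Type*} {m : MeasurableSpace Ω} [m₀ : MeasurableSpace Ω] {μ : Measure Ω}
  {η : Matrix (Fin n) (Fin n) (SignedMeasure ℝ)} {Z X : ℝ → Ω → Fin n → ℝ}

theorem mulVec_delayConv_apply (g : ℝ → Matrix (Fin n) (Fin n) ℝ) (x : ℝ → Fin n → ℝ) (s t u : ℝ) (i : Fin n) :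
    (g (t - u)).mulVec (delayConv η x s u) i
      = ∑ j, g (t - u) i j * ∑ k, pastDrift η x s j k u := by
  simp only [Matrix.mulVec, dotProduct, delayConv_apply]

theorem condExp_apply {f : Ω → Fin n → ℝ} (hf : Integrable f μ) (k : Fin n) :
    (fun ω => (μ[f | m]) ω k) =ᵐ[μ] μ[fun ω => f ω k | m] :=
  (ContinuousLinearMap.proj (R := ℝ) (φ := fun _ : Fin n => ℝ) k).comp_condExp_comm hf

theorem exists_isNoisePrediction [IsFiniteMeasure μ] (hZ : Measurable fun p : ℝ × Ω => Z p.1 p.2)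
    (hZi : ∀ r, Integrable (Z r) μ) (s : ℝ) : ∃ Zhat, IsNoisePrediction μ Z s Zhat := by
  have hN := pastIncrements_le hZ s
  have hf : ∀ k, Measurable fun p : ℝ × Ω => Z p.1 p.2 k - Z s p.2 k := fun k =>
    ((measurable_pi_apply k).comp hZ).sub
      ((measurable_pi_apply k).comp (hZ.comp (measurable_const.prodMk measurable_snd)))
  choose F hFm hF using fun k => exists_measurable_condExp (μ := μ) hN (hf k)
  refine ⟨fun u ω k => F k (u, ω), measurable_pi_iff.2 fun k => hFm k, fun u _ => ?_⟩
  have hi : Integrable (fun ω => Z u ω - Z s ω) μ := (hZi u).sub (hZi s)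
  filter_upwards [ae_all_iff.2 fun k => hF k u (hi.eval k),
    ae_all_iff.2 fun k => condExp_apply (m := pastIncrements Z s) hi k] with ω h1 h2
  ext k
  exact (h1 k).trans (h2 k).symm

variable [IsProbabilityMeasure μ] {g : ℝ → Matrix (Fin n) (Fin n) ℝ}
  (hX : IsStationarySolution μ η Z X) (hη : ConcentratedOnNonneg η)
  (hdet : ∀ z : ℂ, z.re ≤ 0 → (hFun η z).det ≠ 0)
  (hm : HasMoment η 2) (hg : IsKernel η g) (hZ : Measurable fun p : ℝ × Ω => Z p.1 p.2)
  (hZi : ∀ r, Integrable (Z r) μ)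

include hη hdet hm hg

/-- The atom I δ_0 picks out v = 0, that is z_t; the density gives the integral after the
substitution u = t − v. -/
theorem kernelConv_eq (hbv : ∀ j k, BoundedVariationOn (fun r => g r j k) univ)
    {z : ℝ → Fin n → ℝ} {s t : ℝ} (hst : s < t) (hz : ∀ k, Measurable fun u => z u k)
    (hzi : ∀ k, IntegrableOn (fun u => z u k) (Ioc s t)) :
    (∀ j k, VectorMeasure.IntegrableOn (hbv j k).vectorMeasure (fun v => z (t - v) k)
      (Ico 0 (t - s))) ∧
    ∀ i, kernelConv g hbv z s t i
      = z t i + ∑ k, ∫ u in s..t, kdens η g i k (t - u) * z u k := by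
  have hi : ∀ k, IntegrableOn (fun v => z (t - v) k) (Ioc 0 (t - s)) := fun k => by
    have h := ((intervalIntegrable_iff_integrableOn_Ioc_of_le hst.le).2 (hzi k)).comp_sub_left t
    rw [sub_self] at h
    exact (intervalIntegrable_iff_integrableOn_Ioc_of_le (sub_nonneg.2 hst.le)).1 h.symm
  have h := fun i k => integrableOn_kernelMeasure hdet hη hm hg (i := i) (k := k)
    (T := t - s) ((hz k).comp (measurable_const.sub measurable_id)) (hi k)
  simp only [kernelConv, vectorMeasure_kernel hdet hη hm hg]
  refine ⟨fun j k => (h j k).1, fun i => ?_⟩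
  refine (Finset.sum_congr rfl fun k _ => (h i k).2 (sub_pos.2 hst)).trans ?_
  rw [Finset.sum_add_distrib]
  congr 1
  · simp [Matrix.one_apply]
  · refine Finset.sum_congr rfl fun k _ => ?_
    have h' := intervalIntegral.integral_comp_sub_left (a := s) (b := t)
      (fun v => kdens η g i k v * z (t - v) k) t
    simp only [sub_sub_cancel, sub_self] at h'
    exact h'.symm

theorem DelayIntegrable.integrableOn_kernel_mul_pastDrift {x : ℝ → Fin n → ℝ} {s t : ℝ}
    (hx : DelayIntegrable η x s t) (i j : Fin n) :
    IntegrableOn (fun u => g (t - u) i j * ∑ k, pastDrift η x s j k u) (Ioc s t) :=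
  integrableOn_kernel_mul hdet hη hm hg
    (integrable_finsetSum _ fun k _ => hx.integrableOn_pastDrift j k) i j t

theorem DelayIntegrable.intervalIntegrable_mulVec {x : ℝ → Fin n → ℝ} {s t : ℝ}
    (hx : DelayIntegrable η x s t) (hst : s ≤ t) :
    IntervalIntegrable (fun u => (g (t - u)).mulVec (delayConv η x s u)) volume s t ∧
    ∀ i, (∫ u in s..t, (g (t - u)).mulVec (delayConv η x s u)) i
      = ∑ j, ∫ u in s..t, g (t - u) i j * ∑ k, pastDrift η x s j k u := by
  have hi : ∀ i, IntegrableOn (fun u => (g (t - u)).mulVec (delayConv η x s u) i) (Ioc s t) :=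
    fun i => by
      simp only [mulVec_delayConv_apply]
      exact integrable_finsetSum _ fun j _ =>
        hx.integrableOn_kernel_mul_pastDrift hη hdet hm hg i j
  refine ⟨(intervalIntegrable_iff_integrableOn_Ioc_of_le hst).2 (Integrable.of_eval hi),
    fun i => ?_⟩
  simp only [intervalIntegral.integral_of_le hst]
  rw [eval_integral hi]
  simp only [mulVec_delayConv_apply]
  exact integral_finsetSum _ fun j _ => hx.integrableOn_kernel_mul_pastDrift hη hdet hm hg i j

include hX hZ hZi

/-- Here the σ-algebras are exchanged: the noise prediction is defined through the past increments
of Z, whereas the formula conditions on the past of X. -/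
theorem IsNoisePrediction.ae_eq_condExp {s : ℝ} {Zhat : ℝ → Ω → Fin n → ℝ}
    (h : IsNoisePrediction μ Z s Zhat) {u : ℝ} (hu : s < u) (k : Fin n) :
    (fun ω => Zhat u ω k) =ᵐ[μ] μ[fun ω => Z u ω k - Z s ω k | pastSigma X s] := by
  have hi : Integrable (fun ω => Z u ω - Z s ω) μ := (hZi u).sub (hZi s)
  refine EventuallyEq.trans ?_ ((condExp_apply (m := pastIncrements Z s) hi k).trans
    (hX.condExp_pastIncrements hη hdet hm hg hZ hZi s (hi.eval k)))
  filter_upwards [h.ae_eq u hu] with ω hω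
  rw [hω]

theorem IsNoisePrediction.integrable_prod {s : ℝ} {Zhat : ℝ → Ω → Fin n → ℝ}
    (h : IsNoisePrediction μ Z s Zhat) (t : ℝ) (k : Fin n) :
    Integrable (fun p : ℝ × Ω => Zhat p.1 p.2 k) ((volume.restrict (Ioc s t)).prod μ) := by
  refine integrable_prod_of_condExp (m := pastSigma X s)
    (Y := fun u ω => Z u ω k - Z s ω k) (Y' := fun u ω => Zhat u ω k) (hX.integrable_noise s t hη hZ hZi k)
    ((measurable_pi_apply k).comp h.measurable).aestronglyMeasurable ?_
  filter_upwards [ae_restrict_mem measurableSet_Ioc] with u hu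
  exact h.ae_eq_condExp hX hη hdet hm hg hZ hZi hu.1 k

/-- The prediction formula, componentwise and with the kernel density. -/
theorem IsStationarySolution.condExp_eq {s t : ℝ} (hst : s < t) {Zhat : ℝ → Ω → Fin n → ℝ}
    (h : IsNoisePrediction μ Z s Zhat) (i : Fin n) :
    μ[fun ω => X t ω i | pastSigma X s] =ᵐ[μ] fun ω => ∑ k, g (t - s) i k * X s ω k
      + (∑ j, ∫ u in s..t, g (t - u) i j * ∑ k, pastDrift η (fun r => X r ω) s j k u)
      + (Zhat t ω i + ∑ k, ∫ u in s..t, kdens η g i k (t - u) * Zhat u ω k) := by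
  have hS := pastSigma_le hX.measurable s
  -- `A` is determined by the past of X and so is fixed by the conditioning; `B` and the `C k` carry
  -- the noise after time s.
  set A : Ω → ℝ := fun ω => ∑ k, g (t - s) i k * X s ω k
    + ∑ j, ∑ k, ∫ e, pastWeight η g s t i j k e * X (e.1 - e.2) ω k
      ∂((volume.restrict (Ioc s t)).prod (η j k).variation)
  have hAm : AEStronglyMeasurable[pastSigma X s] A μ :=
    (aestronglyMeasurable_sum fun k => (aestronglyMeasurable_pastSigma le_rfl k).const_mul _).add
      (aestronglyMeasurable_sum fun j => aestronglyMeasurable_sum fun k =>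
        hX.aestronglyMeasurable_past hη hdet hm hg s t i j k)
  have hAi : Integrable A μ :=
    (integrable_finsetSum _ fun k _ => (hX.integrable_apply s k).const_mul _).add
      (integrable_finsetSum _ fun j _ => integrable_finsetSum _ fun k _ =>
        hX.integrable_past hη hdet hm hg s t i j k)
  set B : Ω → ℝ := fun ω => Z t ω i - Z s ω i
  have hBi : Integrable B μ := ((hZi t).eval i).sub ((hZi s).eval i)
  have hκi := hX.integrable_kdens_mul_noise hη hdet hm hg hZ hZi s t i
  set C : Fin n → Ω → ℝ := fun k ω =>
    ∫ u in Ioc s t, kdens η g i k (t - u) * (Z u ω k - Z s ω k)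
  have hCi : ∀ k, Integrable (C k) μ := fun k => (hκi k).integral_prod_right
  have hC : ∀ k, μ[C k | pastSigma X s] =ᵐ[μ] fun ω =>
      ∫ u in Ioc s t, kdens η g i k (t - u) * Zhat u ω k := fun k => by
    refine condExp_integral hS (hκi k) ?_ ?_
    · exact (((measurable_kdens hdet hη hm hg i k).comp (measurable_const.sub measurable_fst)).mul
        ((measurable_pi_apply k).comp h.measurable)).aestronglyMeasurable
    · filter_upwards [ae_restrict_mem measurableSet_Ioc] with u hu
      have h1 := condExp_smul (μ := μ) (kdens η g i k (t - u))
        (fun ω => Z u ω k - Z s ω k) (pastSigma X s)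
      filter_upwards [h.ae_eq_condExp hX hη hdet hm hg hZ hZi hu.1 k, h1] with ω h2 h3
      refine Eq.trans ?_ h3.symm
      rw [h2]
      rfl
  have hX' : (fun ω => X t ω i) =ᵐ[μ] A + (B + ∑ k, C k) := by
    filter_upwards [hX.variation_of_constants hη hdet hm hg hZ hZi hst.le,
      hX.sum_integral_pastDrift hη hdet hm hg hst.le] with ω h1 h2
    rw [h1 i, h2 i]
    simp only [intervalIntegral.integral_of_le hst.le, Pi.add_apply, Finset.sum_apply, A, B, C]
  have hCs : Integrable (∑ k, C k) μ := integrable_finsetSum' _ fun k _ => hCi k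
  have e1 := condExp_congr_ae (m := pastSigma X s) hX'
  have e2 := condExp_add hAi (hBi.add hCs) (pastSigma X s)
  have e3 := condExp_add hBi hCs (pastSigma X s)
  have e4 := condExp_finsetSum (μ := μ) (s := Finset.univ) (f := C) (fun k _ => hCi k)
    (pastSigma X s)
  filter_upwards [e1, e2, e3, e4, condExp_of_aestronglyMeasurable' hS hAm hAi,
    h.ae_eq_condExp hX hη hdet hm hg hZ hZi hst i, ae_all_iff.2 hC,
    hX.sum_integral_pastDrift hη hdet hm hg hst.le] with ω e1 e2 e3 e4 e5 e6 e7 e8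
  rw [e1, e2, Pi.add_apply, e3, Pi.add_apply, e4, Finset.sum_apply, e5, e8 i, e6,
    Finset.sum_congr rfl fun k _ => e7 k]
  simp only [intervalIntegral.integral_of_le hst.le, A, B]

end Prediction

end MSDDE

/-! ### The prediction formula. -/

theorem mainTheorem2 {n : ℕ} {Ω : Type*} [MeasurableSpace Ω] (μ : Measure Ω)
    [IsProbabilityMeasure μ]
    (η : Matrix (Fin n) (Fin n) (SignedMeasure ℝ))
    (hη_supp : MSDDE.ConcentratedOnNonneg η) (hη_moment : MSDDE.HasMoment η 2)
    (hdet : ∀ z : ℂ, z.re ≤ 0 → (MSDDE.hFun η z).det ≠ 0)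
    (Z : ℝ → Ω → Fin n → ℝ) (hZ_meas : Measurable (fun p : ℝ × Ω => Z p.1 p.2))
    (hZ_int : ∀ r, Integrable (Z r) μ) (hZ_inc : MSDDE.HasStationaryIncrements μ Z)
    (X : ℝ → Ω → Fin n → ℝ) (hX : MSDDE.IsStationarySolution μ η Z X)
    (g : ℝ → Matrix (Fin n) (Fin n) ℝ) (hg : MSDDE.IsKernel η g)
    (s t : ℝ) (hst : s < t) :
    ∃ hbv : ∀ j k, BoundedVariationOn (fun r => g r j k) univ,
      (∃ Zhat : ℝ → Ω → Fin n → ℝ, MSDDE.IsNoisePrediction μ Z s Zhat) ∧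
      ∀ Zhat : ℝ → Ω → Fin n → ℝ, MSDDE.IsNoisePrediction μ Z s Zhat →
        (∀ᵐ ω ∂μ,
          (∀ᵐ u ∂(volume.restrict (Ioc s t)), ∀ j k,
            VectorMeasure.IntegrableOn (η j k) (fun v => X (u - v) ω k) (Ici (u - s))) ∧
          IntervalIntegrable
            (fun u => (g (t - u)).mulVec (MSDDE.delayConv η (fun r => X r ω) s u)) volume s t ∧
          ∀ j k, VectorMeasure.IntegrableOn ((hbv j k).vectorMeasure)
            (fun v => Zhat (t - v) ω k) (Ico (0 : ℝ) (t - s))) ∧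
        μ[X t | MSDDE.pastSigma X s] =ᵐ[μ] fun ω =>
          (g (t - s)).mulVec (X s ω)
            + (∫ u in s..t, (g (t - u)).mulVec (MSDDE.delayConv η (fun r => X r ω) s u))
            + MSDDE.kernelConv g hbv (fun r => Zhat r ω) s t := by
  refine ⟨MSDDE.boundedVariationOn_kernel hdet hη_supp hη_moment hg,
    MSDDE.exists_isNoisePrediction hZ_meas hZ_int s, fun Zhat hZhat => ?_⟩
  have hd := hX.delayIntegrable s t
  have hzi := ae_all_iff.2 fun k => (hZhat.integrable_prod hX hη_supp hdet hη_moment hg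
    hZ_meas hZ_int t k).prod_left_ae
  have hzm : ∀ ω k, Measurable fun u => Zhat u ω k := fun ω k =>
    (measurable_pi_apply k).comp (hZhat.measurable.comp measurable_prodMk_right)
  refine ⟨?_, ?_⟩
  · filter_upwards [hd, hzi] with ω hd hzi
    refine ⟨?_, (hd.intervalIntegrable_mulVec hη_supp hdet hη_moment hg hst.le).1,
      (MSDDE.kernelConv_eq hη_supp hdet hη_moment hg _ hst (z := fun r => Zhat r ω)
        (hzm ω) hzi).1⟩
    filter_upwards [ae_all_iff.2 fun j => ae_all_iff.2 fun k => hd.ae_integrable j k]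
      with u hu j k
    exact (MSDDE.integrableOn_signedMeasure_iff _ measurableSet_Ici _).2 (hu j k).integrableOn
  -- The vector-valued conditional expectation is read componentwise; the finitely many exceptional
  -- null sets are merged into one.
  · filter_upwards [hd, hzi, ae_all_iff.2 fun k => MSDDE.condExp_apply (hX.integrable t) k,
      ae_all_iff.2 fun i => hX.condExp_eq hη_supp hdet hη_moment hg hZ_meas hZ_int hst hZhat i]
      with ω hd hzi h1 h2
    ext i
    rw [h1 i, h2 i, Pi.add_apply, Pi.add_apply,
      (MSDDE.kernelConv_eq hη_supp hdet hη_moment hg _ hst (z := fun r => Zhat r ω)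
        (hzm ω) hzi).2 i, (hd.intervalIntegrable_mulVec hη_supp hdet hη_moment hg hst.le).2 i]
    rfl
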